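/- **Setting.** Let $\mathbb T^3=(-\pi,\pi)^3$ with periodic boundary conditions. For a vector field $v=\sum_{k\in\mathbb Z^3}\hat v_k e^{ik\cdot x}$ on $\mathbb T^3$ put $$\|v\|_{H^r}^2=\sum_{k}(1+|k|^2)^r|\hat v_k|^2,\qquad \|v\|_{\mathcal G^s_{r,\tau}}^2=\sum_{k}|k|^{2r}e^{2\tau|k|^{1/s}}|\hat v_k|^2 .$$ $\mathcal H^r$ is the space of real vector fields with $\hat v_0=0$, $k\cdot\hat v_k=0$ for all $k$ (i.e. $\nabla\cdot v=0$) and $\|v\|_{H^r}<\infty$; $\mathcal G^s_{r,\tau}$ is the space of $v\in\mathcal H^r$ with $\|v\|_{\mathcal G^s_{r,\tau}}<\infty$. Let $\mathbb P$ be the Leray projector ($\mathbb Pv=v_1$ where $v=v_1+\nabla q$, $\nabla\cdot v_1=0$, $\langle v_1,\nabla q\rangle_{L^2}=0$) and $A=-\mathbb P\Delta$. Consider the projected Navier–Stokes equation $$\tfrac{d}{dt}u^\nu+\nu Au^\nu+\mathbb P(u^\nu\cdot\nabla u^\nu)=0,\qquad u^\nu(0)=\mathbb Pa\qquad\text{(PNS)}$$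 with $\nu>0$, and the projected Euler equation (PE), which is the same equation with $\nu=0$. A solution on $[0,T]$ is a function in $C([0,T];\mathcal H^r)$ satisfying the equation; for $\nu\ge 0$ let $T_*(\nu)$ be the maximal time of existence of the $\mathcal H^r$ solution with viscosity $\nu$ and initial datum $a$. **Proposition 3.2.** Let $r>9/2$, $s\ge1$, $\tau_0>0$, $a\in\mathcal G^s_{r,\tau_0}(\mathbb T^3)$, and let $T>0$ be such that $T<T_*(\nu)$ for every $\nu\ge0$. Then there are constants $C_1,C_2,G_T,M_T>0$, depending on $a,r,s,\tau_0,T$ but not on $\nu$, such that, with $$\tau(t)=\frac{1}{e^{C_1t}\frac1{\tau_0}+\frac{C_2}{C_1}\left(e^{C_1t}-1\right)},$$ which is a positive, differentiable, decreasing function on $[0,T]$ with $\tau(0)=\tau_0$, the following holds. (i) For every $\nu>0$, if $u^\nu\in L^\infty([0,T];\mathcal G^s_{r,\tau(\cdot)})\cap L^2([0,T];\mathcal G^s_{r+1,\tau(\cdot)})$ is the solution of (PNS) on $[0,T]$, then for all $0<t\le T$ $$\|u^\nu(t)\|_{\mathcal G^s_{r,\tau(t)}}\le G_T,\qquad \nu\int_0^t\|u^\nu(t')\|_{\mathcal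 G^s_{r+1,\tau(t')}}^2\,dt'\le M_T .$$ (ii) If $u\in L^\infty([0,T];\mathcal G^s_{r+1,\tau(\cdot)})$ is the solution of (PE) on $[0,T]$, then $\|u(t)\|_{\mathcal G^s_{r,\tau(t)}}\le G_T$ for all $0<t\le T$. -/

import Mathlib

open MeasureTheory Set Filter Topology
open scoped ENNReal

noncomputable section

namespace GevreyNS

/-- The physical space `ℝ³` with its Euclidean norm. -/
abbrev R3 : Type := EuclideanSpace ℝ (Fin 3)

/-- The period cell `(-π, π)³`, representing the torus `𝕋³`. -/
def cell : Set R3 := {x | ∀ i, x i ∈ Ioo (-Real.pi) Real.pi}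

/-- `2π`-periodicity in each of the three variables, i.e. being a function on `𝕋³`. -/
def IsPeriodic {F : Type*} (f : R3 → F) : Prop :=
  ∀ (x : R3) (i : Fin 3), f (x + EuclideanSpace.single i (2 * Real.pi)) = f x

/-- The Euclidean length `|k|` of a frequency `k ∈ ℤ³`. -/
def freqNorm (k : Fin 3 → ℤ) : ℝ := Real.sqrt (∑ i, (k i : ℝ) ^ 2)

/-- The Fourier coefficient `v̂ₖ = (2π)⁻³ ∫ v(x) e^{-i k·x} dx ∈ ℂ³` of a vector field on `𝕋³`. -/
def vecFourierCoeff (v : R3 → R3) (k : Fin 3 → ℤ) : EuclideanSpace ℂ (Fin 3) :=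
  WithLp.toLp 2 fun i =>
    (((2 * Real.pi) ^ 3 : ℝ) : ℂ)⁻¹ *
      ∫ x in cell, Complex.exp (-(Complex.I * ∑ j, (k j : ℂ) * (x j : ℂ))) * (v x i : ℂ)

/-- `‖v‖_{H^r} = (∑ₖ (1+|k|²)^r |v̂ₖ|²)^{1/2} ∈ [0,∞]`. -/
def sobolevNorm (r : ℝ) (v : R3 → R3) : ℝ≥0∞ :=
  (∑' k : Fin 3 → ℤ,
    ENNReal.ofReal ((1 + freqNorm k ^ 2) ^ r * ‖vecFourierCoeff v k‖ ^ 2)) ^ (1 / 2 : ℝ)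

/-- `‖v‖_{𝒢^s_{r,τ}} = (∑ₖ |k|^{2r} e^{2τ|k|^{1/s}} |v̂ₖ|²)^{1/2} ∈ [0,∞]`. -/
def gevreyNorm (s r τ : ℝ) (v : R3 → R3) : ℝ≥0∞ :=
  (∑' k : Fin 3 → ℤ,
    ENNReal.ofReal (freqNorm k ^ (2 * r) * Real.exp (2 * τ * freqNorm k ^ (1 / s)) *
      ‖vecFourierCoeff v k‖ ^ 2)) ^ (1 / 2 : ℝ)

/-- Membership in `ℋ^r(𝕋³)`: real, periodic, mean-zero, divergence-free (`k · v̂ₖ = 0`) vector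
fields of finite `H^r` norm. An element is represented by its continuous representative, which
exists as soon as `r > 3/2` (only such `r` are used). The condition that `v̂ₖ` and `v̂₋ₖ` are
complex conjugates holds because `v` takes real values. -/
structure MemSobolev (r : ℝ) (v : R3 → R3) : Prop where
  periodic : IsPeriodic v
  continuous : Continuous v
  mean_zero : vecFourierCoeff v 0 = 0
  div_free : ∀ k : Fin 3 → ℤ, ∑ i, (k i : ℂ) * vecFourierCoeff v k i = 0
  norm_lt_top : sobolevNorm r v < ∞

/-- Membership in the Gevrey space `𝒢^s_{r,τ}(𝕋³)`. -/
def MemGevrey (s r τ : ℝ) (v : R3 → R3) : Prop :=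
  MemSobolev r v ∧ gevreyNorm s r τ v < ∞

/-- `u ∈ L^∞([0,T]; 𝒢^s_{r,τ(·)})`. -/
def MemLinftyGevrey (s r T : ℝ) (τ : ℝ → ℝ) (u : ℝ → R3 → R3) : Prop :=
  ∃ B : ℝ, ∀ᵐ t ∂(volume.restrict (Icc 0 T)),
    MemGevrey s r (τ t) (u t) ∧ gevreyNorm s r (τ t) (u t) ≤ ENNReal.ofReal B

/-- `u ∈ L²([0,T]; 𝒢^s_{r,τ(·)})`. -/
def MemL2Gevrey (s r T : ℝ) (τ : ℝ → ℝ) (u : ℝ → R3 → R3) : Prop :=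
  (∀ᵐ t ∂(volume.restrict (Icc 0 T)), MemGevrey s r (τ t) (u t)) ∧
    ∫⁻ t in Icc 0 T, gevreyNorm s r (τ t) (u t) ^ 2 < ∞

/-- The divergence `∇ · w`. -/
def divergence (w : R3 → R3) (x : R3) : ℝ :=
  ∑ i, (fderiv ℝ w x (EuclideanSpace.single i 1)) i

/-- `w = ℙ v` for the Leray projector `ℙ`: `v = w + ∇q` with `w` divergence free, `q` a scalar
function on `𝕋³` and `⟨w, ∇q⟩ = 0`. (It determines `w` uniquely.) -/
def IsLerayProjection (v w : R3 → R3) : Prop :=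
  IsPeriodic w ∧ ContDiff ℝ 1 w ∧ (∀ x, divergence w x = 0) ∧
    ∃ q : R3 → ℝ, IsPeriodic q ∧ ContDiff ℝ 1 q ∧ (∀ x, v x = w x + gradient q x) ∧
      ∫ x in cell, inner ℝ (w x) (gradient q x) = 0

/-- The convection term `(v · ∇) v`. -/
def convection (v : R3 → R3) (x : R3) : R3 := fderiv ℝ v x (v x)

/-- `u ∈ C([0,T]; ℋ^r)` solves `∂ₜu + ν A u + ℙ(u · ∇u) = 0`, `u(0) = ℙ a` on `[0,T]`, where
`A = -ℙΔ` is the Stokes operator. For `ν > 0` this is the projected Navier-Stokes equation, for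
`ν = 0` the projected Euler equation. In the regularity range considered (`r > 9/2`) the fields
`u(t)` are of class `C³` and all terms are continuous functions; the equation holds pointwise,
with one-sided time derivatives at the end points. -/
structure IsSolution (ν r T : ℝ) (a : R3 → R3) (u : ℝ → R3 → R3) : Prop where
  mem : ∀ t ∈ Icc 0 T, MemSobolev r (u t)
  continuous_in_time : ∀ t ∈ Icc 0 T,
    Tendsto (fun t' => sobolevNorm r (u t' - u t)) (𝓝[Icc 0 T] t) (𝓝 0)
  initial : IsLerayProjection a (u 0)
  equation : ∀ t ∈ Icc 0 T, ∃ Au N : R3 → R3,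
    IsLerayProjection (fun x => -(Laplacian.laplacian (u t) x)) Au ∧
    IsLerayProjection (convection (u t)) N ∧
    ∀ x, HasDerivWithinAt (fun t' => u t' x) (-(ν • Au x) - N x) (Icc 0 T) t

/-- The maximal time of existence, in `[0,∞]`, of the `H^r` solution with viscosity `ν` and
initial datum `a`. -/
def lifespan (ν r : ℝ) (a : R3 → R3) : ℝ≥0∞ :=
  ⨆ (T : ℝ) (_ : 0 < T ∧ ∃ u : ℝ → R3 → R3, IsSolution ν r T a u), ENNReal.ofReal T

/-- The Gevrey radius `τ(t) = 1 / (e^{C₁t}/τ₀ + (C₂/C₁)(e^{C₁t} - 1))`. -/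
def radius (C₁ C₂ τ₀ t : ℝ) : ℝ :=
  1 / (Real.exp (C₁ * t) * (1 / τ₀) + C₂ / C₁ * (Real.exp (C₁ * t) - 1))

end GevreyNS

end

open GevreyNS

/-!
The unknown is studied through its Fourier coefficients. For coefficients that decay like
`e^{-ρ|k|^p}`, `p = 1/s`, all sums below converge absolutely and may be differentiated in time term
by term, so the Gevrey energy `X = ∑ |k|^{2r} e^{2σ|k|^p} |û_k|²` with a time dependent radius
`σ(t)` satisfies `X' = 2σ' Y - 2ν Z - 2 (production)`, where `Y` and `Z` are the energies with `r`
replaced by `r + p/2` and `r + 1` (`FourierSolution.hasDerivAt_gev`).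

Since `u` is real and divergence free, transport of the weighted field by `u` is skew-adjoint
(`re_tsum_transportTerm`), so that only a commutator of the weight remains. Its pointwise bound
`weight_commutator_le` yields `exists_production_le`: the production is at most `C ‖u‖_{H^r} X + C
(σ ‖u‖_{H^r} + σ² √X) Y`. The radius `τ` of the statement solves `τ' = -(C₁ τ + C₂ τ²)`, so that
the term `2σ' Y` absorbs the part of the production with `Y`. What is left is a linear differential
inequality for `X`, valid as long as `X` stays below a threshold, and a continuity argument
(`bootstrap`) shows that it always does. Integrating the inequality once more bounds the
dissipation (`FourierSolution.gev_le_and_integral_le`).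

Two points need care. First, the constants must not depend on `ν`, so an `H^r` bound uniform in `ν`
is needed on all of `[0,T]` (`exists_energy_le`). For large `ν` the `H^r` norm does not increase.
Near a given viscosity `μ`, the solutions are close to the one for `μ` in `L²`
(`FourierSolution.sq_norm_sub_le`); closeness in `L²` and boundedness in `H^r` give closeness in
the norm `∑ |k| |û_k|`, which drives the `H^r` energy inequality, and a continuity argument closes
the estimate. Compactness of bounded intervals of viscosities does the rest.
Second, the hypothesis on `u` only gives a bound for the norm of radius `τ`, not the decay needed
for the energy identity. The estimate is therefore applied with the radius `θ τ`, `θ < 1`, for which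
the decay is available and the same differential inequality holds, and `θ → 1` by Fatou's lemma
(`IsSolution.gevrey_bounds`).
-/

namespace GevreyNS

/-! ### Characters and Fourier coefficients on `ℝ³` -/

/-- The phase `x ↦ k·x` as a continuous linear functional. -/
noncomputable def phase (k : Fin 3 → ℤ) : R3 →L[ℝ] ℝ := ∑ j, (k j : ℝ) • EuclideanSpace.proj j

lemma phase_apply (k : Fin 3 → ℤ) (x : R3) : phase k x = ∑ j, (k j : ℝ) * x j := by
  simp [phase]

/-- The character `e^{ik·x}`. -/
noncomputable def expo (k : Fin 3 → ℤ) (x : R3) : ℂ :=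
  Complex.exp (Complex.I * ∑ j, (k j : ℂ) * (x j : ℂ))

lemma expo_eq (k : Fin 3 → ℤ) (x : R3) : expo k x = Complex.exp (Complex.I * (phase k x : ℂ)) := by
  simp [expo, phase_apply]

/-- The scalar Fourier coefficient `(2π)⁻³ ∫ f(x) e^{-ik·x} dx`. -/
noncomputable def coef (f : R3 → ℂ) (k : Fin 3 → ℤ) : ℂ :=
  (((2 * Real.pi) ^ 3 : ℝ) : ℂ)⁻¹ *
    ∫ x in cell, Complex.exp (-(Complex.I * ∑ j, (k j : ℂ) * (x j : ℂ))) * f x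

lemma vecFourierCoeff_apply (v : R3 → R3) (k : Fin 3 → ℤ) (i : Fin 3) :
    vecFourierCoeff v k i = coef (fun x => (v x i : ℂ)) k := rfl

lemma norm_expo (k : Fin 3 → ℤ) (x : R3) : ‖expo k x‖ = 1 := by
  rw [expo_eq, mul_comm, Complex.norm_exp_ofReal_mul_I]

lemma contDiff_expo (k : Fin 3 → ℤ) {n : WithTop ℕ∞} : ContDiff ℝ n (expo k) := by
  have : expo k = fun x => Complex.exp (Complex.I * (phase k x : ℂ)) := funext (expo_eq k)
  rw [this]
  have h1 : ContDiff ℝ n (fun x => ((phase k x : ℝ) : ℂ)) :=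
    Complex.ofRealCLM.contDiff.comp (phase k).contDiff
  exact (contDiff_const.mul h1).cexp

lemma continuous_expo (k : Fin 3 → ℤ) : Continuous (expo k) :=
  (contDiff_expo k (n := 0)).continuous

lemma expo_add (j k : Fin 3 → ℤ) (x : R3) : expo (j + k) x = expo j x * expo k x := by
  rw [expo_eq, expo_eq, expo_eq, ← Complex.exp_add]
  congr 1
  simp only [phase_apply, Pi.add_apply]
  push_cast
  simp only [add_mul, Finset.sum_add_distrib]
  ring

lemma expo_neg_eq (k : Fin 3 → ℤ) (x : R3) :
    expo (-k) x = Complex.exp (-(Complex.I * ∑ j, (k j : ℂ) * (x j : ℂ))) := by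
  simp [expo]

lemma coef_eq (f : R3 → ℂ) (k : Fin 3 → ℤ) :
    coef f k = (((2 * Real.pi) ^ 3 : ℝ) : ℂ)⁻¹ * ∫ x in cell, expo (-k) x * f x := by
  simp only [coef, expo_neg_eq]

lemma isPeriodic_expo (k : Fin 3 → ℤ) : IsPeriodic (expo k) := by
  intro x i
  rw [expo_eq, expo_eq, map_add]
  have : phase k (EuclideanSpace.single i (2 * Real.pi)) = k i * (2 * Real.pi) := by
    simp [phase_apply]
  rw [this]
  push_cast
  rw [mul_add, Complex.exp_add]
  have : Complex.exp (Complex.I * (k i * (2 * Real.pi))) = 1 := by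
    rw [Complex.exp_eq_one_iff]
    exact ⟨k i, by ring⟩
  rw [this, mul_one]

lemma hasFDerivAt_expo (k : Fin 3 → ℤ) (x : R3) :
    HasFDerivAt (expo k) ((Complex.I * expo k x) • (Complex.ofRealCLM.comp (phase k))) x := by
  have h1 : HasFDerivAt (fun x => Complex.I * ((phase k x : ℝ) : ℂ))
      (Complex.I • (Complex.ofRealCLM.comp (phase k))) x :=
    ((Complex.ofRealCLM.comp (phase k)).hasFDerivAt).const_mul Complex.I
  have h2 := h1.cexp
  have : expo k = fun x => Complex.exp (Complex.I * (phase k x : ℂ)) := funext (expo_eq k)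
  rw [this]
  refine h2.congr_fderiv ?_
  rw [smul_smul, mul_comm]

lemma norm_phase_le (k : Fin 3 → ℤ) : ‖phase k‖ ≤ freqNorm k := by
  refine ContinuousLinearMap.opNorm_le_bound _ (Real.sqrt_nonneg _) fun x => ?_
  have h := real_inner_le_norm (WithLp.toLp 2 (fun i => (k i : ℝ)) : R3) x
  have h' := abs_real_inner_le_norm (WithLp.toLp 2 (fun i => (k i : ℝ)) : R3) x
  have e1 : inner ℝ (WithLp.toLp 2 (fun i => (k i : ℝ)) : R3) x = phase k x := by
    simp [phase_apply, PiLp.inner_apply, mul_comm]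
  have e2 : ‖(WithLp.toLp 2 (fun i => (k i : ℝ)) : R3)‖ = freqNorm k := by
    simp [EuclideanSpace.norm_eq, freqNorm]
  rw [e1, e2] at h'
  exact h'

/-! ### Integration over the period cell and Fourier series on the torus -/

lemma cell_preimage : (WithLp.toLp 2 : (Fin 3 → ℝ) → R3) ⁻¹' cell =
    univ.pi fun _ => Ioo (-Real.pi) Real.pi := by
  ext y; simp [cell]

lemma setIntegral_cell (g : R3 → ℂ) : ∫ x in cell, g x =
    ∫ y in Icc (fun _ => -Real.pi) (fun _ => Real.pi), g (WithLp.toLp 2 y : R3) := by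
  rw [← (PiLp.volume_preserving_toLp (Fin 3)).setIntegral_preimage_emb
    (MeasurableEquiv.toLp 2 (Fin 3 → ℝ)).measurableEmbedding, cell_preimage]
  exact setIntegral_congr_set Measure.univ_pi_Ioo_ae_eq_Icc

lemma cell_subset : cell ⊆ Metric.closedBall 0 (Real.sqrt (3 * Real.pi ^ 2)) := by
  intro x hx
  rw [mem_closedBall_zero_iff, EuclideanSpace.norm_eq]
  apply Real.sqrt_le_sqrt
  calc ∑ i, ‖x i‖ ^ 2 ≤ ∑ _i : Fin 3, Real.pi ^ 2 := by
        refine Finset.sum_le_sum fun i _ => ?_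
        rw [Real.norm_eq_abs, sq_abs]
        exact sq_le_sq' (hx i).1.le (hx i).2.le
    _ = 3 * Real.pi ^ 2 := by simp

lemma integrableOn_cell {F : Type*} [NormedAddCommGroup F] {g : R3 → F} (hg : Continuous g) :
    IntegrableOn g cell :=
  (hg.continuousOn.integrableOn_compact (isCompact_closedBall 0 _)).mono_set cell_subset

lemma volume_cell_lt_top : volume cell < ∞ :=
  (measure_mono cell_subset).trans_lt measure_closedBall_lt_top

lemma single_add' (i : Fin 3) (a b : ℝ) : (EuclideanSpace.single i (a + b) : R3) =
    EuclideanSpace.single i a + EuclideanSpace.single i b := by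
  ext j
  by_cases h : j = i <;> simp [h]

lemma IsPeriodic.add_zsmul {F : Type*} {f : R3 → F} (hf : IsPeriodic f) (i : Fin 3) (n : ℤ)
    (x : R3) : f (x + EuclideanSpace.single i (n * (2 * Real.pi))) = f x := by
  induction n using Int.induction_on generalizing x with
  | zero =>
    have : (EuclideanSpace.single i (((0 : ℤ) : ℝ) * (2 * Real.pi)) : R3) = 0 := by ext j; simp
    rw [this, add_zero]
  | succ n ih =>
    have : x + EuclideanSpace.single i (((n + 1 : ℤ) : ℝ) * (2 * Real.pi)) =
        (x + EuclideanSpace.single i (((n : ℤ) : ℝ) * (2 * Real.pi))) +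
          EuclideanSpace.single i (2 * Real.pi) := by
      rw [add_assoc, ← single_add']; push_cast; ring_nf
    rw [this, hf, ih]
  | pred n ih =>
    rw [← hf]
    have : x + EuclideanSpace.single i (((-n - 1 : ℤ) : ℝ) * (2 * Real.pi)) +
          EuclideanSpace.single i (2 * Real.pi) =
        x + EuclideanSpace.single i (((-n : ℤ) : ℝ) * (2 * Real.pi)) := by
      rw [add_assoc, ← single_add']; push_cast; ring_nf
    rw [this, ih]

lemma IsPeriodic.add_lattice {F : Type*} {f : R3 → F} (hf : IsPeriodic f) (n : Fin 3 → ℤ)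
    (x : R3) : f (x + WithLp.toLp 2 fun i => n i * (2 * Real.pi)) = f x := by
  have : x + WithLp.toLp 2 (fun i => n i * (2 * Real.pi)) =
      ((x + EuclideanSpace.single 0 (n 0 * (2 * Real.pi))) +
        EuclideanSpace.single 1 (n 1 * (2 * Real.pi))) +
          EuclideanSpace.single 2 (n 2 * (2 * Real.pi)) := by
    ext i; fin_cases i <;> simp
  rw [this, hf.add_zsmul, hf.add_zsmul, hf.add_zsmul]

/-- The quotient map `ℝ³ → 𝕋³`, in coordinates of period one. -/
noncomputable def toTorus : C(Fin 3 → ℝ, UnitAddTorus (Fin 3)) where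
  toFun y := fun i => (y i : UnitAddCircle)
  continuous_toFun := by
    refine continuous_pi fun i => ?_
    exact (AddCircle.continuous_mk' 1).comp (continuous_apply i)

lemma isQuotientMap_toTorus : IsQuotientMap toTorus := by
  have : IsOpenQuotientMap (Pi.map fun _ : Fin 3 => (QuotientAddGroup.mk : ℝ → UnitAddCircle)) :=
    IsOpenQuotientMap.piMap fun _ => QuotientAddGroup.isOpenQuotientMap_mk
  exact this.isQuotientMap

/-- Descent of a periodic function to `𝕋³`, in coordinates of period one. -/
lemma exists_torus_lift {f : R3 → ℂ} (hf : Continuous f) (hp : IsPeriodic f) :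
    ∃ F : C(UnitAddTorus (Fin 3), ℂ), ∀ y : Fin 3 → ℝ,
      F (fun i => (y i : UnitAddCircle)) = f (WithLp.toLp 2 fun i => 2 * Real.pi * y i) := by
  let g : C(Fin 3 → ℝ, ℂ) := ⟨fun y => f (WithLp.toLp 2 fun i => 2 * Real.pi * y i), by
    refine hf.comp ?_
    exact (PiLp.continuous_toLp 2 _).comp (by fun_prop)⟩
  have hg : Function.FactorsThrough g toTorus := by
    intro a b hab
    have h : ∀ i, ∃ n : ℤ, a i = b i + n := by
      intro i
      have := congrFun hab i
      have h2 : ((a i : ℝ) : UnitAddCircle) = (b i : ℝ) := this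
      rw [QuotientAddGroup.eq] at h2
      obtain ⟨n, hn⟩ := AddSubgroup.mem_zmultiples_iff.1 h2
      refine ⟨-n, ?_⟩
      simp at hn
      push_cast
      linarith
    choose n hn using h
    change f _ = f _
    rw [← hp.add_lattice n (WithLp.toLp 2 fun i => 2 * Real.pi * b i)]
    congr 1
    ext i
    simp [hn i]; ring
  refine ⟨isQuotientMap_toTorus.lift g hg, fun y => ?_⟩
  have := isQuotientMap_toTorus.lift_comp g hg
  exact congrArg (fun h : C(Fin 3 → ℝ, ℂ) => h y) this

lemma mFourier_coe (k : Fin 3 → ℤ) (y : Fin 3 → ℝ) :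
    UnitAddTorus.mFourier k (fun i => (y i : UnitAddCircle)) =
      expo k (WithLp.toLp 2 fun i => 2 * Real.pi * y i) := by
  simp only [UnitAddTorus.mFourier, ContinuousMap.coe_mk, fourier_coe_apply, expo,
    ← Complex.exp_sum]
  congr 1
  rw [Finset.mul_sum]
  refine Finset.sum_congr rfl fun i _ => ?_
  push_cast
  simp
  ring

open scoped Pointwise in
lemma coef_eq_mFourierCoeff {f : R3 → ℂ} {F : C(UnitAddTorus (Fin 3), ℂ)}
    (hF : ∀ y : Fin 3 → ℝ,
      F (fun i => (y i : UnitAddCircle)) = f (WithLp.toLp 2 fun i => 2 * Real.pi * y i))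
    (k : Fin 3 → ℤ) : coef f k = UnitAddTorus.mFourierCoeff F k := by
  rw [UnitAddTorus.mFourierCoeff_eq_integral F k (fun _ => -(1 / 2)), coef_eq, setIntegral_cell]
  have hset : {x : Fin 3 → ℝ | ∀ i, x i ∈ Ioc (-(1 / 2 : ℝ)) (-(1 / 2) + 1)} =
      univ.pi fun _ => Ioc (-(1 / 2 : ℝ)) (-(1 / 2) + 1) := by
    ext x; simp
  -- Up to null sets, the period `2π` cube is the image of the unit cube under scaling.
  have hae : (univ.pi fun _ : Fin 3 => Ioc (-(1 / 2 : ℝ)) (-(1 / 2) + 1)) =ᵐ[volume]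
      Icc (fun _ : Fin 3 => -(1 / 2 : ℝ)) (fun _ => (-(1 / 2) + 1 : ℝ)) :=
    Measure.univ_pi_Ioc_ae_eq_Icc
  rw [hset, setIntegral_congr_set hae]
  have h2 := Measure.setIntegral_comp_smul (volume : Measure (Fin 3 → ℝ))
    (fun y => expo (-k) (WithLp.toLp 2 y) * f (WithLp.toLp 2 y))
    (Icc (fun _ => -(1 / 2 : ℝ)) (fun _ => (-(1 / 2) + 1 : ℝ)))
    (R := 2 * Real.pi) (by positivity)
  have h3 : (2 * Real.pi) • Icc (fun _ : Fin 3 => -(1 / 2 : ℝ)) (fun _ => (-(1 / 2) + 1 : ℝ)) =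
      Icc (fun _ => -Real.pi) (fun _ => Real.pi) := by
    have hpi := Real.pi_pos
    ext y
    rw [mem_smul_set_iff_inv_smul_mem₀ (by positivity)]
    simp only [mem_Icc, Pi.le_def, Pi.smul_apply, smul_eq_mul]
    refine and_congr (forall_congr' fun i => ?_) (forall_congr' fun i => ?_)
    · rw [le_inv_mul_iff₀ (by positivity)]
      constructor <;> intro h <;> linarith
    · rw [inv_mul_le_iff₀ (by positivity)]
      constructor <;> intro h <;> linarith
  have h4 : |((2 * Real.pi) ^ Module.finrank ℝ (Fin 3 → ℝ))⁻¹| = ((2 * Real.pi) ^ 3)⁻¹ := by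
    rw [abs_of_pos (by positivity)]
    simp
  rw [h3, h4, Complex.real_smul] at h2
  rw [← Complex.ofReal_inv, ← h2]
  refine setIntegral_congr_fun measurableSet_Icc fun y _ => ?_
  simp only [mFourier_coe, hF, smul_eq_mul]
  rfl

/-- A continuous periodic function with summable Fourier coefficients is the sum of its Fourier
series at every point. -/
lemma hasSum_coef {f : R3 → ℂ} (hf : Continuous f) (hp : IsPeriodic f) (hs : Summable (coef f))
    (x : R3) : HasSum (fun k => coef f k * expo k x) (f x) := by
  obtain ⟨F, hF⟩ := exists_torus_lift hf hp
  have hc : coef f = UnitAddTorus.mFourierCoeff F := funext (coef_eq_mFourierCoeff hF)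
  rw [hc] at hs
  have h := UnitAddTorus.hasSum_mFourier_series_apply_of_summable hs
    (fun i => ((x i / (2 * Real.pi) : ℝ) : UnitAddCircle))
  simp only [mFourier_coe, hF, smul_eq_mul, ← hc] at h
  have hx : (WithLp.toLp 2 fun i => 2 * Real.pi * (x i / (2 * Real.pi)) : R3) = x := by
    have hpi := Real.pi_pos
    ext i; simp; field_simp
  rwa [hx] at h

lemma coef_add {f g : R3 → ℂ} (hf : Continuous f) (hg : Continuous g) (k : Fin 3 → ℤ) :
    coef (fun x => f x + g x) k = coef f k + coef g k := by
  simp only [coef_eq, mul_add]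
  rw [integral_add, mul_add]
  · exact integrableOn_cell ((continuous_expo _).mul hf)
  · exact integrableOn_cell ((continuous_expo _).mul hg)

lemma coef_const_mul (c : ℂ) (f : R3 → ℂ) (k : Fin 3 → ℤ) :
    coef (fun x => c * f x) k = c * coef f k := by
  simp only [coef_eq]
  have : ∀ x, expo (-k) x * (c * f x) = c * (expo (-k) x * f x) := fun x => by ring
  simp only [this]
  rw [integral_const_mul]
  ring

lemma coef_neg (f : R3 → ℂ) (k : Fin 3 → ℤ) : coef (fun x => -f x) k = -coef f k := by
  simpa using coef_const_mul (-1) f k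

lemma coef_sum {ι : Type*} (s : Finset ι) {f : ι → R3 → ℂ} (hf : ∀ i, Continuous (f i))
    (k : Fin 3 → ℤ) : coef (fun x => ∑ i ∈ s, f i x) k = ∑ i ∈ s, coef (f i) k := by
  classical
  induction s using Finset.induction_on with
  | empty => simp [coef_eq]
  | insert i s hi ih =>
    simp only [Finset.sum_insert hi]
    rw [coef_add (hf i) (continuous_finsetSum _ fun i _ => hf i), ih]

lemma coef_conj_of_real (f : R3 → ℝ) (k : Fin 3 → ℤ) :
    coef (fun x => (f x : ℂ)) (-k) = star (coef (fun x => (f x : ℂ)) k) := by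
  simp only [coef_eq, star_mul', Complex.star_def, map_inv₀, Complex.conj_ofReal]
  rw [← integral_conj]
  congr 2
  ext x
  simp only [map_mul, Complex.conj_ofReal]
  congr 1
  rw [expo_eq, expo_eq, ← Complex.exp_conj]
  simp [phase_apply]

/-- The Fourier coefficients of a product are the convolution of the Fourier coefficients. -/
lemma hasSum_coef_mul {f g : R3 → ℂ} (hf : Continuous f) (hp : IsPeriodic f)
    (hs : Summable (coef f)) (hg : Continuous g) (k : Fin 3 → ℤ) :
    HasSum (fun j => coef f j * coef g (k - j)) (coef (fun x => f x * g x) k) := by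
  have key : HasSum (fun j => ∫ x in cell, coef f j * (expo (-(k - j)) x * g x))
      (∫ x in cell, ∑' j, coef f j * (expo (-(k - j)) x * g x)) := by
    refine hasSum_integral_of_summable_integral_norm (fun j => ?_) ?_
    · exact integrableOn_cell (continuous_const.mul ((continuous_expo _).mul hg))
    · have : ∀ j, ∫ x in cell, ‖coef f j * (expo (-(k - j)) x * g x)‖ =
          ‖coef f j‖ * ∫ x in cell, ‖g x‖ := by
        intro j
        simp only [norm_mul, norm_expo, one_mul]
        rw [integral_const_mul]
      simp only [this]
      exact hs.norm.mul_right _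
  have e1 : ∀ j, ∫ x in cell, coef f j * (expo (-(k - j)) x * g x) =
      coef f j * ∫ x in cell, (expo (-(k - j)) x * g x) := fun j => integral_const_mul _ _
  have e2 : ∀ x, ∑' j, coef f j * (expo (-(k - j)) x * g x) = expo (-k) x * (f x * g x) := by
    intro x
    have h := (hasSum_coef hf hp hs x).mul_right (expo (-k) x * g x)
    rw [show expo (-k) x * (f x * g x) = f x * (expo (-k) x * g x) by ring, ← h.tsum_eq]
    refine tsum_congr fun j => ?_
    rw [show -(k - j) = j + -k by ring, expo_add]
    ring
  simp only [e1, e2] at key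
  have h := key.mul_left (((2 * Real.pi) ^ 3 : ℝ) : ℂ)⁻¹
  rw [← coef_eq (fun x => f x * g x)] at h
  have he : (fun j => coef f j * coef g (k - j)) = fun j => (((2 * Real.pi) ^ 3 : ℝ) : ℂ)⁻¹ *
      (coef f j * ∫ x in cell, expo (-(k - j)) x * g x) := by
    ext j
    rw [coef_eq g]
    ring
  rwa [he]

/-- The integral over a period of a partial derivative of a periodic function vanishes. -/
lemma integral_cell_fderiv {g : R3 → ℂ} (hg : ContDiff ℝ 1 g) (hp : IsPeriodic g) (i : Fin 3) :
    ∫ x in cell, fderiv ℝ g x (EuclideanSpace.single i 1) = 0 := by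
  rw [setIntegral_cell]
  let L : (Fin 3 → ℝ) →L[ℝ] R3 := (PiLp.continuousLinearEquiv 2 ℝ (fun _ : Fin 3 => ℝ)).symm
  have hL : ∀ y, L y = WithLp.toLp 2 y := fun y => rfl
  let f' : (Fin 3 → ℝ) → (Fin 3 → ℝ) →L[ℝ] (Fin 3 → ℂ) := fun y =>
    (ContinuousLinearMap.single ℝ (fun _ : Fin 3 => ℂ) i).comp ((fderiv ℝ g (L y)).comp L)
  have hsum : ∀ y, ∑ j, f' y (Pi.single j 1) j =
      fderiv ℝ g (WithLp.toLp 2 y) (EuclideanSpace.single i 1) := by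
    intro y
    rw [Finset.sum_eq_single i]
    · simp [f', hL]
    · intro j _ hj
      simp [f', hj]
    · simp
  have hd : ∀ y, HasFDerivAt (fun y => (Pi.single i (g (L y)) : Fin 3 → ℂ)) (f' y) y := by
    intro y
    have h1 : HasFDerivAt (fun y => g (L y)) ((fderiv ℝ g (L y)).comp L) y :=
      ((hg.differentiable one_ne_zero) (L y)).hasFDerivAt.comp y L.hasFDerivAt
    exact ((ContinuousLinearMap.single ℝ (fun _ : Fin 3 => ℂ) i).hasFDerivAt).comp y h1
  have hpi := Real.pi_pos
  have hcont : Continuous fun y : Fin 3 → ℝ =>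
      fderiv ℝ g (WithLp.toLp 2 y) (EuclideanSpace.single i 1) :=
    ((hg.continuous_fderiv one_ne_zero).clm_apply continuous_const).comp L.continuous
  have h := integral_divergence_of_hasFDerivAt_off_countable (n := 2)
    (fun _ => -Real.pi) (fun _ => Real.pi) (by intro j; dsimp; linarith)
    (fun y => (Pi.single i (g (L y)) : Fin 3 → ℂ)) f' ∅ countable_empty
    (continuous_iff_continuousAt.2 fun y => (hd y).continuousAt).continuousOn
    (fun y _ => hd y)
    (by simp only [hsum]; exact hcont.continuousOn.integrableOn_compact isCompact_Icc)
  simp only [hsum] at h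
  rw [h]
  refine Finset.sum_eq_zero fun j _ => ?_
  rw [sub_eq_zero]
  congr 1
  ext y
  by_cases hj : j = i
  · rw [hj]
    simp only [Pi.single_eq_same, hL]
    rw [← hp (WithLp.toLp 2 (i.insertNth (-Real.pi) y)) i]
    congr 1
    ext l
    by_cases hl : l = i
    · simp [hl]; ring
    · obtain ⟨l, rfl⟩ := Fin.exists_succAbove_eq hl
      simp
  · simp [hj]

lemma IsPeriodic.mul {f g : R3 → ℂ} (hf : IsPeriodic f) (hg : IsPeriodic g) :
    IsPeriodic fun x => f x * g x := fun x i => by simp only [hf x i, hg x i]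

lemma IsPeriodic.fderiv {F : Type*} [NormedAddCommGroup F] [NormedSpace ℝ F] {f : R3 → F}
    (hf : IsPeriodic f) : IsPeriodic (fderiv ℝ f) := fun x i => by
  rw [← fderiv_comp_add_right]
  congr 1
  exact funext fun y => hf y i

/-- The Fourier coefficients of a partial derivative. -/
lemma coef_fderiv {f : R3 → ℂ} (hf : ContDiff ℝ 1 f) (hp : IsPeriodic f) (i : Fin 3)
    (k : Fin 3 → ℤ) :
    coef (fun x => fderiv ℝ f x (EuclideanSpace.single i 1)) k = Complex.I * k i * coef f k := by
  have h := integral_cell_fderiv ((contDiff_expo (-k)).mul hf) ((isPeriodic_expo (-k)).mul hp) i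
  have hphase : phase (-k) (EuclideanSpace.single i 1) = -(k i : ℝ) := by
    simp [phase_apply]
  have e1 : ∀ x, _root_.fderiv ℝ (fun x => expo (-k) x * f x) x (EuclideanSpace.single i 1) =
      expo (-k) x * _root_.fderiv ℝ f x (EuclideanSpace.single i 1) +
        -(Complex.I * k i) * (expo (-k) x * f x) := by
    intro x
    have hd : HasFDerivAt (fun x => expo (-k) x * f x) _ x :=
      (hasFDerivAt_expo (-k) x).mul ((hf.differentiable one_ne_zero) x).hasFDerivAt
    rw [hd.fderiv]
    simp only [add_apply, smul_apply, smul_eq_mul,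
      ContinuousLinearMap.comp_apply, Complex.ofRealCLM_apply, hphase]
    push_cast
    ring
  simp only [e1] at h
  rw [integral_add, integral_const_mul] at h
  · simp only [coef_eq]
    linear_combination (((2 * Real.pi) ^ 3 : ℝ) : ℂ)⁻¹ * h
  · exact integrableOn_cell ((continuous_expo _).mul
      ((hf.continuous_fderiv one_ne_zero).clm_apply continuous_const))
  · exact integrableOn_cell (continuous_const.mul ((continuous_expo _).mul hf.continuous))

lemma freqNorm_nonneg (k : Fin 3 → ℤ) : 0 ≤ freqNorm k := Real.sqrt_nonneg _

lemma freqNorm_sq (k : Fin 3 → ℤ) : freqNorm k ^ 2 = ∑ i, (k i : ℝ) ^ 2 :=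
  Real.sq_sqrt (Finset.sum_nonneg fun _ _ => sq_nonneg _)

lemma abs_le_freqNorm (k : Fin 3 → ℤ) (i : Fin 3) : |(k i : ℝ)| ≤ freqNorm k := by
  rw [← Real.sqrt_sq_eq_abs]
  exact Real.sqrt_le_sqrt (Finset.single_le_sum (f := fun i => (k i : ℝ) ^ 2)
    (fun _ _ => sq_nonneg _) (Finset.mem_univ i))

/-- A function with `∑ (1 + |k|)|f̂ₖ| < ∞` is continuously differentiable. -/
lemma contDiff_one_of_summable {f : R3 → ℂ} (hf : Continuous f) (hp : IsPeriodic f)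
    (h0 : Summable fun k => ‖coef f k‖) (h1 : Summable fun k => freqNorm k * ‖coef f k‖) :
    ContDiff ℝ 1 f := by
  have hfe : f = fun x => ∑' k, coef f k * expo k x :=
    funext fun x => (hasSum_coef hf hp h0.of_norm x).tsum_eq.symm
  rw [hfe]
  refine contDiff_tsum (N := 1)
    (v := fun n k => if n = 0 then ‖coef f k‖ else freqNorm k * ‖coef f k‖)
    (fun k => contDiff_const.mul (contDiff_expo k)) (fun n hn => ?_) (fun n k x hn => ?_)
  · by_cases hn0 : n = 0 <;> simp [hn0, h0, h1]
  · have hn1 : n ≤ 1 := by exact_mod_cast hn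
    interval_cases n
    · simp [norm_expo]
    · have : HasFDerivAt (fun x => coef f k * expo k x)
          (coef f k • ((Complex.I * expo k x) • (Complex.ofRealCLM.comp (phase k)))) x :=
        (hasFDerivAt_expo k x).const_mul _
      rw [norm_iteratedFDeriv_one, this.fderiv]
      simp only [norm_smul, norm_mul, norm_expo, Complex.norm_I, mul_one, one_mul, one_ne_zero,
        if_false]
      rw [mul_comm]
      refine mul_le_mul_of_nonneg_right ?_ (norm_nonneg _)
      refine (ContinuousLinearMap.opNorm_comp_le _ _).trans ?_
      simpa using norm_phase_le k

/-- A function with `∑ (1 + |k| + |k|²)|f̂ₖ| < ∞` is twice continuously differentiable. -/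
lemma contDiff_two_of_summable {f : R3 → ℂ} (hf : Continuous f) (hp : IsPeriodic f)
    (h0 : Summable fun k => ‖coef f k‖) (h1 : Summable fun k => freqNorm k * ‖coef f k‖)
    (h2 : Summable fun k => freqNorm k ^ 2 * ‖coef f k‖) : ContDiff ℝ 2 f := by
  have hf1 := contDiff_one_of_summable hf hp h0 h1
  have hpart : ∀ i : Fin 3, ContDiff ℝ 1 fun x => fderiv ℝ f x (EuclideanSpace.single i 1) := by
    intro i
    have hle : ∀ k, ‖coef (fun x => fderiv ℝ f x (EuclideanSpace.single i 1)) k‖ ≤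
        freqNorm k * ‖coef f k‖ := by
      intro k
      rw [coef_fderiv hf1 hp, norm_mul, norm_mul, Complex.norm_I, one_mul, Complex.norm_intCast]
      exact mul_le_mul_of_nonneg_right (abs_le_freqNorm k i) (norm_nonneg _)
    refine contDiff_one_of_summable
      ((hf1.continuous_fderiv one_ne_zero).clm_apply continuous_const)
      (fun x j => by simp only [hp.fderiv x j]) ?_ ?_
    · exact h1.of_nonneg_of_le (fun _ => norm_nonneg _) hle
    · refine h2.of_nonneg_of_le (fun k => mul_nonneg (freqNorm_nonneg k) (norm_nonneg _))
        fun k => ?_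
      rw [sq, mul_assoc]
      exact mul_le_mul_of_nonneg_left (hle k) (freqNorm_nonneg k)
  rw [show (2 : WithTop ℕ∞) = 1 + 1 by norm_num, contDiff_succ_iff_fderiv_apply]
  refine ⟨hf1.differentiable one_ne_zero, by simp, fun y => ?_⟩
  have : (fun x => fderiv ℝ f x y) =
      fun x => ∑ i, (y i : ℂ) * fderiv ℝ f x (EuclideanSpace.single i 1) := by
    ext x
    have hy : y = ∑ i, y i • (EuclideanSpace.single i (1 : ℝ) : R3) := by
      ext j; simp [Pi.single_apply]
    conv_lhs => rw [hy]
    simp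
  rw [this]
  exact ContDiff.sum fun i _ => contDiff_const.mul (hpart i)

/-! ### Sequences of Fourier coefficients -/

/-- The frequency lattice `ℤ³`. -/
abbrev Freq : Type := Fin 3 → ℤ

/-- The values `ℂ³` of the Fourier coefficients of a vector field. -/
abbrev C3 : Type := EuclideanSpace ℂ (Fin 3)

/-- The bilinear (not sesquilinear) product `k · z`. -/
noncomputable def dotc (k : Freq) (z : C3) : ℂ := ∑ i, (k i : ℂ) * z i

lemma dotc_smul (k : Freq) (c : ℂ) (z : C3) : dotc k (c • z) = c * dotc k z := by
  simp only [dotc, PiLp.smul_apply, smul_eq_mul, Finset.mul_sum]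
  exact Finset.sum_congr rfl fun i _ => by ring

lemma dotc_sub (k : Freq) (z w : C3) : dotc k (z - w) = dotc k z - dotc k w := by
  simp [dotc, mul_sub]

lemma dotc_sub_left (j k : Freq) (z : C3) : dotc (j - k) z = dotc j z - dotc k z := by
  simp [dotc, sub_mul]

/-- The vector `k` in `ℂ³`. -/
noncomputable def kvec (k : Freq) : C3 := WithLp.toLp 2 fun i => (k i : ℂ)

lemma norm_kvec (k : Freq) : ‖kvec k‖ = freqNorm k := by
  simp [kvec, EuclideanSpace.norm_eq, freqNorm]

lemma inner_kvec (k : Freq) (z : C3) : inner ℂ (kvec k) z = dotc k z := by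
  simp [kvec, dotc, PiLp.inner_apply, mul_comm]

lemma norm_dotc_le (k : Freq) (z : C3) : ‖dotc k z‖ ≤ freqNorm k * ‖z‖ := by
  rw [← inner_kvec, ← norm_kvec]
  exact norm_inner_le_norm _ _

lemma freqNorm_zero : freqNorm 0 = 0 := by simp [freqNorm]

lemma one_le_freqNorm {k : Freq} (hk : k ≠ 0) : 1 ≤ freqNorm k := by
  obtain ⟨i, hi⟩ := Function.ne_iff.1 hk
  have h1 : (1 : ℝ) ≤ |(k i : ℝ)| := by
    exact_mod_cast Int.one_le_abs hi
  exact h1.trans (abs_le_freqNorm k i)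

lemma freqNorm_neg (k : Freq) : freqNorm (-k) = freqNorm k := by simp [freqNorm]

lemma freqNorm_add_le (j k : Freq) : freqNorm (j + k) ≤ freqNorm j + freqNorm k := by
  rw [← norm_kvec, ← norm_kvec, ← norm_kvec]
  refine le_trans (le_of_eq ?_) (norm_add_le _ _)
  congr 1
  ext i
  simp [kvec]

lemma summable_freqNorm_rpow {q : ℝ} (hq : q < -3) : Summable fun k : Freq => freqNorm k ^ q := by
  let b := (EuclideanSpace.basisFun (Fin 3) ℝ).toBasis
  let L : Submodule ℤ R3 := Submodule.span ℤ (range b)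
  have hfin : Module.finrank ℤ L = 3 := by
    have hli : LinearIndependent ℤ b := b.linearIndependent.restrict_scalars
      (by intro x y h; simpa using h)
    simpa using finrank_span_eq_card hli
  have hs := ZLattice.summable_norm_rpow L q (by rw [hfin]; exact_mod_cast hq)
  have hmem : ∀ k : Freq, (∑ i, k i • b i) ∈ L := fun k =>
    Submodule.sum_mem _ fun i _ => Submodule.smul_mem _ _ (Submodule.subset_span ⟨i, rfl⟩)
  have hval : ∀ k : Freq, (∑ i, k i • b i) = (WithLp.toLp 2 fun i => (k i : ℝ) : R3) := by
    intro k
    ext j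
    simp [b, Pi.single_apply]
  have hinj : Function.Injective fun k : Freq => (⟨_, hmem k⟩ : L) := by
    intro k l hkl
    have h : (∑ i, k i • b i) = ∑ i, l i • b i := congrArg Subtype.val hkl
    rw [hval, hval] at h
    ext i
    have := congrArg (fun x : R3 => x i) h
    simpa using this
  have h := hs.comp_injective hinj
  refine h.congr fun k => ?_
  simp only [Function.comp_apply, Submodule.coe_norm, hval]
  congr 1
  simp [EuclideanSpace.norm_eq, freqNorm]

lemma summable_mul_of_sq {ι : Type*} {f g : ι → ℝ} (hf0 : ∀ i, 0 ≤ f i) (hg0 : ∀ i, 0 ≤ g i)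
    (hf : Summable fun i => f i ^ 2) (hg : Summable fun i => g i ^ 2) :
    (Summable fun i => f i * g i) ∧
      ∑' i, f i * g i ≤ Real.sqrt (∑' i, f i ^ 2) * Real.sqrt (∑' i, g i ^ 2) := by
  have h := Real.summable_and_inner_le_Lp_mul_Lq_tsum_of_nonneg (p := 2) (q := 2)
    ((Real.holderConjugate_iff).2 ⟨by norm_num, by norm_num⟩) hf0 hg0
    (by simpa using hf) (by simpa using hg)
  simpa [Real.sqrt_eq_rpow] using h

/-- The constant in the embedding of `ℓ²(|k|^r)` into `ℓ¹(|k|^q)`, as a function of `c = r - q`,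
meaningful for `c > 3/2`. The term at `k = 0` is `0`, as `0 ^ x = 0` for `x ≠ 0`. -/
noncomputable def embConst (c : ℝ) : ℝ := Real.sqrt (∑' k : Freq, freqNorm k ^ (-(2 * c)))

lemma embConst_nonneg (c : ℝ) : 0 ≤ embConst c := Real.sqrt_nonneg _

lemma summable_l1_of_l2 {r q : ℝ} (hq : q + 3 / 2 < r) {f : Freq → ℝ} (hf0 : ∀ k, 0 ≤ f k)
    (hz : f 0 = 0) (hf : Summable fun k => freqNorm k ^ (2 * r) * f k ^ 2) :
    (Summable fun k => freqNorm k ^ q * f k) ∧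
      ∑' k, freqNorm k ^ q * f k ≤
        embConst (r - q) * Real.sqrt (∑' k, freqNorm k ^ (2 * r) * f k ^ 2) := by
  have e1 : ∀ k : Freq, (freqNorm k ^ (q - r)) ^ 2 = freqNorm k ^ (-(2 * (r - q))) := by
    intro k
    rw [← Real.rpow_natCast, ← Real.rpow_mul (freqNorm_nonneg k)]
    congr 1; push_cast; ring
  have e2 : ∀ k : Freq, (freqNorm k ^ r * f k) ^ 2 = freqNorm k ^ (2 * r) * f k ^ 2 := by
    intro k
    rw [mul_pow, ← Real.rpow_natCast (freqNorm k ^ r), ← Real.rpow_mul (freqNorm_nonneg k)]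
    congr 2; push_cast; ring
  have e3 : ∀ k : Freq, freqNorm k ^ (q - r) * (freqNorm k ^ r * f k) = freqNorm k ^ q * f k := by
    intro k
    by_cases hk : k = 0
    · simp [hk, hz]
    · rw [← mul_assoc, ← Real.rpow_add (by linarith [one_le_freqNorm hk])]
      congr 2; ring
  have h := summable_mul_of_sq (f := fun k : Freq => freqNorm k ^ (q - r))
    (g := fun k => freqNorm k ^ r * f k)
    (fun k => Real.rpow_nonneg (freqNorm_nonneg k) _)
    (fun k => mul_nonneg (Real.rpow_nonneg (freqNorm_nonneg k) _) (hf0 k))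
    (by simp only [e1]; exact summable_freqNorm_rpow (by linarith))
    (by simpa only [e2] using hf)
  simp only [e1, e2, e3] at h
  exact h

/-- The Fourier side of membership in `ℋ^r`: the coefficients of a real, mean-zero, divergence free
field of finite homogeneous `H^r` norm. -/
structure Admissible (r : ℝ) (a : Freq → C3) : Prop where
  real : ∀ k i, a (-k) i = star (a k i)
  zero : a 0 = 0
  div : ∀ k, dotc k (a k) = 0
  summable : Summable fun k => freqNorm k ^ (2 * r) * ‖a k‖ ^ 2

/-- The square of the homogeneous `H^r` norm. -/
noncomputable def energy (r : ℝ) (a : Freq → C3) : ℝ :=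
  ∑' k, freqNorm k ^ (2 * r) * ‖a k‖ ^ 2

lemma energy_nonneg (r : ℝ) (a : Freq → C3) : 0 ≤ energy r a :=
  tsum_nonneg fun k => mul_nonneg (Real.rpow_nonneg (freqNorm_nonneg k) _) (sq_nonneg _)

lemma Admissible.l1 {r q : ℝ} {a : Freq → C3} (ha : Admissible r a) (hq : q + 3 / 2 < r) :
    (Summable fun k => freqNorm k ^ q * ‖a k‖) ∧
      ∑' k, freqNorm k ^ q * ‖a k‖ ≤ embConst (r - q) * Real.sqrt (energy r a) :=
  summable_l1_of_l2 hq (fun _ => norm_nonneg _) (by simp [ha.zero]) ha.summable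

/-- The Fourier coefficients of `(a · ∇) b` for a divergence free `a`. -/
noncomputable def conv (a b : Freq → C3) (k : Freq) : C3 :=
  ∑' j, (Complex.I * dotc k (a j)) • b (k - j)

lemma norm_conv_term_le {a b : Freq → C3} (hdiv : ∀ k, dotc k (a k) = 0) (k j : Freq) :
    ‖(Complex.I * dotc k (a j)) • b (k - j)‖ ≤
      ‖a j‖ * (freqNorm (k - j) * ‖b (k - j)‖) := by
  have : dotc k (a j) = dotc (k - j) (a j) := by rw [dotc_sub_left, hdiv, sub_zero]
  rw [norm_smul, norm_mul, Complex.norm_I, one_mul, this]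
  calc _ ≤ (freqNorm (k - j) * ‖a j‖) * ‖b (k - j)‖ :=
        mul_le_mul_of_nonneg_right (norm_dotc_le _ _) (norm_nonneg _)
    _ = _ := by ring

lemma summable_conv_prod {f g : Freq → ℝ} (hf0 : ∀ k, 0 ≤ f k) (hg0 : ∀ k, 0 ≤ g k)
    (hf : Summable f) (hg : Summable g) :
    Summable fun p : Freq × Freq => f p.2 * g (p.1 - p.2) := by
  have h := hf.mul_of_nonneg hg hf0 hg0
  let e : Freq × Freq ≃ Freq × Freq :=
    { toFun := fun p => (p.2, p.1 - p.2)
      invFun := fun p => (p.1 + p.2, p.1)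
      left_inv := fun p => by simp
      right_inv := fun p => by simp }
  exact (e.summable_iff (f := fun x : Freq × Freq => f x.1 * g x.2)).2 h

lemma tsum_conv_prod {f g : Freq → ℝ} (hf0 : ∀ k, 0 ≤ f k) (hg0 : ∀ k, 0 ≤ g k)
    (hf : Summable f) (hg : Summable g) :
    ∑' k, ∑' j, f j * g (k - j) = (∑' k, f k) * ∑' k, g k := by
  have h := hf.mul_of_nonneg hg hf0 hg0
  let e : Freq × Freq ≃ Freq × Freq :=
    { toFun := fun p => (p.2, p.1 - p.2)
      invFun := fun p => (p.1 + p.2, p.1)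
      left_inv := fun p => by simp
      right_inv := fun p => by simp }
  rw [hf.tsum_mul_tsum hg h, ← e.tsum_eq (fun x : Freq × Freq => f x.1 * g x.2)]
  exact ((summable_conv_prod hf0 hg0 hf hg).tsum_prod).symm

/-- The `ℓ¹` bound for the Fourier coefficients of the convection term. -/
lemma conv_l1 {a b : Freq → C3} (hdiv : ∀ k, dotc k (a k) = 0) (ha : Summable fun k => ‖a k‖)
    (hb : Summable fun k => freqNorm k * ‖b k‖) :
    (∀ k, Summable fun j => (Complex.I * dotc k (a j)) • b (k - j)) ∧
    (∀ k, ‖conv a b k‖ ≤ ∑' j, ‖a j‖ * (freqNorm (k - j) * ‖b (k - j)‖)) ∧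
    (Summable fun k => ‖conv a b k‖) ∧
      ∑' k, ‖conv a b k‖ ≤ (∑' k, ‖a k‖) * ∑' k, freqNorm k * ‖b k‖ := by
  have hb0 : ∀ k, 0 ≤ freqNorm k * ‖b k‖ := fun k => mul_nonneg (freqNorm_nonneg k) (norm_nonneg _)
  have hp := summable_conv_prod (fun k => norm_nonneg (a k)) hb0 ha hb
  have hp1 : ∀ k, Summable fun j => ‖a j‖ * (freqNorm (k - j) * ‖b (k - j)‖) := fun k =>
    hp.prod_factor k
  have hn : ∀ k, ‖conv a b k‖ ≤ ∑' j, ‖a j‖ * (freqNorm (k - j) * ‖b (k - j)‖) := fun k =>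
    tsum_of_norm_bounded (hp1 k).hasSum (norm_conv_term_le hdiv k)
  have hs : Summable fun k => ‖conv a b k‖ :=
    hp.prod.of_nonneg_of_le (fun _ => norm_nonneg _) hn
  refine ⟨fun k => (hp1 k).of_norm_bounded (norm_conv_term_le hdiv k), hn, hs, ?_⟩
  rw [← tsum_conv_prod (fun k => norm_nonneg (a k)) hb0 ha hb]
  exact hs.tsum_le_tsum hn hp.prod

/-- `n` is the `k`-th Fourier coefficient of `ℙ f` if `b` is that of `f`: the orthogonal projection
of `b` to the complement of `k`. -/
def IsLerayCoef (k : Freq) (b n : C3) : Prop :=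
  dotc k n = 0 ∧ ∀ z, dotc k z = 0 → inner ℂ z n = inner ℂ z b

lemma IsLerayCoef.norm_le {k : Freq} {b n : C3} (h : IsLerayCoef k b n) : ‖n‖ ≤ ‖b‖ := by
  have h1 := h.2 n h.1
  have h2 : ‖n‖ * ‖n‖ ≤ ‖n‖ * ‖b‖ := by
    rw [← inner_self_eq_norm_mul_norm (𝕜 := ℂ), h1]
    exact (RCLike.re_le_norm _).trans (norm_inner_le_norm _ _)
  by_cases hn : ‖n‖ = 0
  · rw [hn]; exact norm_nonneg _
  · exact le_of_mul_le_mul_left h2 (lt_of_le_of_ne (norm_nonneg _) (Ne.symm hn))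

lemma IsLerayCoef.eq_of_dotc {k : Freq} {b n : C3} (h : IsLerayCoef k b n) (hb : dotc k b = 0) :
    n = b := by
  have h1 := h.2 (n - b) (by rw [dotc_sub, h.1, hb, sub_zero])
  rw [← sub_eq_zero, ← inner_self_eq_zero (𝕜 := ℂ), inner_sub_right, h1, sub_self]

/-- The Fourier side of a solution of the projected equation: bounded in `H^r`, with continuous
coefficients that solve the equation in the interior of the time interval. -/
structure FourierSolution (ν r T : ℝ) (u : ℝ → Freq → C3) : Prop where
  adm : ∀ t ∈ Icc 0 T, Admissible r (u t)
  bound : ∃ K, ∀ t ∈ Icc 0 T, energy r (u t) ≤ K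
  cont : ∀ k, ContinuousOn (fun t => u t k) (Icc 0 T)
  deriv : ∀ t ∈ Ioo 0 T, ∀ k, ∃ n, IsLerayCoef k (conv (u t) (u t) k) n ∧
    HasDerivAt (fun t => u t k) (-((ν * freqNorm k ^ 2) • u t k) - n) t

/-! ### From solutions in physical space to their Fourier coefficients -/

lemma continuous_ofReal_comp {v : R3 → R3} (hv : Continuous v) (i : Fin 3) :
    Continuous fun x => (v x i : ℂ) :=
  Complex.continuous_ofReal.comp ((EuclideanSpace.proj (𝕜 := ℝ) i).continuous.comp hv)

lemma IsPeriodic.component {v : R3 → R3} (hv : IsPeriodic v) (i : Fin 3) :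
    IsPeriodic fun x => (v x i : ℂ) := fun x j => by simp only [hv x j]

lemma vecFourierCoeff_sub {v w : R3 → R3} (hv : Continuous v) (hw : Continuous w) (k : Freq) :
    vecFourierCoeff (v - w) k = vecFourierCoeff v k - vecFourierCoeff w k := by
  ext i
  have : (fun x => ((v - w) x i : ℂ)) = fun x => (v x i : ℂ) + -(w x i : ℂ) := by
    ext x; simp [sub_eq_add_neg]
  rw [vecFourierCoeff_apply, this, coef_add (g := fun x => -(w x i : ℂ))
    (continuous_ofReal_comp hv i) (continuous_ofReal_comp hw i).neg, coef_neg, PiLp.sub_apply,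
    vecFourierCoeff_apply,
    vecFourierCoeff_apply, sub_eq_add_neg]

lemma vecFourierCoeff_neg (v : R3 → R3) (k : Freq) :
    vecFourierCoeff (fun x => -v x) k = -vecFourierCoeff v k := by
  ext i
  rw [PiLp.neg_apply, vecFourierCoeff_apply, vecFourierCoeff_apply, ← coef_neg]
  congr 1
  ext x
  simp

lemma summable_of_tsum_ofReal_lt_top {ι : Type*} {f : ι → ℝ} (hf : ∀ i, 0 ≤ f i)
    (h : ∑' i, ENNReal.ofReal (f i) < ∞) : Summable f := by
  refine (ENNReal.summable_toReal h.ne).congr fun i => ?_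
  exact ENNReal.toReal_ofReal (hf i)

lemma freqNorm_rpow_le (r : ℝ) (hr : 0 ≤ r) (k : Freq) :
    freqNorm k ^ (2 * r) ≤ (1 + freqNorm k ^ 2) ^ r := by
  rw [Real.rpow_mul (freqNorm_nonneg k), Real.rpow_two]
  exact Real.rpow_le_rpow (sq_nonneg _) (by linarith) hr

lemma sobolevNorm_rpow_two (r : ℝ) (v : R3 → R3) : sobolevNorm r v ^ (2 : ℝ) =
    ∑' k : Freq, ENNReal.ofReal ((1 + freqNorm k ^ 2) ^ r * ‖vecFourierCoeff v k‖ ^ 2) := by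
  rw [sobolevNorm, ← ENNReal.rpow_mul]
  norm_num

/-- Finiteness of the Sobolev norm, in terms of the homogeneous energy. -/
lemma energy_of_sobolevNorm {r : ℝ} (hr : 0 ≤ r) {v : R3 → R3} (hv : sobolevNorm r v < ∞) :
    (Summable fun k => freqNorm k ^ (2 * r) * ‖vecFourierCoeff v k‖ ^ 2) ∧
      energy r (vecFourierCoeff v) ≤ (sobolevNorm r v ^ (2 : ℝ)).toReal := by
  have h0 : ∀ k : Freq, 0 ≤ (1 + freqNorm k ^ 2) ^ r * ‖vecFourierCoeff v k‖ ^ 2 := fun k => by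
    positivity
  have hlt : ∑' k : Freq,
      ENNReal.ofReal ((1 + freqNorm k ^ 2) ^ r * ‖vecFourierCoeff v k‖ ^ 2) < ∞ := by
    rw [← sobolevNorm_rpow_two]
    exact ENNReal.rpow_lt_top_of_nonneg (by norm_num) hv.ne
  have hs := summable_of_tsum_ofReal_lt_top h0 hlt
  have hle : ∀ k : Freq, freqNorm k ^ (2 * r) * ‖vecFourierCoeff v k‖ ^ 2 ≤
      (1 + freqNorm k ^ 2) ^ r * ‖vecFourierCoeff v k‖ ^ 2 := fun k =>
    mul_le_mul_of_nonneg_right (freqNorm_rpow_le r hr k) (sq_nonneg _)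
  have hs' := hs.of_nonneg_of_le (fun k => mul_nonneg
    (Real.rpow_nonneg (freqNorm_nonneg k) _) (sq_nonneg _)) hle
  refine ⟨hs', ?_⟩
  rw [sobolevNorm_rpow_two, ← ENNReal.ofReal_tsum_of_nonneg h0 hs,
    ENNReal.toReal_ofReal (tsum_nonneg h0)]
  exact hs'.tsum_le_tsum hle hs

lemma norm_vecFourierCoeff_le_sobolevNorm {r : ℝ} (hr : 0 ≤ r) (v : R3 → R3) (k : Freq) :
    ENNReal.ofReal ‖vecFourierCoeff v k‖ ≤ sobolevNorm r v := by
  rw [sobolevNorm, one_div, ENNReal.le_rpow_inv_iff two_pos]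
  refine le_trans ?_ (ENNReal.le_tsum k)
  rw [ENNReal.ofReal_rpow_of_nonneg (norm_nonneg _) (by norm_num)]
  apply ENNReal.ofReal_le_ofReal
  norm_num
  have : (1 : ℝ) ≤ (1 + freqNorm k ^ 2) ^ r :=
    Real.one_le_rpow (by nlinarith [sq_nonneg (freqNorm k)]) hr
  nlinarith [sq_nonneg ‖vecFourierCoeff v k‖]

lemma MemSobolev.admissible {r : ℝ} (hr : 0 ≤ r) {v : R3 → R3} (hv : MemSobolev r v) :
    Admissible r (vecFourierCoeff v) where
  real k i := by
    rw [vecFourierCoeff_apply, vecFourierCoeff_apply]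
    exact coef_conj_of_real (fun x => v x i) k
  zero := hv.mean_zero
  div := hv.div_free
  summable := (energy_of_sobolevNorm hr hv.norm_lt_top).1

lemma norm_coef_le (v : R3 → R3) (i : Fin 3) (k : Freq) :
    ‖coef (fun x => (v x i : ℂ)) k‖ ≤ ‖vecFourierCoeff v k‖ := by
  rw [← vecFourierCoeff_apply]
  exact PiLp.norm_apply_le _ i

/-- A continuous periodic field with summable Fourier coefficients is bounded by their sum. -/
lemma abs_component_le_tsum {v : R3 → R3} (hv : Continuous v) (hp : IsPeriodic v)
    (hs : Summable fun k => ‖vecFourierCoeff v k‖) (x : R3) (i : Fin 3) :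
    |v x i| ≤ ∑' k, ‖vecFourierCoeff v k‖ := by
  have hsi : Summable fun k => ‖coef (fun x => (v x i : ℂ)) k‖ :=
    hs.of_nonneg_of_le (fun _ => norm_nonneg _) (norm_coef_le v i)
  have h := hasSum_coef (continuous_ofReal_comp hv i) (hp.component i) hsi.of_norm x
  rw [← Real.norm_eq_abs, ← Complex.norm_real, ← h.tsum_eq]
  refine tsum_of_norm_bounded hs.hasSum fun k => ?_
  rw [norm_mul, norm_expo, mul_one]
  exact norm_coef_le v i k

lemma contDiff_of_component {v : R3 → R3} {n : WithTop ℕ∞}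
    (h : ∀ i, ContDiff ℝ n fun x => (v x i : ℂ)) : ContDiff ℝ n v := by
  rw [contDiff_euclidean]
  intro i
  exact Complex.reCLM.contDiff.comp (h i)

lemma contDiff_component {v : R3 → R3} {n : WithTop ℕ∞} (h : ContDiff ℝ n v) (i : Fin 3) :
    ContDiff ℝ n fun x => (v x i : ℂ) :=
  Complex.ofRealCLM.contDiff.comp ((contDiff_euclidean.1 h) i)

lemma fderiv_component {v : R3 → R3} {x : R3} (h : DifferentiableAt ℝ v x) (i : Fin 3) (y : R3) :
    fderiv ℝ (fun x => (v x i : ℂ)) x y = ((fderiv ℝ v x y) i : ℂ) := by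
  have h1 : HasFDerivAt (fun x => (v x i : ℂ))
      (Complex.ofRealCLM.comp ((EuclideanSpace.proj (𝕜 := ℝ) i).comp (fderiv ℝ v x))) x :=
    Complex.ofRealCLM.hasFDerivAt.comp x
      ((EuclideanSpace.proj (𝕜 := ℝ) i).hasFDerivAt.comp x h.hasFDerivAt)
  rw [h1.fderiv]
  rfl

lemma MemSobolev.summable_coef {r q : ℝ} (hr : 0 ≤ r) {v : R3 → R3} (hv : MemSobolev r v)
    (hq : q + 3 / 2 < r) (i : Fin 3) :
    Summable fun k => freqNorm k ^ q * ‖coef (fun x => (v x i : ℂ)) k‖ :=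
  ((hv.admissible hr).l1 hq).1.of_nonneg_of_le
    (fun k => mul_nonneg (Real.rpow_nonneg (freqNorm_nonneg k) _) (norm_nonneg _))
    fun k => mul_le_mul_of_nonneg_left (norm_coef_le v i k)
      (Real.rpow_nonneg (freqNorm_nonneg k) _)

lemma MemSobolev.contDiff {r : ℝ} (hr : 7 / 2 < r) {v : R3 → R3} (hv : MemSobolev r v) :
    ContDiff ℝ 2 v := by
  refine contDiff_of_component fun i => ?_
  have h0 := hv.summable_coef (by linarith) (q := 0) (by linarith) i
  have h1 := hv.summable_coef (by linarith) (q := 1) (by linarith) i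
  have h2 := hv.summable_coef (by linarith) (q := 2) (by linarith) i
  simp only [Real.rpow_zero, one_mul, Real.rpow_one, Real.rpow_two] at h0 h1 h2
  exact contDiff_two_of_summable (continuous_ofReal_comp hv.continuous i)
    (hv.periodic.component i) h0 h1 h2

/-- The Fourier coefficients of a Leray projection. -/
lemma IsLerayProjection.isLerayCoef {v w : R3 → R3} (h : IsLerayProjection v w) (k : Freq) :
    IsLerayCoef k (vecFourierCoeff v k) (vecFourierCoeff w k) := by
  obtain ⟨hwp, hwc, hdiv, q, hqp, hqc, hvw, -⟩ := h
  have hdotc : dotc k (vecFourierCoeff w k) = 0 := by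
    have h1 : ∑ i, coef (fun x => fderiv ℝ (fun x => (w x i : ℂ)) x (EuclideanSpace.single i 1)) k
        = 0 := by
      rw [← coef_sum]
      · have : (fun x => ∑ i, fderiv ℝ (fun x => (w x i : ℂ)) x (EuclideanSpace.single i 1)) =
            fun x => 0 := by
          ext x
          have h2 := hdiv x
          simp only [divergence] at h2
          simp only [fderiv_component (hwc.differentiable one_ne_zero x)]
          exact_mod_cast congrArg (fun y : ℝ => (y : ℂ)) h2
        rw [this]
        simp [coef_eq]
      · exact fun i => ((contDiff_component hwc i).continuous_fderiv one_ne_zero).clm_apply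
          continuous_const
    simp only [coef_fderiv (contDiff_component hwc _) (hwp.component _), ← vecFourierCoeff_apply]
      at h1
    have h3 : Complex.I * dotc k (vecFourierCoeff w k) = 0 := by
      rw [← h1, dotc, Finset.mul_sum]
      exact Finset.sum_congr rfl fun i _ => by ring
    exact (mul_eq_zero.1 h3).resolve_left Complex.I_ne_zero
  refine ⟨hdotc, fun z hz => ?_⟩
  let Q : R3 → ℂ := fun x => (q x : ℂ)
  have hQc : ContDiff ℝ 1 Q := Complex.ofRealCLM.contDiff.comp hqc
  have hQp : IsPeriodic Q := fun x i => by simp only [Q, hqp x i]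
  have hgrad : ∀ x i, ((gradient q x i : ℝ) : ℂ) = fderiv ℝ Q x (EuclideanSpace.single i 1) := by
    intro x i
    have h1 : HasFDerivAt Q (Complex.ofRealCLM.comp (fderiv ℝ q x)) x :=
      Complex.ofRealCLM.hasFDerivAt.comp x (hqc.differentiable one_ne_zero x).hasFDerivAt
    rw [h1.fderiv]
    have h2 : inner ℝ (gradient q x) (EuclideanSpace.single i (1 : ℝ)) =
        fderiv ℝ q x (EuclideanSpace.single i 1) := by
      simp [gradient]
    rw [EuclideanSpace.inner_single_right] at h2
    simp at h2
    simp [h2]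
  have hv : vecFourierCoeff v k = vecFourierCoeff w k + (Complex.I * coef Q k) • kvec k := by
    ext i
    rw [PiLp.add_apply, vecFourierCoeff_apply, vecFourierCoeff_apply]
    have : (fun x => (v x i : ℂ)) =
        fun x => (w x i : ℂ) + fderiv ℝ Q x (EuclideanSpace.single i 1) := by
      ext x
      rw [hvw, ← hgrad]
      simp
    rw [this, coef_add (continuous_ofReal_comp hwc.continuous i)
      ((hQc.continuous_fderiv one_ne_zero).clm_apply continuous_const), coef_fderiv hQc hQp]
    simp [kvec]
    ring
  have hzk : inner ℂ z (kvec k) = 0 := by rw [← inner_conj_symm, inner_kvec, hz, map_zero]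
  rw [hv, inner_add_right, inner_smul_right, hzk, mul_zero, add_zero]

lemma hasSum_coef_sum_mul {f g : Fin 3 → R3 → ℂ} (hf : ∀ i, Continuous (f i))
    (hp : ∀ i, IsPeriodic (f i)) (hs : ∀ i, Summable (coef (f i))) (hg : ∀ i, Continuous (g i))
    (k : Freq) : HasSum (fun j => ∑ i, coef (f i) j * coef (g i) (k - j))
      (coef (fun x => ∑ i, f i x * g i x) k) := by
  rw [coef_sum (f := fun i x => f i x * g i x) _ fun i => (hf i).mul (hg i)]
  exact hasSum_sum fun i _ => hasSum_coef_mul (hf i) (hp i) (hs i) (hg i) k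

lemma hasSum_component {ι : Type*} {f : ι → C3} (hf : Summable f) (m : Fin 3) :
    HasSum (fun j => f j m) ((∑' j, f j) m) :=
  (EuclideanSpace.proj (𝕜 := ℂ) m).hasSum hf.hasSum

lemma coef_convection {v : R3 → R3} (hc : ContDiff ℝ 1 v) (hp : IsPeriodic v)
    (hs : ∀ i, Summable (coef fun x => (v x i : ℂ)))
    (hdiv : ∀ k, dotc k (vecFourierCoeff v k) = 0) (k : Freq)
    (hconv : Summable fun j => (Complex.I * dotc k (vecFourierCoeff v j)) •
      vecFourierCoeff v (k - j)) :
    vecFourierCoeff (convection v) k = conv (vecFourierCoeff v) (vecFourierCoeff v) k := by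
  ext m
  have hD : ∀ i : Fin 3, Continuous fun x =>
      fderiv ℝ (fun x => (v x m : ℂ)) x (EuclideanSpace.single i 1) := fun i =>
    ((contDiff_component hc m).continuous_fderiv one_ne_zero).clm_apply continuous_const
  have h2 := hasSum_coef_sum_mul (fun i => continuous_ofReal_comp hc.continuous i)
    (fun i => hp.component i) hs hD k
  have e1 : (fun x => ∑ i, (v x i : ℂ) *
      fderiv ℝ (fun x => (v x m : ℂ)) x (EuclideanSpace.single i 1)) =
      fun x => (convection v x m : ℂ) := by
    ext x
    have hy : v x = ∑ i, v x i • (EuclideanSpace.single i (1 : ℝ) : R3) := by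
      ext j; simp [Pi.single_apply]
    rw [convection, ← fderiv_component (hc.differentiable one_ne_zero x)]
    conv_rhs => rw [hy]
    simp
  have e2 : ∀ j, ∑ i, coef (fun x => (v x i : ℂ)) j *
      coef (fun x => fderiv ℝ (fun x => (v x m : ℂ)) x (EuclideanSpace.single i 1)) (k - j) =
      ((Complex.I * dotc k (vecFourierCoeff v j)) • vecFourierCoeff v (k - j)) m := by
    intro j
    have : dotc k (vecFourierCoeff v j) = dotc (k - j) (vecFourierCoeff v j) := by
      rw [dotc_sub_left, hdiv, sub_zero]
    rw [this, PiLp.smul_apply, smul_eq_mul, dotc, Finset.mul_sum, Finset.sum_mul]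
    refine Finset.sum_congr rfl fun i _ => ?_
    rw [coef_fderiv (contDiff_component hc m) (hp.component m), ← vecFourierCoeff_apply,
      ← vecFourierCoeff_apply]
    ring
  rw [e1] at h2
  rw [vecFourierCoeff_apply]
  rw [funext e2] at h2
  exact h2.unique (hasSum_component hconv m)

lemma vecFourierCoeff_laplacian {v : R3 → R3} (hc : ContDiff ℝ 2 v) (hp : IsPeriodic v)
    (k : Freq) : vecFourierCoeff (Laplacian.laplacian v) k =
      (-(freqNorm k ^ 2)) • vecFourierCoeff v k := by
  ext m
  have hV := contDiff_component hc m
  have hV1 : ContDiff ℝ 1 fun x => (v x m : ℂ) := hV.of_le (by norm_num)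
  have hpart : ∀ i : Fin 3, ContDiff ℝ 1 fun x =>
      fderiv ℝ (fun x => (v x m : ℂ)) x (EuclideanSpace.single i 1) := fun i =>
    (hV.fderiv_right (m := 1) (by norm_num)).clm_apply contDiff_const
  have e1 : (fun x => (Laplacian.laplacian v x m : ℂ)) = fun x => ∑ i,
      fderiv ℝ (fun x => fderiv ℝ (fun x => (v x m : ℂ)) x (EuclideanSpace.single i 1)) x
        (EuclideanSpace.single i 1) := by
    ext x
    rw [InnerProductSpace.laplacian_eq_iteratedFDeriv_orthonormalBasis v
      (EuclideanSpace.basisFun (Fin 3) ℝ)]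
    have hd : DifferentiableAt ℝ (fderiv ℝ v) x :=
      (hc.fderiv_right (m := 1) (by norm_num)).differentiable one_ne_zero x
    have hi : ∀ i : Fin 3, fderiv ℝ (fun x => fderiv ℝ (fun x => (v x m : ℂ)) x
        (EuclideanSpace.single i 1)) x (EuclideanSpace.single i 1) =
        ((fderiv ℝ (fderiv ℝ v) x (EuclideanSpace.single i 1) (EuclideanSpace.single i 1)) m :
          ℂ) := by
      intro i
      have : (fun x => fderiv ℝ (fun x => (v x m : ℂ)) x (EuclideanSpace.single i 1)) =
          fun x => ((fderiv ℝ v x (EuclideanSpace.single i 1)) m : ℂ) := by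
        ext y
        exact fderiv_component (hc.differentiable two_ne_zero y) m _
      have h2 : fderiv ℝ (fun x => fderiv ℝ v x (EuclideanSpace.single i 1)) x
          (EuclideanSpace.single i 1) =
          fderiv ℝ (fderiv ℝ v) x (EuclideanSpace.single i 1) (EuclideanSpace.single i 1) := by
        rw [fderiv_clm_apply hd (differentiableAt_const _)]
        simp
      rw [this, fderiv_component (v := fun x => fderiv ℝ v x (EuclideanSpace.single i 1))
        (hd.clm_apply (differentiableAt_const _)), h2]
    simp only [hi, iteratedFDeriv_two_apply, EuclideanSpace.basisFun_apply]
    simp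
  rw [vecFourierCoeff_apply, e1, coef_sum _ fun i =>
    ((hpart i).continuous_fderiv one_ne_zero).clm_apply continuous_const]
  have e2 : ∀ i : Fin 3, coef (fun x => fderiv ℝ (fun x => fderiv ℝ (fun x => (v x m : ℂ)) x
        (EuclideanSpace.single i 1)) x (EuclideanSpace.single i 1)) k =
      -((k i : ℂ) ^ 2) * vecFourierCoeff v k m := by
    intro i
    rw [coef_fderiv (hpart i) (fun x j => by simp only [(hp.component m).fderiv x j]),
      coef_fderiv hV1 (hp.component m), vecFourierCoeff_apply]
    linear_combination (k i : ℂ) ^ 2 * coef (fun x => (v x m : ℂ)) k * Complex.I_sq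
  simp only [e2]
  rw [← Finset.sum_mul, PiLp.smul_apply, freqNorm_sq]
  rw [Complex.real_smul]
  push_cast
  rw [Finset.sum_neg_distrib]

lemma energy_add_le {r : ℝ} {a b c : Freq → C3} (h : ∀ k, c k = a k + b k)
    (ha : Summable fun k => freqNorm k ^ (2 * r) * ‖a k‖ ^ 2)
    (hb : Summable fun k => freqNorm k ^ (2 * r) * ‖b k‖ ^ 2) :
    energy r c ≤ 2 * energy r a + 2 * energy r b := by
  have h0 : ∀ k : Freq, 0 ≤ freqNorm k ^ (2 * r) := fun k => Real.rpow_nonneg (freqNorm_nonneg k) _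
  have hle : ∀ k, freqNorm k ^ (2 * r) * ‖c k‖ ^ 2 ≤
      2 * (freqNorm k ^ (2 * r) * ‖a k‖ ^ 2) + 2 * (freqNorm k ^ (2 * r) * ‖b k‖ ^ 2) := by
    intro k
    have h1 : ‖c k‖ ^ 2 ≤ 2 * ‖a k‖ ^ 2 + 2 * ‖b k‖ ^ 2 := by
      have h2 : ‖c k‖ ≤ ‖a k‖ + ‖b k‖ := by rw [h]; exact norm_add_le _ _
      nlinarith [sq_nonneg (‖a k‖ - ‖b k‖), norm_nonneg (c k)]
    nlinarith [mul_le_mul_of_nonneg_left h1 (h0 k)]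
  have hs := (ha.mul_left 2).add (hb.mul_left 2)
  have hc := hs.of_nonneg_of_le (fun k => mul_nonneg (h0 k) (sq_nonneg _)) hle
  refine (hc.tsum_le_tsum hle hs).trans (le_of_eq ?_)
  rw [(ha.mul_left 2).tsum_add (hb.mul_left 2), tsum_mul_left, tsum_mul_left]
  rfl

lemma IsSolution.exists_energy_bound {ν r T : ℝ} {a : R3 → R3} {u : ℝ → R3 → R3} (hr : 0 ≤ r)
    (hu : IsSolution ν r T a u) :
    ∃ K, ∀ t ∈ Icc 0 T, energy r (vecFourierCoeff (u t)) ≤ K := by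
  suffices h : ∃ K, ∀ t ∈ Icc 0 T, t ∈ Icc 0 T → energy r (vecFourierCoeff (u t)) ≤ K by
    obtain ⟨K, hK⟩ := h
    exact ⟨K, fun t ht => hK t ht ht⟩
  refine isCompact_Icc.induction_on
    (p := fun S => ∃ K, ∀ t ∈ S, t ∈ Icc 0 T → energy r (vecFourierCoeff (u t)) ≤ K)
    ⟨0, by simp⟩ (fun S S' hS ⟨K, hK⟩ => ⟨K, fun t ht => hK t (hS ht)⟩) ?_ ?_
  · rintro S S' ⟨K, hK⟩ ⟨K', hK'⟩
    refine ⟨max K K', fun t ht hT => ?_⟩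
    rcases ht with ht | ht
    · exact (hK t ht hT).trans (le_max_left _ _)
    · exact (hK' t ht hT).trans (le_max_right _ _)
  · intro t ht
    have hev : ∀ᶠ t' in 𝓝[Icc 0 T] t, sobolevNorm r (u t' - u t) < 1 :=
      (hu.continuous_in_time t ht).eventually_lt_const zero_lt_one
    refine ⟨_, hev, 2 * energy r (vecFourierCoeff (u t)) + 2 * 1, fun t' ht' hT => ?_⟩
    have ht1 : sobolevNorm r (u t' - u t) < 1 := ht'
    have hd := energy_of_sobolevNorm hr (ht1.trans ENNReal.one_lt_top)
    refine (energy_add_le (a := vecFourierCoeff (u t)) (b := vecFourierCoeff (u t' - u t))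
      (fun k => ?_) ((hu.mem t ht).admissible hr).summable hd.1).trans ?_
    · rw [vecFourierCoeff_sub (hu.mem t' hT).continuous (hu.mem t ht).continuous]
      abel
    · have h1 : (sobolevNorm r (u t' - u t) ^ (2 : ℝ)).toReal ≤ 1 := by
        have : sobolevNorm r (u t' - u t) ^ (2 : ℝ) ≤ 1 :=
          ENNReal.rpow_le_one ht1.le (by norm_num)
        exact (ENNReal.toReal_mono ENNReal.one_ne_top this).trans (by simp)
      linarith [hd.2]

lemma IsSolution.continuousOn_coef {ν r T : ℝ} {a : R3 → R3} {u : ℝ → R3 → R3} (hr : 0 ≤ r)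
    (hu : IsSolution ν r T a u) (k : Freq) :
    ContinuousOn (fun t => vecFourierCoeff (u t) k) (Icc 0 T) := by
  intro t ht
  change Tendsto _ _ _
  rw [tendsto_iff_norm_sub_tendsto_zero]
  have h1 : Tendsto (fun t' => ENNReal.ofReal ‖vecFourierCoeff (u t' - u t) k‖)
      (𝓝[Icc 0 T] t) (𝓝 0) :=
    tendsto_of_tendsto_of_tendsto_of_le_of_le tendsto_const_nhds (hu.continuous_in_time t ht)
      (fun _ => zero_le) (fun t' => norm_vecFourierCoeff_le_sobolevNorm hr _ k)
  have h2 := (ENNReal.tendsto_toReal ENNReal.zero_ne_top).comp h1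
  simp only [ENNReal.toReal_zero] at h2
  refine h2.congr' ?_
  filter_upwards [self_mem_nhdsWithin] with t' ht'
  simp only [Function.comp_apply]
  rw [ENNReal.toReal_ofReal (norm_nonneg _),
    vecFourierCoeff_sub (hu.mem t' ht').continuous (hu.mem t ht).continuous]

lemma hasDerivAt_C3 {f : ℝ → C3} {f' : C3} {t : ℝ}
    (h : ∀ i, HasDerivAt (fun s => f s i) (f' i) t) : HasDerivAt f f' t := by
  have h1 : HasDerivAt (fun s => (fun i => f s i : Fin 3 → ℂ)) (fun i => f' i) t :=
    hasDerivAt_pi.2 h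
  exact ((PiLp.continuousLinearEquiv 2 ℝ (fun _ : Fin 3 => ℂ)).symm :
    (Fin 3 → ℂ) →L[ℝ] C3).hasFDerivAt.comp_hasDerivAt t h1

/-- A time derivative that is uniformly bounded may be taken under the Fourier integral. -/
lemma hasDerivAt_vecFourierCoeff {u w : ℝ → R3 → R3} {T B : ℝ}
    (hu : ∀ t ∈ Icc 0 T, Continuous (u t)) (hw : ∀ t ∈ Icc 0 T, Continuous (w t))
    (hB : ∀ t ∈ Icc 0 T, ∀ x i, |w t x i| ≤ B)
    (hd : ∀ t ∈ Icc 0 T, ∀ x, HasDerivWithinAt (fun t => u t x) (w t x) (Icc 0 T) t)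
    {t : ℝ} (ht : t ∈ Ioo 0 T) (k : Freq) :
    HasDerivAt (fun t => vecFourierCoeff (u t) k) (vecFourierCoeff (w t) k) t := by
  refine hasDerivAt_C3 fun i => ?_
  simp only [vecFourierCoeff_apply, coef_eq]
  have hsub : Ioo 0 T ⊆ Icc 0 T := Ioo_subset_Icc_self
  refine HasDerivAt.const_mul _ ?_
  refine (hasDerivAt_integral_of_dominated_loc_of_deriv_le (μ := volume.restrict cell)
    (F := fun t x => expo (-k) x * (u t x i : ℂ)) (F' := fun t x => expo (-k) x * (w t x i : ℂ))
    (bound := fun _ => B) (Ioo_mem_nhds ht.1 ht.2) ?_ ?_ ?_ ?_ ?_ ?_).2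
  · filter_upwards [Ioo_mem_nhds ht.1 ht.2] with s hs
    exact (integrableOn_cell ((continuous_expo _).mul
      (continuous_ofReal_comp (hu s (hsub hs)) i))).aestronglyMeasurable
  · exact integrableOn_cell ((continuous_expo _).mul (continuous_ofReal_comp (hu t (hsub ht)) i))
  · exact (integrableOn_cell ((continuous_expo _).mul
      (continuous_ofReal_comp (hw t (hsub ht)) i))).aestronglyMeasurable
  · refine ae_of_all _ fun x s hs => ?_
    rw [norm_mul, norm_expo, one_mul, Complex.norm_real]
    exact hB s (hsub hs) x i
  · have : IsFiniteMeasure (volume.restrict cell) := ⟨by simpa using volume_cell_lt_top⟩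
    exact integrable_const _
  · refine ae_of_all _ fun x s hs => ?_
    have h1 := (hd s (hsub hs) x).hasDerivAt (Icc_mem_nhds hs.1 hs.2)
    have h2 : HasDerivAt (fun s => (u s x i : ℂ)) (w s x i : ℂ) s :=
      (Complex.ofRealCLM.comp (EuclideanSpace.proj (𝕜 := ℝ) i)).hasFDerivAt.comp_hasDerivAt s h1
    exact h2.const_mul _

/-- The Fourier coefficients of a solution solve the projected equation in Fourier space. -/
lemma IsSolution.fourierSolution {ν r T : ℝ} {a : R3 → R3} {u : ℝ → R3 → R3} (hr : 9 / 2 < r)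
    (hu : IsSolution ν r T a u) :
    FourierSolution ν r T fun t => vecFourierCoeff (u t) := by
  have hr0 : 0 ≤ r := by linarith
  have hadm : ∀ t ∈ Icc 0 T, Admissible r (vecFourierCoeff (u t)) := fun t ht =>
    (hu.mem t ht).admissible hr0
  refine ⟨hadm, hu.exists_energy_bound hr0, hu.continuousOn_coef hr0, fun t ht k => ?_⟩
  obtain ⟨K, hK⟩ := hu.exists_energy_bound hr0
  choose! Au N hAu hN hder using hu.equation
  have hc2 : ∀ t ∈ Icc 0 T, ContDiff ℝ 2 (u t) := fun t ht =>
    (hu.mem t ht).contDiff (by linarith)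
  -- The Stokes term is the Laplacian itself: `Δu` is already divergence free.
  have hAuc : ∀ t ∈ Icc 0 T, ∀ k, vecFourierCoeff (Au t) k =
      (freqNorm k ^ 2) • vecFourierCoeff (u t) k := by
    intro t ht k
    have h1 : vecFourierCoeff (fun x => -(Laplacian.laplacian (u t) x)) k =
        (freqNorm k ^ 2) • vecFourierCoeff (u t) k := by
      rw [vecFourierCoeff_neg, vecFourierCoeff_laplacian (hc2 t ht) (hu.mem t ht).periodic,
        neg_smul, neg_neg]
    rw [← h1]
    refine ((hAu t ht).isLerayCoef k).eq_of_dotc ?_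
    have h3 : (freqNorm k ^ 2) • vecFourierCoeff (u t) k =
        ((freqNorm k ^ 2 : ℝ) : ℂ) • vecFourierCoeff (u t) k := by
      ext i; simp
    rw [h1, h3, dotc_smul, (hadm t ht).div, mul_zero]
  have hl : ∀ t ∈ Icc 0 T, ∀ q, q + 3 / 2 < r →
      (Summable fun k => freqNorm k ^ q * ‖vecFourierCoeff (u t) k‖) ∧
      ∑' k, freqNorm k ^ q * ‖vecFourierCoeff (u t) k‖ ≤ embConst (r - q) * Real.sqrt K := by
    intro t ht q hq
    refine ⟨((hadm t ht).l1 hq).1, ((hadm t ht).l1 hq).2.trans ?_⟩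
    exact mul_le_mul_of_nonneg_left (Real.sqrt_le_sqrt (hK t ht)) (embConst_nonneg _)
  have hl0 : ∀ t ∈ Icc 0 T, Summable fun k => ‖vecFourierCoeff (u t) k‖ := fun t ht => by
    simpa using (hl t ht 0 (by linarith)).1
  have hl1 : ∀ t ∈ Icc 0 T, Summable fun k => freqNorm k * ‖vecFourierCoeff (u t) k‖ :=
    fun t ht => by simpa using (hl t ht 1 (by linarith)).1
  have hconv := fun t ht => conv_l1 (hadm t ht).div (hl0 t ht) (hl1 t ht)
  have hNc : ∀ t ∈ Icc 0 T, ∀ k, IsLerayCoef k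
      (conv (vecFourierCoeff (u t)) (vecFourierCoeff (u t)) k) (vecFourierCoeff (N t) k) := by
    intro t ht k
    have h1 := (hN t ht).isLerayCoef k
    rwa [coef_convection ((hc2 t ht).of_le (by norm_num)) (hu.mem t ht).periodic
      (fun i => ((hl0 t ht).of_nonneg_of_le (fun _ => norm_nonneg _)
        (norm_coef_le (u t) i)).of_norm) (hadm t ht).div k ((hconv t ht).1 k)] at h1
  have hAuc0 : ∀ t ∈ Icc 0 T, Continuous (Au t) := fun t ht => (hAu t ht).2.1.continuous
  have hNc0 : ∀ t ∈ Icc 0 T, Continuous (N t) := fun t ht => (hN t ht).2.1.continuous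
  have hAub : ∀ t ∈ Icc 0 T, ∀ x i, |Au t x i| ≤ embConst (r - 2) * Real.sqrt K := by
    intro t ht x i
    have he : ∀ k, ‖vecFourierCoeff (Au t) k‖ =
        freqNorm k ^ (2 : ℝ) * ‖vecFourierCoeff (u t) k‖ := by
      intro k
      rw [hAuc t ht, norm_smul, Real.norm_of_nonneg (sq_nonneg _), Real.rpow_two]
    have h2 := hl t ht 2 (by linarith)
    refine (abs_component_le_tsum (hAuc0 t ht) (hAu t ht).1 ?_ x i).trans ?_
    · simpa only [he] using h2.1
    · simpa only [he] using h2.2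
  have hNb : ∀ t ∈ Icc 0 T, ∀ x i, |N t x i| ≤
      (embConst (r - 0) * Real.sqrt K) * (embConst (r - 1) * Real.sqrt K) := by
    intro t ht x i
    have hs : Summable fun k => ‖vecFourierCoeff (N t) k‖ :=
      (hconv t ht).2.2.1.of_nonneg_of_le (fun _ => norm_nonneg _) fun k => (hNc t ht k).norm_le
    refine (abs_component_le_tsum (hNc0 t ht) (hN t ht).1 hs x i).trans ?_
    refine (hs.tsum_le_tsum (fun k => (hNc t ht k).norm_le) (hconv t ht).2.2.1).trans ?_
    refine (hconv t ht).2.2.2.trans ?_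
    have h0 := (hl t ht 0 (by linarith)).2
    have h1 := (hl t ht 1 (by linarith)).2
    simp only [Real.rpow_zero, one_mul, Real.rpow_one] at h0 h1
    refine mul_le_mul h0 h1 ?_ ?_
    · exact tsum_nonneg fun k => mul_nonneg (freqNorm_nonneg k) (norm_nonneg _)
    · exact mul_nonneg (embConst_nonneg _) (Real.sqrt_nonneg _)
  refine ⟨vecFourierCoeff (N t) k, hNc t (Ioo_subset_Icc_self ht) k, ?_⟩
  have hmain := hasDerivAt_vecFourierCoeff (u := u) (w := fun t x => -(ν • Au t x) - N t x)
    (B := |ν| * (embConst (r - 2) * Real.sqrt K) +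
      (embConst (r - 0) * Real.sqrt K) * (embConst (r - 1) * Real.sqrt K))
    (fun t ht => (hu.mem t ht).continuous)
    (fun t ht => (((hAuc0 t ht).const_smul ν).neg).sub (hNc0 t ht))
    (fun t ht x i => ?_) hder ht k
  · have ht' := Ioo_subset_Icc_self ht
    have e : vecFourierCoeff (fun x => -(ν • Au t x) - N t x) k =
        -((ν * freqNorm k ^ 2) • vecFourierCoeff (u t) k) - vecFourierCoeff (N t) k := by
      have h1 : (fun x => -(ν • Au t x) - N t x) = (fun x => -(ν • Au t x)) - N t := rfl
      have h2 : vecFourierCoeff (fun x => ν • Au t x) k = ν • vecFourierCoeff (Au t) k := by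
        ext i
        rw [vecFourierCoeff_apply, PiLp.smul_apply, vecFourierCoeff_apply, Complex.real_smul,
          ← coef_const_mul]
        congr 1
        ext x
        simp
      rw [h1, vecFourierCoeff_sub (v := fun x => -(ν • Au t x))
        (((hAuc0 t ht').const_smul ν).neg) (hNc0 t ht'),
        vecFourierCoeff_neg, h2, hAuc t ht', smul_smul]
    rwa [e] at hmain
  · have h1 : (-(ν • Au t x) - N t x) i = -(ν * Au t x i) - N t x i := by simp
    rw [h1]
    refine (abs_sub _ _).trans ?_
    rw [abs_neg, abs_mul]
    exact add_le_add (mul_le_mul_of_nonneg_left (hAub t ht x i) (abs_nonneg _)) (hNb t ht x i)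

/-- The Leray projection of a divergence free datum is the datum itself. -/
lemma IsSolution.initial_coef {ν r T : ℝ} {a : R3 → R3} {u : ℝ → R3 → R3}
    (hu : IsSolution ν r T a u) (ha : MemSobolev r a) (k : Freq) :
    vecFourierCoeff (u 0) k = vecFourierCoeff a k :=
  (hu.initial.isLerayCoef k).eq_of_dotc (ha.div_free k)

lemma IsSolution.mono {ν r T T' : ℝ} {a : R3 → R3} {u : ℝ → R3 → R3}
    (hu : IsSolution ν r T' a u) (hT : T ≤ T') : IsSolution ν r T a u := by
  have hsub : Icc 0 T ⊆ Icc 0 T' := Icc_subset_Icc_right hT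
  refine ⟨fun t ht => hu.mem t (hsub ht), fun t ht => ?_, hu.initial, fun t ht => ?_⟩
  · exact (hu.continuous_in_time t (hsub ht)).mono_left (nhdsWithin_mono _ hsub)
  · obtain ⟨Au, N, h1, h2, h3⟩ := hu.equation t (hsub ht)
    exact ⟨Au, N, h1, h2, fun x => (h3 x).mono hsub⟩

lemma exists_isSolution_of_lt_lifespan {ν r T : ℝ} {a : R3 → R3}
    (h : ENNReal.ofReal T < lifespan ν r a) : ∃ u, IsSolution ν r T a u := by
  rw [lifespan] at h
  obtain ⟨T', h1⟩ := lt_iSup_iff.1 h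
  obtain ⟨⟨hT', u, hu⟩, h2⟩ := lt_iSup_iff.1 h1
  refine ⟨u, hu.mono ?_⟩
  exact ((ENNReal.ofReal_lt_ofReal_iff hT').1 h2).le

/-! ### Pointwise inequalities for the Gevrey weights -/

lemma abs_rpow_sub_le {r a b c : ℝ} (hr : 1 ≤ r) (ha : 1 ≤ a) (hb : 1 ≤ b) (hc : 1 ≤ c)
    (h1 : c ≤ a + b) (h2 : b ≤ a + c) : |c ^ r - b ^ r| ≤ r * (a + b) ^ (r - 1) * a := by
  have key : ∀ x y : ℝ, 0 < x → x ≤ y → y ≤ a + b → y - x ≤ a →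
      y ^ r - x ^ r ≤ r * (a + b) ^ (r - 1) * a := by
    intro x y hx hxy hy hd
    have hy0 : 0 < y := hx.trans_le hxy
    have hs : -1 ≤ (x - y) / y := by rw [le_div_iff₀ hy0]; linarith
    have h := one_add_mul_self_le_rpow_one_add hs hr
    have e : 1 + (x - y) / y = x / y := by field_simp; ring
    rw [e, Real.div_rpow hx.le hy0.le, le_div_iff₀ (Real.rpow_pos_of_pos hy0 r)] at h
    have e2 : (1 + r * ((x - y) / y)) * y ^ r = y ^ r - r * y ^ (r - 1) * (y - x) := by
      rw [Real.rpow_sub_one hy0.ne']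
      field_simp
      ring
    rw [e2] at h
    calc y ^ r - x ^ r ≤ r * y ^ (r - 1) * (y - x) := by linarith
      _ ≤ r * (a + b) ^ (r - 1) * a := by
        have := Real.rpow_le_rpow hy0.le hy (by linarith : 0 ≤ r - 1)
        have h0 : 0 ≤ y ^ (r - 1) := Real.rpow_nonneg hy0.le _
        apply mul_le_mul (mul_le_mul_of_nonneg_left this (by linarith)) hd (by linarith)
        exact mul_nonneg (by linarith) (h0.trans this)
  rcases le_total b c with h | h
  · rw [abs_of_nonneg (sub_nonneg.2 (Real.rpow_le_rpow (by linarith) h (by linarith)))]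
    exact key b c (by linarith) h h1 (by linarith)
  · rw [abs_sub_comm,
      abs_of_nonneg (sub_nonneg.2 (Real.rpow_le_rpow (by linarith) h (by linarith)))]
    exact key c b (by linarith) h (by linarith) (by linarith)

lemma add_rpow_le_two_rpow {q a b : ℝ} (hq : 0 ≤ q) (ha : 0 ≤ a) (hb : 0 ≤ b) :
    (a + b) ^ q ≤ 2 ^ q * (a ^ q + b ^ q) := by
  have key : ∀ x y : ℝ, 0 ≤ x → x ≤ y → (x + y) ^ q ≤ 2 ^ q * (x ^ q + y ^ q) := by
    intro x y hx hxy
    calc (x + y) ^ q ≤ (2 * y) ^ q := Real.rpow_le_rpow (by linarith) (by linarith) hq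
      _ = 2 ^ q * y ^ q := Real.mul_rpow (by norm_num) (by linarith)
      _ ≤ 2 ^ q * (x ^ q + y ^ q) := mul_le_mul_of_nonneg_left
          (by linarith [Real.rpow_nonneg hx q]) (Real.rpow_nonneg (by norm_num) _)
  rcases le_total a b with h | h
  · exact key a b ha h
  · rw [add_comm a, add_comm (a ^ q)]
    exact key b a hb h

lemma rpow_le_add_rpow {p a b c : ℝ} (hp0 : 0 < p) (hp1 : p ≤ 1) (ha : 0 ≤ a) (hb : 0 ≤ b)
    (hc : 0 ≤ c) (h : c ≤ a + b) : c ^ p ≤ a ^ p + b ^ p :=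
  (Real.rpow_le_rpow hc h hp0.le).trans (Real.rpow_add_le_add_rpow ha hb hp0.le hp1)

lemma abs_rpow_sub_le_rpow {p a b c : ℝ} (hp0 : 0 < p) (hp1 : p ≤ 1) (ha : 0 ≤ a) (hb : 0 ≤ b)
    (hc : 0 ≤ c) (h1 : c ≤ a + b) (h2 : b ≤ a + c) : |c ^ p - b ^ p| ≤ a ^ p := by
  rw [abs_sub_le_iff]
  constructor
  · linarith [rpow_le_add_rpow hp0 hp1 ha hb hc h1]
  · linarith [rpow_le_add_rpow hp0 hp1 ha hc hb h2]

lemma mul_abs_rpow_sub_le {p a b c : ℝ} (hp0 : 0 < p) (hp1 : p ≤ 1) (hb : 0 < b)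
    (hc : 0 < c) (h1 : c ≤ a + b) (h2 : b ≤ a + c) : b * |c ^ p - b ^ p| ≤ a * b ^ p := by
  have hbp : 0 < b ^ p := Real.rpow_pos_of_pos hb p
  have e : c ^ p = b ^ p * (c / b) ^ p := by
    rw [Real.div_rpow hc.le hb.le]; field_simp
  have hx0 : 0 < c / b := div_pos hc hb
  have key : |(c / b) ^ p - 1| ≤ |c / b - 1| := by
    rcases le_total 1 (c / b) with h | h
    · have h3 := Real.rpow_le_rpow_of_exponent_le h hp1
      have h4 := Real.one_le_rpow h hp0.le
      rw [Real.rpow_one] at h3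
      rw [abs_of_nonneg (by linarith), abs_of_nonneg (by linarith)]
      linarith
    · have h3 := Real.rpow_le_rpow_of_exponent_ge hx0 h hp1
      have h4 := Real.rpow_le_one hx0.le h hp0.le
      rw [Real.rpow_one] at h3
      rw [abs_of_nonpos (by linarith), abs_of_nonpos (by linarith)]
      linarith
  have e2 : |c ^ p - b ^ p| = b ^ p * |(c / b) ^ p - 1| := by
    rw [e, ← abs_of_pos hbp, ← abs_mul, abs_of_pos hbp]
    congr 1; ring
  have e3 : b * |c / b - 1| ≤ a := by
    rw [← abs_of_pos hb, ← abs_mul, abs_of_pos hb, mul_sub, mul_div_cancel₀ _ hb.ne', mul_one,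
      abs_sub_le_iff]
    constructor <;> linarith
  calc b * |c ^ p - b ^ p| = b ^ p * (b * |(c / b) ^ p - 1|) := by rw [e2]; ring
    _ ≤ b ^ p * (b * |c / b - 1|) := by gcongr
    _ ≤ b ^ p * a := by gcongr
    _ = a * b ^ p := mul_comm _ _

lemma abs_exp_sub_exp_le {x y z : ℝ} (hx : x ≤ z) (hy : y ≤ z) :
    |Real.exp x - Real.exp y| ≤ |x - y| * Real.exp z := by
  have key : ∀ x y : ℝ, y ≤ x → x ≤ z → Real.exp x - Real.exp y ≤ (x - y) * Real.exp z := by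
    intro x y hyx hxz
    have h1 : 1 + (y - x) ≤ Real.exp (y - x) := by linarith [Real.add_one_le_exp (y - x)]
    have h2 : Real.exp y = Real.exp x * Real.exp (y - x) := by rw [← Real.exp_add]; ring_nf
    calc Real.exp x - Real.exp y ≤ (x - y) * Real.exp x := by
          rw [h2]; nlinarith [Real.exp_pos x]
      _ ≤ (x - y) * Real.exp z := mul_le_mul_of_nonneg_left (Real.exp_le_exp.2 hxz) (by linarith)
  rcases le_total y x with h | h
  · rw [abs_of_nonneg (sub_nonneg.2 (Real.exp_le_exp.2 h)), abs_of_nonneg (by linarith)]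
    exact key x y h hx
  · rw [abs_sub_comm, abs_sub_comm x, abs_of_nonneg (sub_nonneg.2 (Real.exp_le_exp.2 h)),
      abs_of_nonneg (by linarith)]
    exact key y x h hy

/-- For frequencies at least one, half a derivative of order `p` on the factor `b` can be moved
to the two other factors. -/
lemma rpow_half_le {p a b c : ℝ} (hp0 : 0 < p) (hp1 : p ≤ 1) (ha : 1 ≤ a) (hb : 1 ≤ b)
    (hc : 1 ≤ c) (h : b ≤ a + c) : b ^ (p / 2) ≤ 2 * (a ^ (p / 2) * c ^ (p / 2)) := by
  have h1 : b ≤ 2 * (a * c) := by nlinarith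
  calc b ^ (p / 2) ≤ (2 * (a * c)) ^ (p / 2) :=
        Real.rpow_le_rpow (by linarith) h1 (by linarith)
    _ = 2 ^ (p / 2) * (a ^ (p / 2) * c ^ (p / 2)) := by
        rw [Real.mul_rpow (by norm_num) (by positivity), Real.mul_rpow (by linarith) (by linarith)]
    _ ≤ 2 * (a ^ (p / 2) * c ^ (p / 2)) := by
        have : (2 : ℝ) ^ (p / 2) ≤ 2 ^ (1 : ℝ) :=
          Real.rpow_le_rpow_of_exponent_le (by norm_num) (by linarith)
        rw [Real.rpow_one] at this
        gcongr

/-- The commutator bound for the weight `c ↦ c^r e^{τ c^p}` on a triad of frequencies, where `a` is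
that of the transporting and `b` that of the transported field. The difference of the polynomial
weights gains a full derivative; that of the exponential weights costs a factor `τ` and gains only
`1 - p` derivatives, and the missing `p` are distributed as `p/2` on each of two factors. -/
lemma weight_commutator_le {r p τ a b c : ℝ} (hr : 1 ≤ r) (hp0 : 0 < p) (hp1 : p ≤ 1)
    (hτ : 0 ≤ τ) (ha : 1 ≤ a) (hb : 1 ≤ b) (hc : 1 ≤ c) (h1 : c ≤ a + b) (h2 : b ≤ a + c)
    (h3 : a ≤ b + c) :
    b * |c ^ r * Real.exp (τ * c ^ p) - b ^ r * Real.exp (τ * b ^ p)| *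
        (c ^ r * Real.exp (τ * c ^ p)) ≤
      r * 2 ^ r * (a * (b ^ r * Real.exp (τ * b ^ p)) * (c ^ r * Real.exp (τ * c ^ p)) +
        (b * Real.exp (τ * b ^ p)) * a ^ r * (c ^ r * Real.exp (τ * c ^ p))) +
      2 * 2 ^ r * τ * ((a ^ (1 + p / 2) * Real.exp (τ * a ^ p)) *
          (b ^ (r + p / 2) * Real.exp (τ * b ^ p)) * (c ^ (r + p / 2) * Real.exp (τ * c ^ p)) +
        (b ^ (1 + p / 2) * Real.exp (τ * b ^ p)) *
          (a ^ (r + p / 2) * Real.exp (τ * a ^ p)) *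
            (c ^ (r + p / 2) * Real.exp (τ * c ^ p))) := by
  have ha0 : 0 < a := by linarith
  have hb0 : 0 < b := by linarith
  have hc0 : 0 < c := by linarith
  have hr0 : 0 ≤ r := by linarith
  set Ea := Real.exp (τ * a ^ p) with hEa
  set Eb := Real.exp (τ * b ^ p) with hEb
  set Ec := Real.exp (τ * c ^ p) with hEc
  have hEa0 : 0 < Ea := Real.exp_pos _
  have hEb0 : 0 < Eb := Real.exp_pos _
  have hEc0 : 0 < Ec := Real.exp_pos _
  have hexp : |Ec - Eb| ≤ τ * |c ^ p - b ^ p| * (Ea * Eb) := by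
    have hz1 : τ * c ^ p ≤ τ * a ^ p + τ * b ^ p := by
      rw [← mul_add]
      exact mul_le_mul_of_nonneg_left (rpow_le_add_rpow hp0 hp1 ha0.le hb0.le hc0.le h1) hτ
    have hz2 : τ * b ^ p ≤ τ * a ^ p + τ * b ^ p := by
      linarith [mul_nonneg hτ (Real.rpow_nonneg ha0.le p)]
    have := abs_exp_sub_exp_le hz1 hz2
    rwa [Real.exp_add, ← mul_sub, abs_mul, abs_of_nonneg hτ] at this
  have hpow : |c ^ r - b ^ r| * b ≤ r * 2 ^ r * (a * b ^ r + b * a ^ r) := by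
    have h4 := abs_rpow_sub_le hr ha hb hc h1 h2
    have h5 := add_rpow_le_two_rpow (q := r - 1) (by linarith) ha0.le hb0.le
    have h6 : (2 : ℝ) ^ (r - 1) ≤ 2 ^ r :=
      Real.rpow_le_rpow_of_exponent_le (by norm_num) (by linarith)
    have ea : a ^ r = a ^ (r - 1) * a := by
      rw [Real.rpow_sub_one ha0.ne']; field_simp
    have eb : b ^ r = b ^ (r - 1) * b := by
      rw [Real.rpow_sub_one hb0.ne']; field_simp
    have hs : 0 ≤ a ^ (r - 1) + b ^ (r - 1) := by positivity
    calc |c ^ r - b ^ r| * b ≤ r * (a + b) ^ (r - 1) * a * b := by gcongr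
      _ ≤ r * (2 ^ r * (a ^ (r - 1) + b ^ (r - 1))) * a * b := by
          have := h5.trans (mul_le_mul_of_nonneg_right h6 hs)
          gcongr
      _ = r * 2 ^ r * (a * b ^ r + b * a ^ r) := by rw [ea, eb]; ring
  have hcr : c ^ r ≤ 2 ^ r * (a ^ r + b ^ r) :=
    (Real.rpow_le_rpow hc0.le h1 hr0).trans (add_rpow_le_two_rpow hr0 ha0.le hb0.le)
  have hsub : b * (|c ^ p - b ^ p| * c ^ r) * c ^ r ≤
      2 * 2 ^ r * (a ^ (1 + p / 2) * b ^ (r + p / 2) * c ^ (r + p / 2) +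
        b ^ (1 + p / 2) * a ^ (r + p / 2) * c ^ (r + p / 2)) := by
    have h7 := abs_rpow_sub_le_rpow hp0 hp1 ha0.le hb0.le hc0.le h1 h2
    have h8 := mul_abs_rpow_sub_le hp0 hp1 hb0 hc0 h1 h2
    have h9 := rpow_half_le hp0 hp1 ha hb hc h2
    have h10 := rpow_half_le hp0 hp1 hb ha hc h3
    have e : ∀ x : ℝ, 0 < x → x ^ p = x ^ (p / 2) * x ^ (p / 2) := fun x hx => by
      rw [← Real.rpow_add hx]; ring_nf
    have e1 : ∀ x : ℝ, 0 < x → x ^ (1 + p / 2) = x * x ^ (p / 2) := fun x hx => by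
      rw [Real.rpow_add hx, Real.rpow_one]
    have e2 : ∀ x : ℝ, 0 < x → x ^ (r + p / 2) = x ^ r * x ^ (p / 2) := fun x hx => by
      rw [Real.rpow_add hx]
    have hpart1 : b * |c ^ p - b ^ p| * b ^ r ≤
        2 * (a ^ (1 + p / 2) * b ^ (r + p / 2) * c ^ (p / 2)) := by
      calc b * |c ^ p - b ^ p| * b ^ r ≤ a * b ^ p * b ^ r := by gcongr
        _ = a * (b ^ r * b ^ (p / 2)) * b ^ (p / 2) := by rw [e b hb0]; ring
        _ ≤ a * (b ^ r * b ^ (p / 2)) * (2 * (a ^ (p / 2) * c ^ (p / 2))) := by gcongr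
        _ = _ := by rw [e1 a ha0, e2 b hb0]; ring
    have hpart2 : b * |c ^ p - b ^ p| * a ^ r ≤
        2 * (b ^ (1 + p / 2) * a ^ (r + p / 2) * c ^ (p / 2)) := by
      calc b * |c ^ p - b ^ p| * a ^ r ≤ b * a ^ p * a ^ r := by gcongr
        _ = b * (a ^ r * a ^ (p / 2)) * a ^ (p / 2) := by rw [e a ha0]; ring
        _ ≤ b * (a ^ r * a ^ (p / 2)) * (2 * (b ^ (p / 2) * c ^ (p / 2))) := by gcongr
        _ = _ := by rw [e1 b hb0, e2 a ha0]; ring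
    calc b * (|c ^ p - b ^ p| * c ^ r) * c ^ r
        ≤ b * (|c ^ p - b ^ p| * (2 ^ r * (a ^ r + b ^ r))) * c ^ r := by gcongr
      _ = 2 ^ r * (b * |c ^ p - b ^ p| * b ^ r + b * |c ^ p - b ^ p| * a ^ r) * c ^ r := by ring
      _ ≤ 2 ^ r * (2 * (a ^ (1 + p / 2) * b ^ (r + p / 2) * c ^ (p / 2)) +
            2 * (b ^ (1 + p / 2) * a ^ (r + p / 2) * c ^ (p / 2))) * c ^ r := by gcongr
      _ = _ := by rw [e2 c hc0]; ring
  have hsplit : |c ^ r * Ec - b ^ r * Eb| ≤ |c ^ r - b ^ r| * Eb + c ^ r * |Ec - Eb| := by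
    have : c ^ r * Ec - b ^ r * Eb = (c ^ r - b ^ r) * Eb + c ^ r * (Ec - Eb) := by ring
    rw [this]
    refine (abs_add_le _ _).trans ?_
    rw [abs_mul, abs_mul, abs_of_pos hEb0, abs_of_nonneg (Real.rpow_nonneg hc0.le r)]
  calc b * |c ^ r * Ec - b ^ r * Eb| * (c ^ r * Ec)
      ≤ b * (|c ^ r - b ^ r| * Eb + c ^ r * |Ec - Eb|) * (c ^ r * Ec) := by gcongr
    _ ≤ b * (|c ^ r - b ^ r| * Eb + c ^ r * (τ * |c ^ p - b ^ p| * (Ea * Eb))) * (c ^ r * Ec) := by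
        gcongr
    _ = (|c ^ r - b ^ r| * b) * (Eb * (c ^ r * Ec)) +
          (b * (|c ^ p - b ^ p| * c ^ r) * c ^ r) * (τ * (Ea * Eb * Ec)) := by ring
    _ ≤ (r * 2 ^ r * (a * b ^ r + b * a ^ r)) * (Eb * (c ^ r * Ec)) +
          (2 * 2 ^ r * (a ^ (1 + p / 2) * b ^ (r + p / 2) * c ^ (r + p / 2) +
            b ^ (1 + p / 2) * a ^ (r + p / 2) * c ^ (r + p / 2))) * (τ * (Ea * Eb * Ec)) := by
        gcongr
    _ = _ := by ring

/-! ### The nonlinear term -/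

lemma summable_sq_of_summable {ι : Type*} {f : ι → ℝ} (hf0 : ∀ i, 0 ≤ f i) (hf : Summable f) :
    Summable fun i => f i ^ 2 := by
  refine (hf.mul_left (∑' i, f i)).of_nonneg_of_le (fun i => sq_nonneg _) fun i => ?_
  rw [sq]
  exact mul_le_mul_of_nonneg_right (hf.le_tsum i fun j _ => hf0 j) (hf0 i)

/-- Young's inequality `ℓ¹ * ℓ² ⊆ ℓ²`, paired with an `ℓ²` sequence. -/
lemma trilinear_bound {α β γ : Freq → ℝ} (hα0 : ∀ k, 0 ≤ α k) (hβ0 : ∀ k, 0 ≤ β k)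
    (hγ0 : ∀ k, 0 ≤ γ k) (hα : Summable α) (hβ : Summable fun k => β k ^ 2)
    (hγ : Summable fun k => γ k ^ 2) :
    (Summable fun x : Freq × Freq => α x.2 * β (x.1 - x.2) * γ x.1) ∧
      ∑' x : Freq × Freq, α x.2 * β (x.1 - x.2) * γ x.1 ≤
        (∑' k, α k) * (Real.sqrt (∑' k, β k ^ 2) * Real.sqrt (∑' k, γ k ^ 2)) := by
  set D := Real.sqrt (∑' k, β k ^ 2) * Real.sqrt (∑' k, γ k ^ 2) with hD
  have hin : ∀ j, (Summable fun k => β (k - j) * γ k) ∧ ∑' k, β (k - j) * γ k ≤ D := by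
    intro j
    have h := summable_mul_of_sq (f := fun k => β (k - j)) (g := γ) (fun k => hβ0 _) hγ0
      ((Equiv.subRight j).summable_iff.2 hβ) hγ
    have e : ∑' k, β (k - j) ^ 2 = ∑' k, β k ^ 2 :=
      (Equiv.subRight j).tsum_eq (fun k => β k ^ 2)
    rw [e] at h
    exact h
  have hrow : ∀ j, ∑' k, α j * β (k - j) * γ k = α j * ∑' k, β (k - j) * γ k := fun j => by
    rw [← tsum_mul_left]
    exact tsum_congr fun k => by ring
  have hle : ∀ j, ∑' k, α j * β (k - j) * γ k ≤ α j * D := fun j => by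
    rw [hrow]
    exact mul_le_mul_of_nonneg_left (hin j).2 (hα0 j)
  have h0 : ∀ x : Freq × Freq, 0 ≤ α x.1 * β (x.2 - x.1) * γ x.2 := fun x =>
    mul_nonneg (mul_nonneg (hα0 _) (hβ0 _)) (hγ0 _)
  have hrs : Summable fun j => ∑' k, α j * β (k - j) * γ k :=
    (hα.mul_right D).of_nonneg_of_le (fun j => tsum_nonneg fun k => h0 (j, k)) hle
  have hs : Summable fun x : Freq × Freq => α x.1 * β (x.2 - x.1) * γ x.2 := by
    rw [summable_prod_of_nonneg h0]
    refine ⟨fun j => ?_, hrs⟩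
    exact ((hin j).1.mul_left (α j)).congr fun k => by ring
  refine ⟨(Equiv.prodComm Freq Freq).summable_iff.2 hs, ?_⟩
  have e : ∑' x : Freq × Freq, α x.2 * β (x.1 - x.2) * γ x.1 =
      ∑' x : Freq × Freq, α x.1 * β (x.2 - x.1) * γ x.2 :=
    (Equiv.prodComm Freq Freq).tsum_eq (fun x : Freq × Freq => α x.1 * β (x.2 - x.1) * γ x.2)
  rw [e, hs.tsum_prod, ← tsum_mul_right]
  exact hrs.tsum_le_tsum hle (hα.mul_right D)

/-- The involution `(k, j) ↦ (k, k - j)` exchanging the two factors of a convolution. -/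
def swapEquiv : Freq × Freq ≃ Freq × Freq where
  toFun x := (x.1, x.1 - x.2)
  invFun x := (x.1, x.1 - x.2)
  left_inv x := by simp
  right_inv x := by simp

lemma trilinear_bound_swap {α β γ : Freq → ℝ} (hα0 : ∀ k, 0 ≤ α k) (hβ0 : ∀ k, 0 ≤ β k)
    (hγ0 : ∀ k, 0 ≤ γ k) (hα : Summable α) (hβ : Summable fun k => β k ^ 2)
    (hγ : Summable fun k => γ k ^ 2) :
    (Summable fun x : Freq × Freq => α (x.1 - x.2) * β x.2 * γ x.1) ∧
      ∑' x : Freq × Freq, α (x.1 - x.2) * β x.2 * γ x.1 ≤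
        (∑' k, α k) * (Real.sqrt (∑' k, β k ^ 2) * Real.sqrt (∑' k, γ k ^ 2)) := by
  have h := trilinear_bound hα0 hβ0 hγ0 hα hβ hγ
  have e : (fun x : Freq × Freq => α (x.1 - x.2) * β x.2 * γ x.1) =
      (fun x : Freq × Freq => α x.2 * β (x.1 - x.2) * γ x.1) ∘ swapEquiv := by
    ext x; simp [swapEquiv]
  rw [e]
  refine ⟨swapEquiv.summable_iff.2 h.1, ?_⟩
  exact (swapEquiv.tsum_eq (fun x : Freq × Freq => α x.2 * β (x.1 - x.2) * γ x.1)).trans_le h.2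

/-- The terms of `⟨v, (a · ∇) v⟩`, indexed by the frequencies of `v` and of `a`. -/
noncomputable def transportTerm (a v : Freq → C3) (x : Freq × Freq) : ℂ :=
  (Complex.I * dotc x.1 (a x.2)) * inner ℂ (v x.1) (v (x.1 - x.2))

lemma norm_transportTerm_le {a : Freq → C3} (hdiv : ∀ k, dotc k (a k) = 0) (v : Freq → C3)
    (x : Freq × Freq) : ‖transportTerm a v x‖ ≤
      ‖a x.2‖ * (freqNorm (x.1 - x.2) * ‖v (x.1 - x.2)‖) * ‖v x.1‖ := by
  have : dotc x.1 (a x.2) = dotc (x.1 - x.2) (a x.2) := by rw [dotc_sub_left, hdiv, sub_zero]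
  rw [transportTerm, norm_mul, norm_mul, Complex.norm_I, one_mul, this]
  calc _ ≤ (freqNorm (x.1 - x.2) * ‖a x.2‖) * (‖v x.1‖ * ‖v (x.1 - x.2)‖) := by
        gcongr
        · exact mul_nonneg (freqNorm_nonneg _) (norm_nonneg _)
        · exact norm_dotc_le _ _
        · exact norm_inner_le_norm _ _
    _ = _ := by ring

/-- Transport by a real divergence free field is skew-adjoint: the terms at `(k, j)` and at
`(k - j, -j)` have opposite real parts. -/
lemma re_tsum_transportTerm {a : Freq → C3} (hreal : ∀ k i, a (-k) i = star (a k i))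
    (hdiv : ∀ k, dotc k (a k) = 0) (v : Freq → C3) :
    (∑' x, transportTerm a v x).re = 0 := by
  let e : Freq × Freq ≃ Freq × Freq :=
    { toFun := fun x => (x.1 - x.2, -x.2)
      invFun := fun x => (x.1 - x.2, -x.2)
      left_inv := fun x => by simp
      right_inv := fun x => by simp }
  have hd : ∀ k j, dotc k (a (-j)) = star (dotc k (a j)) := by
    intro k j
    simp only [dotc, hreal, star_sum, star_mul']
    refine Finset.sum_congr rfl fun i _ => ?_
    simp
  have h1 : ∀ x, transportTerm a v (e x) = -star (transportTerm a v x) := by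
    intro x
    have h2 : dotc (x.1 - x.2) (a x.2) = dotc x.1 (a x.2) := by
      rw [dotc_sub_left, hdiv, sub_zero]
    simp only [transportTerm, e, Equiv.coe_fn_mk, hd, h2, sub_neg_eq_add, sub_add_cancel]
    rw [star_mul', star_mul', ← inner_conj_symm (v x.1) (v (x.1 - x.2))]
    simp
  have h3 : ∑' x, transportTerm a v x = -star (∑' x, transportTerm a v x) := by
    calc ∑' x, transportTerm a v x = ∑' x, transportTerm a v (e x) := (e.tsum_eq _).symm
      _ = -star (∑' x, transportTerm a v x) := by rw [tsum_congr h1, tsum_neg, ← tsum_star]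
  have h4 := congrArg Complex.re h3
  simp at h4
  linarith

/-- The Fourier form of `‖a‖²` in the Gevrey space, with `p = 1/s`. -/
noncomputable def gev (p r τ : ℝ) (a : Freq → C3) : ℝ :=
  ∑' k, freqNorm k ^ (2 * r) * Real.exp (2 * τ * freqNorm k ^ p) * ‖a k‖ ^ 2

lemma gev_nonneg (p r τ : ℝ) (a : Freq → C3) : 0 ≤ gev p r τ a :=
  tsum_nonneg fun k => mul_nonneg (mul_nonneg (Real.rpow_nonneg (freqNorm_nonneg k) _)
    (Real.exp_pos _).le) (sq_nonneg _)

/-- Coefficients decaying faster than `|k|^{-q} e^{-τ|k|^p}` for every `q`. -/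
def Rapid (p τ : ℝ) (a : Freq → C3) : Prop :=
  ∀ q : ℝ, 0 ≤ q →
    Summable fun k => freqNorm k ^ q * Real.exp (τ * freqNorm k ^ p) * ‖a k‖

lemma gev_zero (p r : ℝ) (a : Freq → C3) : gev p r 0 a = energy r a := by
  simp [gev, energy]

lemma weight_sq (p q τ : ℝ) (a : Freq → C3) (k : Freq) :
    (freqNorm k ^ q * Real.exp (τ * freqNorm k ^ p) * ‖a k‖) ^ 2 =
      freqNorm k ^ (2 * q) * Real.exp (2 * τ * freqNorm k ^ p) * ‖a k‖ ^ 2 := by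
  rw [mul_pow, mul_pow, ← Real.rpow_natCast (freqNorm k ^ q), ← Real.rpow_mul (freqNorm_nonneg k),
    ← Real.exp_nat_mul]
  congr 3 <;> push_cast <;> ring_nf

lemma Rapid.mono {p τ τ' : ℝ} {a : Freq → C3} (h : Rapid p τ a) (hτ : τ' ≤ τ) :
    Rapid p τ' a := fun q hq => by
  refine (h q hq).of_nonneg_of_le (fun k => ?_) fun k => ?_
  · exact mul_nonneg (mul_nonneg (Real.rpow_nonneg (freqNorm_nonneg k) _) (Real.exp_pos _).le)
      (norm_nonneg _)
  · refine mul_le_mul_of_nonneg_right (mul_le_mul_of_nonneg_left (Real.exp_le_exp.2 ?_)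
      (Real.rpow_nonneg (freqNorm_nonneg k) _)) (norm_nonneg _)
    exact mul_le_mul_of_nonneg_right hτ (Real.rpow_nonneg (freqNorm_nonneg k) _)

lemma weighted_nonneg (p q τ : ℝ) (a : Freq → C3) (k : Freq) :
    0 ≤ freqNorm k ^ q * Real.exp (τ * freqNorm k ^ p) * ‖a k‖ :=
  mul_nonneg (mul_nonneg (Real.rpow_nonneg (freqNorm_nonneg k) _) (Real.exp_pos _).le)
    (norm_nonneg _)

lemma Rapid.summable_sq {p τ : ℝ} {a : Freq → C3} (h : Rapid p τ a) {q : ℝ} (hq : 0 ≤ q) :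
    Summable fun k => (freqNorm k ^ q * Real.exp (τ * freqNorm k ^ p) * ‖a k‖) ^ 2 :=
  summable_sq_of_summable (weighted_nonneg p q τ a) (h q hq)

lemma Rapid.summable_gev {p τ : ℝ} {a : Freq → C3} (h : Rapid p τ a) {q : ℝ} (hq : 0 ≤ q) :
    Summable fun k => freqNorm k ^ (2 * q) * Real.exp (2 * τ * freqNorm k ^ p) * ‖a k‖ ^ 2 :=
  (h.summable_sq hq).congr (weight_sq p q τ a)

/-- The sum `∑ |k|^q e^{τ|k|^p} |aₖ|`. -/
noncomputable def wiener (p q τ : ℝ) (a : Freq → C3) : ℝ :=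
  ∑' k, freqNorm k ^ q * Real.exp (τ * freqNorm k ^ p) * ‖a k‖

/-- The production of Gevrey energy by the nonlinear term, i.e. the inner product of `a` with
`(a · ∇) a` in the Gevrey space. -/
noncomputable def production (p r τ : ℝ) (a : Freq → C3) : ℝ :=
  ∑' k, freqNorm k ^ (2 * r) * Real.exp (2 * τ * freqNorm k ^ p) *
    (inner ℂ (a k) (conv a a k)).re

/-- The nonlinear estimate in terms of `ℓ¹` and `ℓ²` norms. -/
lemma abs_production_le {p r τ : ℝ} {a : Freq → C3} (hr : 1 ≤ r) (hp0 : 0 < p) (hp1 : p ≤ 1)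
    (hτ : 0 ≤ τ) (ha : Admissible r a) (hR : Rapid p τ a) :
    (Summable fun k => freqNorm k ^ (2 * r) * Real.exp (2 * τ * freqNorm k ^ p) *
      (inner ℂ (a k) (conv a a k)).re) ∧
    |production p r τ a| ≤
      r * 2 ^ r * (wiener p 1 0 a * gev p r τ a +
        wiener p 1 τ a * (Real.sqrt (energy r a) * Real.sqrt (gev p r τ a))) +
      2 * 2 ^ r * τ * (2 * (wiener p (1 + p / 2) τ a * gev p (r + p / 2) τ a)) := by
  have hr0 : 0 ≤ r := by linarith
  have hR0 : Rapid p 0 a := hR.mono hτ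
  let m : Freq → ℝ := fun k => freqNorm k ^ r * Real.exp (τ * freqNorm k ^ p)
  have hm0 : ∀ k, 0 ≤ m k := fun k =>
    mul_nonneg (Real.rpow_nonneg (freqNorm_nonneg k) _) (Real.exp_pos _).le
  let W : ℝ → ℝ → Freq → ℝ := fun q σ k =>
    freqNorm k ^ q * Real.exp (σ * freqNorm k ^ p) * ‖a k‖
  have hW0 : ∀ q σ k, 0 ≤ W q σ k := fun q σ k => weighted_nonneg p q σ a k
  let v : Freq → C3 := fun k => (m k : ℂ) • a k
  have hnv : ∀ k, ‖v k‖ = W r τ k := fun k => by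
    simp only [v, norm_smul, Complex.norm_real, Real.norm_of_nonneg (hm0 k)]; rfl
  have hWg : ∀ q, ∑' k, W q τ k ^ 2 = gev p q τ a := fun q =>
    tsum_congr fun k => weight_sq p q τ a k
  have hWe : ∑' k, W r 0 k ^ 2 = energy r a := by
    rw [← gev_zero p]; exact tsum_congr fun k => weight_sq p r 0 a k
  have hq1 : (0 : ℝ) ≤ 1 + p / 2 := by linarith
  have hq2 : (0 : ℝ) ≤ r + p / 2 := by linarith
  -- Convolution bounds for the four products on the right of `weight_commutator_le`.
  have T1 := trilinear_bound (hW0 1 0) (hW0 r τ) (hW0 r τ) (hR0 1 zero_le_one)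
    (hR.summable_sq hr0) (hR.summable_sq hr0)
  have T2 := trilinear_bound_swap (hW0 1 τ) (hW0 r 0) (hW0 r τ) (hR 1 zero_le_one)
    (hR0.summable_sq hr0) (hR.summable_sq hr0)
  have T3 := trilinear_bound (hW0 (1 + p / 2) τ) (hW0 (r + p / 2) τ) (hW0 (r + p / 2) τ)
    (hR _ hq1) (hR.summable_sq hq2) (hR.summable_sq hq2)
  have T4 := trilinear_bound_swap (hW0 (1 + p / 2) τ) (hW0 (r + p / 2) τ) (hW0 (r + p / 2) τ)
    (hR _ hq1) (hR.summable_sq hq2) (hR.summable_sq hq2)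
  rw [hWg, Real.mul_self_sqrt (gev_nonneg _ _ _ _)] at T1 T3 T4
  rw [hWg, hWe] at T2
  let bd : Freq × Freq → ℝ := fun x =>
    r * 2 ^ r * (W 1 0 x.2 * W r τ (x.1 - x.2) * W r τ x.1 +
      W 1 τ (x.1 - x.2) * W r 0 x.2 * W r τ x.1) +
    2 * 2 ^ r * τ * (W (1 + p / 2) τ x.2 * W (r + p / 2) τ (x.1 - x.2) * W (r + p / 2) τ x.1 +
      W (1 + p / 2) τ (x.1 - x.2) * W (r + p / 2) τ x.2 * W (r + p / 2) τ x.1)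
  have hbds : Summable bd := ((T1.1.add T2.1).mul_left _).add ((T3.1.add T4.1).mul_left _)
  have hbdle : ∑' x, bd x ≤ r * 2 ^ r * (wiener p 1 0 a * gev p r τ a +
        wiener p 1 τ a * (Real.sqrt (energy r a) * Real.sqrt (gev p r τ a))) +
      2 * 2 ^ r * τ * (2 * (wiener p (1 + p / 2) τ a * gev p (r + p / 2) τ a)) := by
    rw [((T1.1.add T2.1).mul_left _).tsum_add ((T3.1.add T4.1).mul_left _), tsum_mul_left,
      tsum_mul_left, T1.1.tsum_add T2.1, T3.1.tsum_add T4.1, two_mul (wiener _ _ _ _ * _)]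
    have hc : 0 ≤ r * 2 ^ r := by positivity
    have hc' : 0 ≤ 2 * 2 ^ r * τ := by positivity
    exact add_le_add (mul_le_mul_of_nonneg_left (add_le_add T1.2 T2.2) hc)
      (mul_le_mul_of_nonneg_left (add_le_add T3.2 T4.2) hc')
  -- `c2` carries the weight `m k ^ 2`, the skew-adjoint term the weight `m k * m (k - j)`; their
  -- difference contains the commutator `m k - m (k - j)`.
  let c2 : Freq × Freq → ℂ := fun x =>
    (Complex.I * dotc x.1 (a x.2)) * ((m x.1 ^ 2 : ℝ) * inner ℂ (a x.1) (a (x.1 - x.2)))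
  have hc12 : ∀ x, ‖c2 x - transportTerm a v x‖ ≤ bd x := by
    rintro ⟨k, j⟩
    have e1 : c2 (k, j) - transportTerm a v (k, j) = (Complex.I * dotc k (a j)) *
        (((m k * (m k - m (k - j)) : ℝ) : ℂ) * inner ℂ (a k) (a (k - j))) := by
      simp only [c2, transportTerm, v, inner_smul_left, inner_smul_right, Complex.conj_ofReal]
      push_cast
      ring
    have hd : dotc k (a j) = dotc (k - j) (a j) := by rw [dotc_sub_left, ha.div, sub_zero]
    have hle : ‖c2 (k, j) - transportTerm a v (k, j)‖ ≤
        (freqNorm (k - j) * |m k - m (k - j)| * m k) * (‖a j‖ * ‖a (k - j)‖ * ‖a k‖) := by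
      rw [e1, norm_mul, norm_mul, norm_mul, Complex.norm_I, one_mul, Complex.norm_real,
        Real.norm_eq_abs, abs_mul, abs_of_nonneg (hm0 k), hd]
      calc _ ≤ (freqNorm (k - j) * ‖a j‖) * (m k * |m k - m (k - j)| * (‖a k‖ * ‖a (k - j)‖)) := by
            have := hm0 k
            gcongr
            · exact mul_nonneg (freqNorm_nonneg _) (norm_nonneg _)
            · exact norm_dotc_le _ _
            · exact norm_inner_le_norm _ _
        _ = _ := by ring
    refine hle.trans ?_
    have hbd0 : 0 ≤ bd (k, j) := by
      have := hW0
      have hc : 0 ≤ r * 2 ^ r := by positivity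
      have hc' : 0 ≤ 2 * 2 ^ r * τ := by positivity
      refine add_nonneg (mul_nonneg hc (add_nonneg ?_ ?_)) (mul_nonneg hc' (add_nonneg ?_ ?_)) <;>
        exact mul_nonneg (mul_nonneg (hW0 _ _ _) (hW0 _ _ _)) (hW0 _ _ _)
    by_cases hj : j = 0
    · simpa [hj, ha.zero] using hbd0
    by_cases hk : k = 0
    · simpa [hk, ha.zero] using hbd0
    by_cases hl : k - j = 0
    · simpa [hl, ha.zero] using hbd0
    have t1 : freqNorm k ≤ freqNorm j + freqNorm (k - j) := by
      simpa using freqNorm_add_le j (k - j)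
    have t2 : freqNorm (k - j) ≤ freqNorm j + freqNorm k := by
      have := freqNorm_add_le (-j) k
      rwa [freqNorm_neg, show -j + k = k - j by abel] at this
    have t3 : freqNorm j ≤ freqNorm (k - j) + freqNorm k := by
      have := freqNorm_add_le (-(k - j)) k
      rwa [freqNorm_neg, show -(k - j) + k = j by abel] at this
    have hmain := mul_le_mul_of_nonneg_right (weight_commutator_le hr hp0 hp1 hτ
      (one_le_freqNorm hj) (one_le_freqNorm hl) (one_le_freqNorm hk) t1 t2 t3)
      (mul_nonneg (mul_nonneg (norm_nonneg (a j)) (norm_nonneg (a (k - j)))) (norm_nonneg (a k)))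
    refine hmain.trans (le_of_eq ?_)
    simp only [bd, W, zero_mul, Real.exp_zero, mul_one, Real.rpow_one]
    ring
  have hs1 : Summable (transportTerm a v) := by
    have h := trilinear_bound (α := fun k => ‖a k‖) (β := fun k => W (r + 1) τ k)
      (γ := fun k => W r τ k) (fun _ => norm_nonneg _) (hW0 _ _) (hW0 _ _)
      (by simpa using hR0 0 le_rfl) (hR.summable_sq (by linarith)) (hR.summable_sq hr0)
    refine h.1.of_norm_bounded fun x => (norm_transportTerm_le ha.div v x).trans (le_of_eq ?_)
    rw [hnv, hnv]
    congr 2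
    simp only [W]
    rw [Real.rpow_add_one' (freqNorm_nonneg _) (by linarith)]
    ring
  have hs21 : Summable fun x => c2 x - transportTerm a v x := hbds.of_norm_bounded hc12
  have hs2 : Summable c2 := by simpa using hs21.add hs1
  have hconv := conv_l1 ha.div (by simpa using hR0 0 le_rfl)
    (by simpa using hR0 1 zero_le_one)
  have hrow : ∀ k, HasSum (fun j => (c2 (k, j)).re) (freqNorm k ^ (2 * r) *
      Real.exp (2 * τ * freqNorm k ^ p) * (inner ℂ (a k) (conv a a k)).re) := by
    intro k
    have h1 := (innerSL ℂ (a k)).hasSum (hconv.1 k).hasSum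
    have h2 := (h1.mul_left ((m k ^ 2 : ℝ) : ℂ))
    have h3 := Complex.reCLM.hasSum h2
    have em : m k ^ 2 = freqNorm k ^ (2 * r) * Real.exp (2 * τ * freqNorm k ^ p) := by
      have := weight_sq p r τ (fun _ => EuclideanSpace.single 0 1) k
      simpa using this
    convert h3 using 1
    · ext j
      simp only [c2, Complex.reCLM_apply, innerSL_apply_apply, inner_smul_right]
      congr 1
      ring
    · rw [← em, Complex.reCLM_apply, Complex.re_ofReal_mul]
      rfl
  have hs2r : Summable fun x => (c2 x).re := (Complex.reCLM.hasSum hs2.hasSum).summable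
  have heq : production p r τ a = ∑' x, (c2 x - transportTerm a v x).re := by
    have h1 : production p r τ a = ∑' x, (c2 x).re := by
      rw [hs2r.tsum_prod]
      exact tsum_congr fun k => (hrow k).tsum_eq.symm
    have h2 : ∑' x, (transportTerm a v x).re = 0 := by
      rw [← Complex.re_tsum hs1]
      exact re_tsum_transportTerm ha.real ha.div v
    have h3 : Summable fun x => (transportTerm a v x).re :=
      (Complex.reCLM.hasSum hs1.hasSum).summable
    rw [h1, ← sub_zero (∑' x, (c2 x).re), ← h2, ← hs2r.tsum_sub h3]
    rfl
  constructor
  · refine (hs2r.prod).congr fun k => ?_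
    exact (hrow k).tsum_eq
  · rw [heq, ← Real.norm_eq_abs]
    refine (tsum_of_norm_bounded hbds.hasSum fun x => ?_).trans hbdle
    exact (RCLike.norm_re_le_norm (K := ℂ) _).trans (hc12 x)

lemma wiener_le {p r q τ : ℝ} {a : Freq → C3} (ha : a 0 = 0) (hR : Rapid p τ a) (hr : 0 ≤ r)
    (hq : q + 3 / 2 < r) : wiener p q τ a ≤ embConst (r - q) * Real.sqrt (gev p r τ a) := by
  have e : ∀ k, freqNorm k ^ (2 * r) * Real.exp (2 * τ * freqNorm k ^ p) * ‖a k‖ ^ 2 =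
      freqNorm k ^ (2 * r) * (Real.exp (τ * freqNorm k ^ p) * ‖a k‖) ^ 2 := fun k => by
    rw [mul_pow, ← Real.exp_nat_mul, mul_assoc]
    congr 3; push_cast; ring_nf
  have h := summable_l1_of_l2 hq (f := fun k => Real.exp (τ * freqNorm k ^ p) * ‖a k‖)
    (fun k => by positivity) (by simp [ha]) ((hR.summable_gev hr).congr e)
  refine le_trans (le_of_eq ?_) (h.2.trans (le_of_eq ?_))
  · exact tsum_congr fun k => by ring
  · rw [gev, tsum_congr e]

/-- Trading the exponential weight for a factor `τ` and `p` derivatives, by `eˣ ≤ 1 + x eˣ`. -/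
lemma wiener_split {p q τ : ℝ} {a : Freq → C3} (ha : a 0 = 0) (hp : 0 ≤ p) (hτ : 0 ≤ τ)
    (hR : Rapid p τ a) (hq : 0 ≤ q) :
    wiener p q τ a ≤ wiener p q 0 a + τ * wiener p (q + p) τ a := by
  have hR0 := hR.mono hτ
  rw [wiener, wiener, wiener, ← tsum_mul_left, ← (hR0 q hq).tsum_add
    ((hR (q + p) (by linarith)).mul_left τ)]
  refine (hR q hq).tsum_le_tsum (fun k => ?_)
    ((hR0 q hq).add ((hR (q + p) (by linarith)).mul_left τ))
  by_cases hk : k = 0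
  · simp [hk, ha]
  have hk0 : 0 < freqNorm k := by linarith [one_le_freqNorm hk]
  have hexp : ∀ x : ℝ, Real.exp x ≤ 1 + x * Real.exp x := by
    intro x
    have h1 : 1 + -x ≤ Real.exp (-x) := by linarith [Real.add_one_le_exp (-x)]
    have h2 : Real.exp (-x) * Real.exp x = 1 := by rw [← Real.exp_add]; simp
    nlinarith [mul_le_mul_of_nonneg_right h1 (Real.exp_pos x).le]
  have h := hexp (τ * freqNorm k ^ p)
  have h0 : 0 ≤ freqNorm k ^ q * ‖a k‖ :=
    mul_nonneg (Real.rpow_nonneg hk0.le _) (norm_nonneg _)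
  rw [Real.rpow_add hk0]
  calc freqNorm k ^ q * Real.exp (τ * freqNorm k ^ p) * ‖a k‖
      = (freqNorm k ^ q * ‖a k‖) * Real.exp (τ * freqNorm k ^ p) := by ring
    _ ≤ (freqNorm k ^ q * ‖a k‖) *
        (1 + τ * freqNorm k ^ p * Real.exp (τ * freqNorm k ^ p)) :=
        mul_le_mul_of_nonneg_left h h0
    _ = _ := by simp; ring

/-- The nonlinear estimate in `H^r`: only the Wiener norm of the gradient enters linearly. -/
lemma abs_production_zero_le {p r : ℝ} {a : Freq → C3} (hr : 1 ≤ r) (hp0 : 0 < p) (hp1 : p ≤ 1)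
    (ha : Admissible r a) (hR : Rapid p 0 a) :
    |production p r 0 a| ≤ 2 * r * 2 ^ r * wiener p 1 0 a * energy r a := by
  have h := (abs_production_le hr hp0 hp1 le_rfl ha hR).2
  rw [gev_zero, Real.mul_self_sqrt (energy_nonneg r a)] at h
  linarith

/-- The nonlinear estimate in Gevrey spaces. The loss of `p/2` derivatives is accompanied by
a factor `τ`, and only the `H^r` norm or a further factor `τ` multiply it. -/
lemma exists_production_le (p r : ℝ) (hr : 9 / 2 < r) (hp0 : 0 < p) (hp1 : p ≤ 1) :
    ∃ C : ℝ, 0 < C ∧ ∀ (τ : ℝ) (a : Freq → C3), 0 ≤ τ → Admissible r a → Rapid p τ a →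
      |production p r τ a| ≤ C * Real.sqrt (energy r a) * gev p r τ a +
        C * (τ * Real.sqrt (energy r a) + τ ^ 2 * Real.sqrt (gev p r τ a)) *
          gev p (r + p / 2) τ a := by
  set e1 := embConst (r - 1)
  set e2 := embConst (r - (1 + p / 2))
  set e3 := embConst (r - (1 + p / 2 + p))
  have he1 : 0 ≤ e1 := embConst_nonneg _
  have he2 : 0 ≤ e2 := embConst_nonneg _
  have he3 : 0 ≤ e3 := embConst_nonneg _
  have h2r : (0 : ℝ) < 2 ^ r := by positivity
  refine ⟨2 * r * 2 ^ r * e1 + 4 * 2 ^ r * (e2 + e3) + 1, by positivity, ?_⟩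
  intro τ a hτ ha hR
  have hR0 := hR.mono hτ
  have h := (abs_production_le (by linarith) hp0 hp1 hτ ha hR).2
  set X := gev p r τ a
  set Y := gev p (r + p / 2) τ a
  set sH := Real.sqrt (energy r a)
  set sX := Real.sqrt X with hsX
  have hX0 : 0 ≤ X := gev_nonneg _ _ _ _
  have hY0 : 0 ≤ Y := gev_nonneg _ _ _ _
  have hsH0 : 0 ≤ sH := Real.sqrt_nonneg _
  have hsX0 : 0 ≤ sX := Real.sqrt_nonneg _
  have hsX2 : sX * sX = X := Real.mul_self_sqrt hX0
  have w1 : wiener p 1 0 a ≤ e1 * sH := by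
    have := wiener_le (r := r) ha.zero hR0 (by linarith) (q := 1) (by linarith)
    rwa [gev_zero] at this
  have w2 : wiener p 1 τ a ≤ e1 * sX :=
    wiener_le ha.zero hR (by linarith) (by linarith)
  have w3 : wiener p (1 + p / 2) τ a ≤ e2 * sH + τ * (e3 * sX) := by
    refine (wiener_split ha.zero hp0.le hτ hR (by linarith)).trans (add_le_add ?_ ?_)
    · have := wiener_le (r := r) ha.zero hR0 (by linarith) (q := 1 + p / 2) (by linarith)
      rwa [gev_zero] at this
    · exact mul_le_mul_of_nonneg_left
        (wiener_le ha.zero hR (by linarith) (by linarith)) hτ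
  have hr0 : 0 < r := by linarith
  calc |production p r τ a| ≤ _ := h
    _ ≤ r * 2 ^ r * ((e1 * sH) * X + (e1 * sX) * (sH * sX)) +
        2 * 2 ^ r * τ * (2 * ((e2 * sH + τ * (e3 * sX)) * Y)) := by gcongr
    _ = 2 * r * 2 ^ r * e1 * (sH * X) +
        4 * 2 ^ r * (e2 * (τ * sH) + e3 * (τ ^ 2 * sX)) * Y := by
        linear_combination (r * 2 ^ r * e1 * sH) * hsX2
    _ ≤ (2 * r * 2 ^ r * e1 + 4 * 2 ^ r * (e2 + e3) + 1) * sH * X +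
        (2 * r * 2 ^ r * e1 + 4 * 2 ^ r * (e2 + e3) + 1) * (τ * sH + τ ^ 2 * sX) * Y := by
        have i1 : 2 * r * 2 ^ r * e1 ≤ 2 * r * 2 ^ r * e1 + 4 * 2 ^ r * (e2 + e3) + 1 := by
          nlinarith [mul_nonneg h2r.le he2, mul_nonneg h2r.le he3]
        have i2 : 4 * 2 ^ r * e2 ≤ 2 * r * 2 ^ r * e1 + 4 * 2 ^ r * (e2 + e3) + 1 := by
          have : 0 ≤ 2 * r * 2 ^ r * e1 := by positivity
          nlinarith [mul_nonneg h2r.le he3]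
        have i3 : 4 * 2 ^ r * e3 ≤ 2 * r * 2 ^ r * e1 + 4 * 2 ^ r * (e2 + e3) + 1 := by
          have : 0 ≤ 2 * r * 2 ^ r * e1 := by positivity
          nlinarith [mul_nonneg h2r.le he2]
        set C := 2 * r * 2 ^ r * e1 + 4 * 2 ^ r * (e2 + e3) + 1
        have j1 := mul_le_mul_of_nonneg_right i1 (mul_nonneg hsH0 hX0)
        have j2 := mul_le_mul_of_nonneg_right i2 (mul_nonneg (mul_nonneg hτ hsH0) hY0)
        have j3 := mul_le_mul_of_nonneg_right i3 (mul_nonneg (mul_nonneg (sq_nonneg τ) hsX0) hY0)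
        linarith

/-! ### The energy identity -/

lemma summable_rpow_mul_exp_neg {p ρ q : ℝ} (hp : 0 < p) (hρ : 0 < ρ) :
    Summable fun k : Freq => freqNorm k ^ q * Real.exp (-(ρ * freqNorm k ^ p)) := by
  obtain ⟨n, hn⟩ := exists_nat_gt ((q + 4) / p)
  have hn' : q + 4 < n * p := by rwa [div_lt_iff₀ hp] at hn
  refine ((summable_freqNorm_rpow (q := -4) (by norm_num)).mul_left
    ((n.factorial : ℝ) / ρ ^ n)).of_norm_bounded_eventually ?_
  refine (Set.finite_singleton (0 : Freq)).subset fun k hk => ?_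
  by_contra hk0
  refine hk ?_
  have h1 : 1 ≤ freqNorm k := one_le_freqNorm hk0
  have h0 : 0 < freqNorm k := by linarith
  have hy : 0 < ρ * freqNorm k ^ p := mul_pos hρ (Real.rpow_pos_of_pos h0 p)
  have hexp := Real.pow_div_factorial_le_exp _ hy.le n
  have hpow : (ρ * freqNorm k ^ p) ^ n = ρ ^ n * freqNorm k ^ (n * p) := by
    rw [mul_pow, ← Real.rpow_natCast (freqNorm k ^ p), ← Real.rpow_mul h0.le, mul_comm p]
  have hpos : 0 < (ρ * freqNorm k ^ p) ^ n / n.factorial := by positivity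
  change ‖freqNorm k ^ q * Real.exp (-(ρ * freqNorm k ^ p))‖ ≤ _
  rw [Real.norm_of_nonneg (mul_nonneg (Real.rpow_nonneg h0.le _) (Real.exp_pos _).le),
    Real.exp_neg]
  calc freqNorm k ^ q * (Real.exp (ρ * freqNorm k ^ p))⁻¹
      ≤ freqNorm k ^ q * ((ρ * freqNorm k ^ p) ^ n / n.factorial)⁻¹ := by
        gcongr
    _ = n.factorial / ρ ^ n * (freqNorm k ^ q * freqNorm k ^ (-(n * p))) := by
        rw [hpow, Real.rpow_neg h0.le]
        field_simp
    _ ≤ n.factorial / ρ ^ n * freqNorm k ^ (-4 : ℝ) := by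
        rw [← Real.rpow_add h0]
        gcongr
        linarith

lemma real_inner_C3 (x y : C3) : inner ℝ x y = (inner ℂ x y).re := by
  simp [PiLp.inner_apply, Complex.inner]

lemma hasDerivAt_norm_sq_C3 {f : ℝ → C3} {f' : C3} {t : ℝ} (hf : HasDerivAt f f' t) :
    HasDerivAt (fun s => ‖f s‖ ^ 2) (2 * (inner ℂ (f t) f').re) t := by
  rw [← real_inner_C3]
  exact hf.norm_sq

/-- A majorant `B e^{-ρ|k|^p}`, uniform in time, of the coefficients with the weight `e^{σ|k|^p}`. -/
def HasMajorant (p T : ℝ) (σ : ℝ → ℝ) (u : ℝ → Freq → C3) (ρ B : ℝ) : Prop :=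
  ∀ t ∈ Icc 0 T, ∀ k, Real.exp (σ t * freqNorm k ^ p) * ‖u t k‖ ≤
    B * Real.exp (-(ρ * freqNorm k ^ p))

lemma HasMajorant.rapid {p T ρ B : ℝ} {σ : ℝ → ℝ} {u : ℝ → Freq → C3}
    (h : HasMajorant p T σ u ρ B) (hp : 0 < p) (hρ : 0 < ρ) {t : ℝ} (ht : t ∈ Icc 0 T) :
    Rapid p (σ t) (u t) := by
  intro q _
  refine ((summable_rpow_mul_exp_neg (q := q) hp hρ).mul_left B).of_nonneg_of_le
    (weighted_nonneg p q (σ t) (u t)) fun k => ?_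
  have := mul_le_mul_of_nonneg_left (h t ht k) (Real.rpow_nonneg (freqNorm_nonneg k) q)
  calc _ = _ := mul_assoc _ _ _
    _ ≤ _ := this
    _ = _ := by ring

lemma HasMajorant.nonneg {p T ρ B : ℝ} {σ : ℝ → ℝ} {u : ℝ → Freq → C3}
    (h : HasMajorant p T σ u ρ B) {t : ℝ} (ht : t ∈ Icc 0 T) : 0 ≤ B := by
  have h1 := h t ht 0
  have h2 : 0 ≤ B * Real.exp (-(ρ * freqNorm 0 ^ p)) := le_trans (by positivity) h1
  exact nonneg_of_mul_nonneg_left h2 (Real.exp_pos _)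

lemma rpow_two_mul_add {r q : ℝ} (hr : 0 ≤ r) (hq : 0 ≤ q) (k : Freq) :
    freqNorm k ^ (2 * (r + q / 2)) = freqNorm k ^ (2 * r) * freqNorm k ^ q := by
  rw [← Real.rpow_add_of_nonneg (freqNorm_nonneg k) (by linarith) hq]
  congr 1; ring

/-- The majorant controls the weighted convection term, since `|k|^p` is subadditive. -/
lemma HasMajorant.exp_mul_norm_conv_le {p T ρ B : ℝ} {σ : ℝ → ℝ} {u : ℝ → Freq → C3}
    (h : HasMajorant p T σ u ρ B) (hp0 : 0 < p) (hp1 : p ≤ 1) (hρ : 0 < ρ)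
    (hσ : ∀ t ∈ Icc 0 T, 0 ≤ σ t) (hdiv : ∀ t ∈ Icc 0 T, ∀ k, dotc k (u t k) = 0) :
    ∃ D, ∀ t ∈ Icc 0 T, ∀ k, Real.exp (σ t * freqNorm k ^ p) * ‖conv (u t) (u t) k‖ ≤ D := by
  let M : Freq → ℝ := fun k => B * Real.exp (-(ρ * freqNorm k ^ p))
  have hM : Summable M := by
    simpa using (summable_rpow_mul_exp_neg (q := 0) hp0 hρ).mul_left B
  have hM1 : Summable fun k => freqNorm k * M k := by
    refine ((summable_rpow_mul_exp_neg (q := 1) hp0 hρ).mul_left B).congr fun k => ?_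
    rw [Real.rpow_one]; ring
  refine ⟨(∑' k, M k) * ∑' k, freqNorm k * M k, fun t ht k => ?_⟩
  have hB := h.nonneg ht
  have hM0 : ∀ k, 0 ≤ M k := fun k => mul_nonneg hB (Real.exp_pos _).le
  have hM10 : ∀ k, 0 ≤ freqNorm k * M k := fun k => mul_nonneg (freqNorm_nonneg k) (hM0 k)
  have hR := (h.rapid hp0 hρ ht).mono (hσ t ht)
  have hc := conv_l1 (a := u t) (b := u t) (hdiv t ht) (by simpa using hR 0 le_rfl)
    (by simpa using hR 1 zero_le_one)
  have hp' := summable_conv_prod hM0 hM10 hM hM1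
  have hrow : Real.exp (σ t * freqNorm k ^ p) * ‖conv (u t) (u t) k‖ ≤
      ∑' j, M j * (freqNorm (k - j) * M (k - j)) := by
    rw [conv, ← Real.norm_of_nonneg (Real.exp_pos (σ t * freqNorm k ^ p)).le, ← norm_smul,
      ← ((hc.1 k).tsum_const_smul (Real.exp (σ t * freqNorm k ^ p)))]
    refine tsum_of_norm_bounded (hp'.prod_factor k).hasSum fun j => ?_
    rw [norm_smul, Real.norm_of_nonneg (Real.exp_pos _).le]
    have hexp : Real.exp (σ t * freqNorm k ^ p) ≤
        Real.exp (σ t * freqNorm j ^ p) * Real.exp (σ t * freqNorm (k - j) ^ p) := by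
      rw [← Real.exp_add, ← mul_add]
      refine Real.exp_le_exp.2 (mul_le_mul_of_nonneg_left ?_ (hσ t ht))
      refine rpow_le_add_rpow hp0 hp1 (freqNorm_nonneg j) (freqNorm_nonneg _) (freqNorm_nonneg k) ?_
      simpa using freqNorm_add_le j (k - j)
    calc _ ≤ (Real.exp (σ t * freqNorm j ^ p) * Real.exp (σ t * freqNorm (k - j) ^ p)) *
          (‖u t j‖ * (freqNorm (k - j) * ‖u t (k - j)‖)) := by
          gcongr
          exact norm_conv_term_le (hdiv t ht) k j
      _ = (Real.exp (σ t * freqNorm j ^ p) * ‖u t j‖) *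
          (freqNorm (k - j) * (Real.exp (σ t * freqNorm (k - j) ^ p) * ‖u t (k - j)‖)) := by ring
      _ ≤ M j * (freqNorm (k - j) * M (k - j)) := by
          have := freqNorm_nonneg (k - j)
          have := hM0 j
          gcongr
          · exact h t ht j
          · exact h t ht (k - j)
  refine hrow.trans ?_
  rw [← tsum_conv_prod hM0 hM10 hM hM1]
  exact hp'.prod.le_tsum k fun k' _ => tsum_nonneg fun j => mul_nonneg (hM0 j) (hM10 _)

lemma HasMajorant.continuousOn_gev {p r T ρ B : ℝ} {σ : ℝ → ℝ} {u : ℝ → Freq → C3}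
    (h : HasMajorant p T σ u ρ B) (hp0 : 0 < p) (hρ : 0 < ρ)
    (hσc : ContinuousOn σ (Icc 0 T)) (hu : ∀ k, ContinuousOn (fun t => u t k) (Icc 0 T)) :
    ContinuousOn (fun t => gev p r (σ t) (u t)) (Icc 0 T) := by
  refine continuousOn_tsum (u := fun k => B ^ 2 * (freqNorm k ^ (2 * r) *
    Real.exp (-((2 * ρ) * freqNorm k ^ p)))) (fun k => ?_)
    ((summable_rpow_mul_exp_neg hp0 (by linarith)).mul_left _) fun k t ht => ?_
  · refine (continuousOn_const.mul (Real.continuous_exp.comp_continuousOn ?_)).mul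
      ((hu k).norm.pow 2)
    exact (continuousOn_const.mul hσc).mul continuousOn_const
  · rw [Real.norm_of_nonneg (by have := Real.rpow_nonneg (freqNorm_nonneg k) (2 * r); positivity)]
    have h1 := pow_le_pow_left₀ (by positivity) (h t ht k) 2
    have e1 : (Real.exp (σ t * freqNorm k ^ p) * ‖u t k‖) ^ 2 =
        Real.exp (2 * σ t * freqNorm k ^ p) * ‖u t k‖ ^ 2 := by
      rw [mul_pow, ← Real.exp_nat_mul]; congr 2; push_cast; ring
    have e2 : (B * Real.exp (-(ρ * freqNorm k ^ p))) ^ 2 =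
        B ^ 2 * Real.exp (-((2 * ρ) * freqNorm k ^ p)) := by
      rw [mul_pow, ← Real.exp_nat_mul]; congr 2; push_cast; ring
    rw [e1, e2] at h1
    calc _ = freqNorm k ^ (2 * r) * (Real.exp (2 * σ t * freqNorm k ^ p) * ‖u t k‖ ^ 2) := by ring
      _ ≤ freqNorm k ^ (2 * r) * (B ^ 2 * Real.exp (-((2 * ρ) * freqNorm k ^ p))) :=
        mul_le_mul_of_nonneg_left h1 (Real.rpow_nonneg (freqNorm_nonneg k) _)
      _ = _ := by ring

/-- The Gevrey energy identity. The majorant dominates the series of the derivatives, including the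
ones with more derivatives than `r`, so that differentiation under the sum is justified. -/
lemma FourierSolution.hasDerivAt_gev {ν p r T ρ B S : ℝ} {σ σ' : ℝ → ℝ} {u : ℝ → Freq → C3}
    (hu : FourierSolution ν r T u) (hr : 1 ≤ r) (hp0 : 0 < p) (hp1 : p ≤ 1) (hρ : 0 < ρ)
    (h : HasMajorant p T σ u ρ B) (hσ : ∀ t ∈ Icc 0 T, 0 ≤ σ t)
    (hσd : ∀ t ∈ Ioo 0 T, HasDerivAt σ (σ' t) t) (hS : ∀ t ∈ Ioo 0 T, |σ' t| ≤ S)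
    {t : ℝ} (ht : t ∈ Ioo 0 T) :
    HasDerivAt (fun t => gev p r (σ t) (u t))
      (2 * σ' t * gev p (r + p / 2) (σ t) (u t) - 2 * ν * gev p (r + 1) (σ t) (u t) -
        2 * production p r (σ t) (u t)) t := by
  have hsub : Ioo 0 T ⊆ Icc 0 T := Ioo_subset_Icc_self
  have hr0 : 0 ≤ r := by linarith
  obtain ⟨D, hD⟩ := h.exp_mul_norm_conv_le hp0 hp1 hρ hσ fun t ht => (hu.adm t ht).div
  choose! n hn hder using hu.deriv
  have hB := h.nonneg (hsub ht)
  have hS0 : 0 ≤ S := (abs_nonneg _).trans (hS t ht)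
  have hD0 : 0 ≤ D := le_trans (by positivity) (hD t (hsub ht) 0)
  let g' : Freq → ℝ → ℝ := fun k t =>
    2 * σ' t * (freqNorm k ^ (2 * (r + p / 2)) * Real.exp (2 * σ t * freqNorm k ^ p) *
      ‖u t k‖ ^ 2) -
    2 * ν * (freqNorm k ^ (2 * (r + 1)) * Real.exp (2 * σ t * freqNorm k ^ p) * ‖u t k‖ ^ 2) -
    2 * (freqNorm k ^ (2 * r) * Real.exp (2 * σ t * freqNorm k ^ p) *
      (inner ℂ (u t k) (conv (u t) (u t) k)).re)
  have e1 : ∀ k : Freq, freqNorm k ^ (2 * (r + p / 2)) = freqNorm k ^ (2 * r) * freqNorm k ^ p :=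
    rpow_two_mul_add hr0 hp0.le
  have e2 : ∀ k : Freq, freqNorm k ^ (2 * (r + 1)) = freqNorm k ^ (2 * r) * freqNorm k ^ 2 := by
    intro k
    have := rpow_two_mul_add hr0 (q := 2) (by norm_num) k
    rw [Real.rpow_two] at this
    rw [← this]; norm_num
  have hgd : ∀ k, ∀ s ∈ Ioo 0 T, HasDerivAt (fun s => freqNorm k ^ (2 * r) *
      Real.exp (2 * σ s * freqNorm k ^ p) * ‖u s k‖ ^ 2) (g' k s) s := by
    intro k s hs
    have h1 : HasDerivAt (fun s => Real.exp (2 * σ s * freqNorm k ^ p))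
        (Real.exp (2 * σ s * freqNorm k ^ p) * (2 * σ' s * freqNorm k ^ p)) s :=
      (((hσd s hs).const_mul 2).mul_const _).exp
    have h2 := hasDerivAt_norm_sq_C3 (hder s hs k)
    have h3 := (h1.const_mul (freqNorm k ^ (2 * r))).mul h2
    refine h3.congr_deriv ?_
    have hin : (inner ℂ (u s k) (-((ν * freqNorm k ^ 2) • u s k) - n s k)).re =
        -(ν * freqNorm k ^ 2 * ‖u s k‖ ^ 2) -
          (inner ℂ (u s k) (conv (u s) (u s) k)).re := by
      rw [inner_sub_right, (hn s hs k).2 _ ((hu.adm s (hsub hs)).div k), inner_neg_right,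
        Complex.sub_re, Complex.neg_re, ← real_inner_C3, real_inner_smul_right,
        real_inner_self_eq_norm_sq]
    rw [hin]
    simp only [g', e1, e2]
    ring
  have hexp2 : ∀ (s : ℝ) (k : Freq), Real.exp (2 * σ s * freqNorm k ^ p) =
      Real.exp (σ s * freqNorm k ^ p) * Real.exp (σ s * freqNorm k ^ p) := fun s k => by
    rw [← Real.exp_add]; ring_nf
  let bd : Freq → ℝ := fun k =>
    2 * S * B ^ 2 * (freqNorm k ^ (2 * (r + p / 2)) * Real.exp (-(ρ * freqNorm k ^ p))) +
    2 * |ν| * B ^ 2 * (freqNorm k ^ (2 * (r + 1)) * Real.exp (-(ρ * freqNorm k ^ p))) +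
    2 * B * D * (freqNorm k ^ (2 * r) * Real.exp (-(ρ * freqNorm k ^ p)))
  have hbd : Summable bd :=
    (((summable_rpow_mul_exp_neg hp0 hρ).mul_left _).add
      ((summable_rpow_mul_exp_neg hp0 hρ).mul_left _)).add
      ((summable_rpow_mul_exp_neg hp0 hρ).mul_left _)
  have hg'bd : ∀ k, ∀ s ∈ Ioo 0 T, ‖g' k s‖ ≤ bd k := by
    intro k s hs
    have hm := h s (hsub hs) k
    set E := Real.exp (σ s * freqNorm k ^ p)
    set R := Real.exp (-(ρ * freqNorm k ^ p))
    have hE0 : 0 < E := Real.exp_pos _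
    have hR0 : 0 < R := Real.exp_pos _
    have hR1 : R ≤ 1 := Real.exp_le_one_iff.2
      (neg_nonpos.2 (mul_nonneg hρ.le (Real.rpow_nonneg (freqNorm_nonneg k) p)))
    have hEu0 : 0 ≤ E * ‖u s k‖ := by positivity
    have hsq : E * E * ‖u s k‖ ^ 2 ≤ B ^ 2 * R := by
      calc E * E * ‖u s k‖ ^ 2 = (E * ‖u s k‖) * (E * ‖u s k‖) := by ring
        _ ≤ (B * R) * (B * R) := mul_le_mul hm hm hEu0 (hEu0.trans hm)
        _ = B ^ 2 * R * R := by ring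
        _ ≤ B ^ 2 * R * 1 := by gcongr
        _ = _ := mul_one _
    have hpr : |E * E * (inner ℂ (u s k) (conv (u s) (u s) k)).re| ≤ B * D * R := by
      rw [abs_mul, abs_of_pos (mul_pos hE0 hE0)]
      calc E * E * |(inner ℂ (u s k) (conv (u s) (u s) k)).re|
          ≤ E * E * (‖u s k‖ * ‖conv (u s) (u s) k‖) := by
            gcongr
            exact (Complex.abs_re_le_norm _).trans (norm_inner_le_norm _ _)
        _ = (E * ‖u s k‖) * (E * ‖conv (u s) (u s) k‖) := by ring
        _ ≤ (B * R) * D := mul_le_mul hm (hD s (hsub hs) k) (by positivity) (by positivity)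
        _ = _ := by ring
    have q1 : 0 ≤ freqNorm k ^ (2 * (r + p / 2)) := Real.rpow_nonneg (freqNorm_nonneg k) _
    have q2 : 0 ≤ freqNorm k ^ (2 * (r + 1)) := Real.rpow_nonneg (freqNorm_nonneg k) _
    have q3 : 0 ≤ freqNorm k ^ (2 * r) := Real.rpow_nonneg (freqNorm_nonneg k) _
    simp only [g', bd, hexp2]
    rw [Real.norm_eq_abs]
    refine (abs_sub _ _).trans (add_le_add ((abs_sub _ _).trans (add_le_add ?_ ?_)) ?_)
    · rw [abs_mul, abs_mul, abs_of_pos (two_pos : (0 : ℝ) < 2), abs_of_nonneg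
        (show 0 ≤ freqNorm k ^ (2 * (r + p / 2)) * (E * E) * ‖u s k‖ ^ 2 by positivity)]
      calc _ = 2 * |σ' s| * (freqNorm k ^ (2 * (r + p / 2)) * (E * E * ‖u s k‖ ^ 2)) := by ring
        _ ≤ 2 * S * (freqNorm k ^ (2 * (r + p / 2)) * (B ^ 2 * R)) := by
          have := hS s hs
          gcongr
        _ = _ := by ring
    · rw [abs_mul, abs_mul, abs_of_pos (two_pos : (0 : ℝ) < 2), abs_of_nonneg
        (show 0 ≤ freqNorm k ^ (2 * (r + 1)) * (E * E) * ‖u s k‖ ^ 2 by positivity)]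
      calc _ = 2 * |ν| * (freqNorm k ^ (2 * (r + 1)) * (E * E * ‖u s k‖ ^ 2)) := by ring
        _ ≤ 2 * |ν| * (freqNorm k ^ (2 * (r + 1)) * (B ^ 2 * R)) := by gcongr
        _ = _ := by ring
    · rw [abs_mul, abs_of_pos (two_pos : (0 : ℝ) < 2), mul_assoc (freqNorm k ^ (2 * r)), abs_mul,
        abs_of_nonneg q3]
      calc _ ≤ 2 * (freqNorm k ^ (2 * r) * (B * D * R)) := by gcongr
        _ = _ := by ring
  have hR := h.rapid hp0 hρ (hsub ht)
  have hmain := hasDerivAt_tsum_of_isPreconnected hbd isOpen_Ioo isPreconnected_Ioo hgd hg'bd ht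
    (hR.summable_gev hr0) ht
  refine hmain.congr_deriv ?_
  have s1 := (hR.summable_gev (q := r + p / 2) (by linarith)).mul_left (2 * σ' t)
  have s2 := (hR.summable_gev (q := r + 1) (by linarith)).mul_left (2 * ν)
  have s3 := (abs_production_le hr hp0 hp1 (hσ t (hsub ht)) (hu.adm t (hsub ht)) hR).1.mul_left 2
  rw [(s1.sub s2).tsum_sub s3, s1.tsum_sub s2, tsum_mul_left, tsum_mul_left, tsum_mul_left]
  rfl

/-! ### Stability in `L²` -/

lemma Admissible.summable_norm {r : ℝ} {a : Freq → C3} (ha : Admissible r a) (hr : 3 / 2 < r) :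
    Summable fun k => ‖a k‖ := by
  simpa using (ha.l1 (q := 0) (by linarith)).1

lemma Admissible.summable_freqNorm_mul {r : ℝ} {a : Freq → C3} (ha : Admissible r a)
    (hr : 5 / 2 < r) : Summable fun k => freqNorm k * ‖a k‖ := by
  simpa using (ha.l1 (q := 1) (by linarith)).1

/-- The pairing `⟨c, (a · ∇) b⟩` as a sum over pairs of frequencies. -/
lemma hasSum_re_inner_conv {a b : Freq → C3} (c : Freq → C3) (hdiv : ∀ k, dotc k (a k) = 0)
    (ha : Summable fun k => ‖a k‖) (hb : Summable fun k => freqNorm k * ‖b k‖) (k : Freq) :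
    HasSum (fun j => ((Complex.I * dotc k (a j)) * inner ℂ (c k) (b (k - j))).re)
      (inner ℂ (c k) (conv a b k)).re := by
  have h1 := (innerSL ℂ (c k)).hasSum ((conv_l1 hdiv ha hb).1 k).hasSum
  have h2 := Complex.reCLM.hasSum h1
  convert h2 using 1
  · ext j
    simp only [Complex.reCLM_apply, innerSL_apply_apply, inner_smul_right]
  · rfl

lemma tsum_re_inner_conv_self {a v : Freq → C3} (hreal : ∀ k i, a (-k) i = star (a k i))
    (hdiv : ∀ k, dotc k (a k) = 0) (ha : Summable fun k => ‖a k‖)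
    (hv : Summable fun k => ‖v k‖) (hv1 : Summable fun k => freqNorm k * ‖v k‖) :
    (Summable fun k => (inner ℂ (v k) (conv a v k)).re) ∧
      ∑' k, (inner ℂ (v k) (conv a v k)).re = 0 := by
  have h0 : ∀ k : Freq, 0 ≤ freqNorm k * ‖v k‖ := fun k =>
    mul_nonneg (freqNorm_nonneg k) (norm_nonneg _)
  have hs : Summable (transportTerm a v) :=
    (trilinear_bound (fun k => norm_nonneg (a k)) h0 (fun k => norm_nonneg (v k)) ha
      (summable_sq_of_summable h0 hv1)
      (summable_sq_of_summable (fun k => norm_nonneg (v k)) hv)).1.of_norm_bounded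
      (norm_transportTerm_le hdiv v)
  have hsr : Summable fun x => (transportTerm a v x).re :=
    (Complex.reCLM.hasSum hs.hasSum).summable
  have hrow := hasSum_re_inner_conv v hdiv ha hv1
  constructor
  · exact hsr.prod.congr fun k => (hrow k).tsum_eq
  · rw [← re_tsum_transportTerm hreal hdiv v, Complex.re_tsum hs, hsr.tsum_prod]
    exact tsum_congr fun k => (hrow k).tsum_eq.symm

lemma abs_tsum_re_inner_conv_le {w b : Freq → C3} (hdiv : ∀ k, dotc k (w k) = 0)
    (hw : Summable fun k => ‖w k‖) (hb : Summable fun k => freqNorm k * ‖b k‖) :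
    (Summable fun k => (inner ℂ (w k) (conv w b k)).re) ∧
      |∑' k, (inner ℂ (w k) (conv w b k)).re| ≤
        (∑' k, freqNorm k * ‖b k‖) * ∑' k, ‖w k‖ ^ 2 := by
  have h0 : ∀ k : Freq, 0 ≤ freqNorm k * ‖b k‖ := fun k =>
    mul_nonneg (freqNorm_nonneg k) (norm_nonneg _)
  have hw2 := summable_sq_of_summable (fun k => norm_nonneg (w k)) hw
  have T := trilinear_bound_swap h0 (fun k => norm_nonneg (w k)) (fun k => norm_nonneg (w k))
    hb hw2 hw2
  rw [Real.mul_self_sqrt (tsum_nonneg fun k => sq_nonneg _)] at T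
  have hle : ∀ k, ‖(inner ℂ (w k) (conv w b k)).re‖ ≤
      ∑' j, (freqNorm (k - j) * ‖b (k - j)‖) * ‖w j‖ * ‖w k‖ := by
    intro k
    calc ‖(inner ℂ (w k) (conv w b k)).re‖ ≤ ‖w k‖ * ‖conv w b k‖ :=
          (Complex.abs_re_le_norm _).trans (norm_inner_le_norm _ _)
      _ ≤ ‖w k‖ * ∑' j, ‖w j‖ * (freqNorm (k - j) * ‖b (k - j)‖) :=
          mul_le_mul_of_nonneg_left ((conv_l1 hdiv hw hb).2.1 k) (norm_nonneg _)
      _ = _ := by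
          rw [← tsum_mul_left]
          exact tsum_congr fun j => by ring
  refine ⟨T.1.prod.of_norm_bounded hle, ?_⟩
  refine le_trans ?_ T.2
  rw [T.1.tsum_prod]
  exact tsum_of_norm_bounded T.1.prod.hasSum hle

lemma conv_self_sub {a b : Freq → C3} (hda : ∀ k, dotc k (a k) = 0)
    (hdb : ∀ k, dotc k (b k) = 0) (ha : Summable fun k => ‖a k‖) (hb : Summable fun k => ‖b k‖)
    (ha1 : Summable fun k => freqNorm k * ‖a k‖) (hb1 : Summable fun k => freqNorm k * ‖b k‖)
    (k : Freq) :
    conv a a k - conv b b k =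
      conv a (fun k => a k - b k) k + conv (fun k => a k - b k) b k := by
  have h1 := (conv_l1 hda ha ha1).1 k
  have h2 := (conv_l1 hda ha hb1).1 k
  have h3 := (conv_l1 hdb hb hb1).1 k
  simp only [conv, dotc_sub, mul_sub, smul_sub, sub_smul]
  rw [h1.tsum_sub h2, h2.tsum_sub h3]
  abel

lemma Admissible.norm_le {r : ℝ} {a : Freq → C3} (ha : Admissible r a) (k : Freq) :
    ‖a k‖ ≤ Real.sqrt (energy r a) * freqNorm k ^ (-r) := by
  by_cases hk : k = 0
  · rw [hk, ha.zero, norm_zero]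
    exact mul_nonneg (Real.sqrt_nonneg _) (Real.rpow_nonneg (freqNorm_nonneg _) _)
  have h0 : 0 < freqNorm k := by linarith [one_le_freqNorm hk]
  have h1 : freqNorm k ^ (2 * r) * ‖a k‖ ^ 2 ≤ energy r a :=
    ha.summable.le_tsum k fun j _ =>
      mul_nonneg (Real.rpow_nonneg (freqNorm_nonneg j) _) (sq_nonneg _)
  have h2 : freqNorm k ^ r * ‖a k‖ ≤ Real.sqrt (energy r a) := by
    apply Real.le_sqrt_of_sq_le
    rw [mul_pow, ← Real.rpow_natCast (freqNorm k ^ r), ← Real.rpow_mul h0.le]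
    convert h1 using 3
    push_cast; ring
  rw [Real.rpow_neg h0.le, ← div_eq_mul_inv, le_div_iff₀ (Real.rpow_pos_of_pos h0 r)]
  linarith

/-- `L²` stability with respect to the viscosity. Only the reference solution `U` enters the
growth rate, so no a priori bound on `u` is needed. -/
lemma FourierSolution.sq_norm_sub_le {r T K ν μ : ℝ} {u U : ℝ → Freq → C3} (hr : 9 / 2 < r)
    (hν : 0 ≤ ν) (hu : FourierSolution ν r T u) (hU : FourierSolution μ r T U)
    (hK : ∀ t ∈ Icc 0 T, energy r (U t) ≤ K) (h0 : ∀ k, u 0 k = U 0 k)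
    {t : ℝ} (ht : t ∈ Icc 0 T) (k : Freq) :
    ‖u t k - U t k‖ ^ 2 ≤
      (ν - μ) ^ 2 * (K * T * Real.exp ((1 + 2 * (embConst (r - 1) * Real.sqrt K)) * T)) := by
  have hsub : Ioo 0 T ⊆ Icc 0 T := Ioo_subset_Icc_self
  have hT : 0 ≤ T := ht.1.trans ht.2
  obtain ⟨Ku, hKu⟩ := hu.bound
  have hK0 : 0 ≤ K := (energy_nonneg _ _).trans (hK t ht)
  have hKu0 : 0 ≤ Ku := (energy_nonneg _ _).trans (hKu t ht)
  choose! n hn hder using hu.deriv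
  choose! N hN hDer using hU.deriv
  set s1 := Real.sqrt Ku
  set s2 := Real.sqrt K
  have hs10 : 0 ≤ s1 := Real.sqrt_nonneg _
  have hs20 : 0 ≤ s2 := Real.sqrt_nonneg _
  have hub : ∀ t ∈ Icc 0 T, ∀ k, ‖u t k‖ ≤ s1 * freqNorm k ^ (-r) := fun t ht k =>
    ((hu.adm t ht).norm_le k).trans (mul_le_mul_of_nonneg_right
      (Real.sqrt_le_sqrt (hKu t ht)) (Real.rpow_nonneg (freqNorm_nonneg _) _))
  have hUb : ∀ t ∈ Icc 0 T, ∀ k, ‖U t k‖ ≤ s2 * freqNorm k ^ (-r) := fun t ht k =>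
    ((hU.adm t ht).norm_le k).trans (mul_le_mul_of_nonneg_right
      (Real.sqrt_le_sqrt (hK t ht)) (Real.rpow_nonneg (freqNorm_nonneg _) _))
  have hu1 := fun t ht => (hu.adm t ht).summable_norm (by linarith)
  have hu2 := fun t ht => (hu.adm t ht).summable_freqNorm_mul (by linarith)
  have hU1 := fun t ht => (hU.adm t ht).summable_norm (by linarith)
  have hU2 := fun t ht => (hU.adm t ht).summable_freqNorm_mul (by linarith)
  have hconvb : ∀ (s : ℝ) (b : Freq → C3), Admissible r b → Real.sqrt (energy r b) ≤ s → 0 ≤ s →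
      ∀ k, ‖conv b b k‖ ≤ (embConst (r - 0) * s) * (embConst (r - 1) * s) := by
    intro s b hb hs hs0 k
    have hb1 := hb.summable_norm (by linarith)
    have hb2 := hb.summable_freqNorm_mul (by linarith)
    have hc := conv_l1 hb.div hb1 hb2
    have i1 := (hb.l1 (q := 0) (by linarith)).2
    have i2 := (hb.l1 (q := 1) (by linarith)).2
    simp only [Real.rpow_zero, one_mul, Real.rpow_one] at i1 i2
    refine (hc.2.2.1.le_tsum k fun _ _ => norm_nonneg _).trans (hc.2.2.2.trans ?_)
    refine mul_le_mul (i1.trans (mul_le_mul_of_nonneg_left hs (embConst_nonneg _)))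
      (i2.trans (mul_le_mul_of_nonneg_left hs (embConst_nonneg _)))
      (tsum_nonneg fun k => mul_nonneg (freqNorm_nonneg k) (norm_nonneg _))
      (mul_nonneg (embConst_nonneg _) hs0)
  let w : ℝ → Freq → C3 := fun t k => u t k - U t k
  let X : ℝ → ℝ := fun t => ∑' k, ‖w t k‖ ^ 2
  let w' : ℝ → Freq → C3 := fun t k =>
    (-((ν * freqNorm k ^ 2) • u t k) - n t k) - (-((μ * freqNorm k ^ 2) • U t k) - N t k)
  have hwb : ∀ t ∈ Icc 0 T, ∀ k, ‖w t k‖ ≤ (s1 + s2) * freqNorm k ^ (-r) := by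
    intro t ht k
    rw [add_mul]
    exact (norm_sub_le _ _).trans (add_le_add (hub t ht k) (hUb t ht k))
  have hwd : ∀ t ∈ Icc 0 T, ∀ k, dotc k (w t k) = 0 := fun t ht k => by
    simp only [w, dotc_sub, (hu.adm t ht).div, (hU.adm t ht).div, sub_zero]
  have hw1 : ∀ t ∈ Icc 0 T, Summable fun k => ‖w t k‖ := fun t ht =>
    ((hu1 t ht).add (hU1 t ht)).of_nonneg_of_le (fun _ => norm_nonneg _) fun k => norm_sub_le _ _
  have hw2 : ∀ t ∈ Icc 0 T, Summable fun k => freqNorm k * ‖w t k‖ := fun t ht => by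
    refine ((hu2 t ht).add (hU2 t ht)).of_nonneg_of_le
      (fun k => mul_nonneg (freqNorm_nonneg k) (norm_nonneg _)) fun k => ?_
    rw [← mul_add]
    exact mul_le_mul_of_nonneg_left (norm_sub_le _ _) (freqNorm_nonneg k)
  have hwsq : ∀ t ∈ Icc 0 T, Summable fun k => ‖w t k‖ ^ 2 := fun t ht =>
    summable_sq_of_summable (fun _ => norm_nonneg _) (hw1 t ht)
  have hXc : ContinuousOn X (Icc 0 T) := by
    refine continuousOn_tsum (u := fun k => (s1 + s2) ^ 2 * freqNorm k ^ (-(2 * r)))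
      (fun k => (((hu.cont k).sub (hU.cont k)).norm.pow 2))
      ((summable_freqNorm_rpow (by linarith)).mul_left _) fun k t ht => ?_
    rw [Real.norm_of_nonneg (sq_nonneg _)]
    refine (pow_le_pow_left₀ (norm_nonneg _) (hwb t ht k) 2).trans (le_of_eq ?_)
    rw [mul_pow, ← Real.rpow_natCast (freqNorm k ^ (-r)), ← Real.rpow_mul (freqNorm_nonneg k)]
    congr 2; push_cast; ring
  set D := (embConst (r - 0) * s1) * (embConst (r - 1) * s1) +
    (embConst (r - 0) * s2) * (embConst (r - 1) * s2)
  have hXd : ∀ t ∈ Ioo 0 T, HasDerivAt X (∑' k, 2 * (inner ℂ (w t k) (w' t k)).re) t ∧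
      Summable fun k => 2 * (inner ℂ (w t k) (w' t k)).re := by
    intro t ht
    let bd : Freq → ℝ := fun k =>
      2 * ((s1 + s2) * (|ν| * s1 + |μ| * s2)) * freqNorm k ^ (-r + 2 + -r) +
        2 * ((s1 + s2) * D) * freqNorm k ^ (-r)
    have hbd : Summable bd := ((summable_freqNorm_rpow (by linarith)).mul_left _).add
      ((summable_freqNorm_rpow (by linarith)).mul_left _)
    have hle : ∀ k, ∀ t ∈ Ioo 0 T, ‖2 * (inner ℂ (w t k) (w' t k)).re‖ ≤ bd k := by
      intro k t ht
      have ht' := hsub ht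
      have hq0 : 0 ≤ freqNorm k ^ (-r) := Real.rpow_nonneg (freqNorm_nonneg k) _
      have hsq0 : 0 ≤ freqNorm k ^ 2 := sq_nonneg _
      have hnb : ‖n t k‖ + ‖N t k‖ ≤ D := add_le_add
        ((hn t ht k).norm_le.trans (hconvb s1 _ (hu.adm t ht')
          (Real.sqrt_le_sqrt (hKu t ht')) hs10 k))
        ((hN t ht k).norm_le.trans (hconvb s2 _ (hU.adm t ht')
          (Real.sqrt_le_sqrt (hK t ht')) hs20 k))
      have hw' : ‖w' t k‖ ≤ (|ν| * s1 + |μ| * s2) * (freqNorm k ^ 2 * freqNorm k ^ (-r)) + D := by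
        have i1 : ‖(ν * freqNorm k ^ 2) • u t k‖ ≤
            |ν| * freqNorm k ^ 2 * (s1 * freqNorm k ^ (-r)) := by
          rw [norm_smul, Real.norm_eq_abs, abs_mul, abs_of_nonneg hsq0]
          exact mul_le_mul_of_nonneg_left (hub t ht' k) (by positivity)
        have i2 : ‖(μ * freqNorm k ^ 2) • U t k‖ ≤
            |μ| * freqNorm k ^ 2 * (s2 * freqNorm k ^ (-r)) := by
          rw [norm_smul, Real.norm_eq_abs, abs_mul, abs_of_nonneg hsq0]
          exact mul_le_mul_of_nonneg_left (hUb t ht' k) (by positivity)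
        have i3 : ‖w' t k‖ ≤ (‖(ν * freqNorm k ^ 2) • u t k‖ + ‖n t k‖) +
            (‖(μ * freqNorm k ^ 2) • U t k‖ + ‖N t k‖) := by
          refine (norm_sub_le _ _).trans (add_le_add ?_ ?_)
          · exact (norm_sub_le _ _).trans (by rw [norm_neg])
          · exact (norm_sub_le _ _).trans (by rw [norm_neg])
        linarith
      have hin : ‖(inner ℂ (w t k) (w' t k)).re‖ ≤ ‖w t k‖ * ‖w' t k‖ :=
        (Complex.abs_re_le_norm _).trans (norm_inner_le_norm _ _)
      rw [norm_mul, Real.norm_of_nonneg (two_pos : (0 : ℝ) < 2).le]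
      have hprod : ‖w t k‖ * ‖w' t k‖ ≤ ((s1 + s2) * freqNorm k ^ (-r)) *
          ((|ν| * s1 + |μ| * s2) * (freqNorm k ^ 2 * freqNorm k ^ (-r)) + D) :=
        mul_le_mul (hwb t ht' k) hw' (norm_nonneg _) (by positivity)
      have hpw : freqNorm k ^ (-r) * freqNorm k ^ 2 * freqNorm k ^ (-r) ≤
          freqNorm k ^ (-r + 2 + -r) := by
        by_cases hk : k = 0
        · rw [hk, freqNorm_zero, Real.zero_rpow (by linarith)]
          simp [Real.rpow_nonneg]
        · have hk0 : 0 < freqNorm k := by linarith [one_le_freqNorm hk]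
          rw [← Real.rpow_two, ← Real.rpow_add hk0, ← Real.rpow_add hk0]
      have hc : 0 ≤ (s1 + s2) * (|ν| * s1 + |μ| * s2) := by positivity
      have := mul_le_mul_of_nonneg_left hpw hc
      simp only [bd]
      linarith
    exact ⟨hasDerivAt_tsum_of_isPreconnected hbd isOpen_Ioo isPreconnected_Ioo
      (fun k s hs => hasDerivAt_norm_sq_C3 ((hder s hs k).sub (hDer s hs k))) hle ht
      (hwsq t (hsub ht)) ht, hbd.of_norm_bounded fun k => hle k t ht⟩
  have hwU : embConst (r - 1) * s2 = embConst (r - 1) * Real.sqrt K := rfl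
  set L := embConst (r - 1) * s2
  have hL0 : 0 ≤ L := mul_nonneg (embConst_nonneg _) hs20
  -- Only `conv w U` contributes to the growth: transport of `w` by `u` is skew-adjoint.
  have hineq : ∀ t ∈ Ioo 0 T, ∑' k, 2 * (inner ℂ (w t k) (w' t k)).re ≤
      (1 + 2 * L) * X t + (ν - μ) ^ 2 * K := by
    intro t ht
    have ht' := hsub ht
    have c1 := tsum_re_inner_conv_self (hu.adm t ht').real (hu.adm t ht').div (hu1 t ht')
      (hw1 t ht') (hw2 t ht')
    have c2 := abs_tsum_re_inner_conv_le (hwd t ht') (hw1 t ht') (hU2 t ht')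
    have hE : Summable fun k => (ν - μ) ^ 2 * (freqNorm k ^ (2 * r) * ‖U t k‖ ^ 2) :=
      (hU.adm t ht').summable.mul_left _
    have hterm : ∀ k, 2 * (inner ℂ (w t k) (w' t k)).re ≤
        ‖w t k‖ ^ 2 + (ν - μ) ^ 2 * (freqNorm k ^ (2 * r) * ‖U t k‖ ^ 2) +
          (-2 * (inner ℂ (w t k) (conv (u t) (w t) k)).re +
            -2 * (inner ℂ (w t k) (conv (w t) (U t) k)).re) := by
      intro k
      have ew' : w' t k = -((ν * freqNorm k ^ 2) • w t k) -
          (((ν - μ) * freqNorm k ^ 2) • U t k) - (n t k - N t k) := by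
        simp only [w', w, smul_sub, sub_mul, sub_smul]
        abel
      have ein : (inner ℂ (w t k) (n t k - N t k)).re =
          (inner ℂ (w t k) (conv (u t) (w t) k)).re +
            (inner ℂ (w t k) (conv (w t) (U t) k)).re := by
        rw [inner_sub_right, (hn t ht k).2 _ (hwd t ht' k), (hN t ht k).2 _ (hwd t ht' k),
          ← inner_sub_right, conv_self_sub (hu.adm t ht').div (hU.adm t ht').div (hu1 t ht')
            (hU1 t ht') (hu2 t ht') (hU2 t ht'), inner_add_right, Complex.add_re]
      have e1 : (inner ℂ (w t k) (w' t k)).re = -(ν * freqNorm k ^ 2 * ‖w t k‖ ^ 2) -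
          (ν - μ) * freqNorm k ^ 2 * (inner ℂ (w t k) (U t k)).re -
          ((inner ℂ (w t k) (conv (u t) (w t) k)).re +
            (inner ℂ (w t k) (conv (w t) (U t) k)).re) := by
        rw [ew', inner_sub_right, inner_sub_right, Complex.sub_re, Complex.sub_re, ein,
          inner_neg_right, Complex.neg_re, ← real_inner_C3 _ ((ν * freqNorm k ^ 2) • w t k),
          ← real_inner_C3 _ (((ν - μ) * freqNorm k ^ 2) • U t k), real_inner_smul_right,
          real_inner_smul_right, real_inner_self_eq_norm_sq, real_inner_C3]
      -- The difference of the viscous terms costs two derivatives of `U`, which `H^r` controls.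
      have e2 : -2 * ((ν - μ) * freqNorm k ^ 2 * (inner ℂ (w t k) (U t k)).re) ≤
          ‖w t k‖ ^ 2 + (ν - μ) ^ 2 * (freqNorm k ^ (2 * r) * ‖U t k‖ ^ 2) := by
        have i1 : |(inner ℂ (w t k) (U t k)).re| ≤ ‖w t k‖ * ‖U t k‖ :=
          (Complex.abs_re_le_norm _).trans (norm_inner_le_norm _ _)
        have i2 : -2 * ((ν - μ) * freqNorm k ^ 2 * (inner ℂ (w t k) (U t k)).re) ≤
            2 * (|ν - μ| * freqNorm k ^ 2 * (‖w t k‖ * ‖U t k‖)) := by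
          calc _ ≤ |-2 * ((ν - μ) * freqNorm k ^ 2 * (inner ℂ (w t k) (U t k)).re)| := le_abs_self _
            _ = 2 * (|ν - μ| * freqNorm k ^ 2 * |(inner ℂ (w t k) (U t k)).re|) := by
              rw [abs_mul, abs_mul, abs_mul, abs_of_nonneg (sq_nonneg (freqNorm k))]
              norm_num
            _ ≤ _ := by gcongr
        have i3 : freqNorm k ^ 2 * freqNorm k ^ 2 * ‖U t k‖ ^ 2 ≤
            freqNorm k ^ (2 * r) * ‖U t k‖ ^ 2 := by
          by_cases hk : k = 0
          · simp [hk, (hU.adm t ht').zero]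
          · have h1 := one_le_freqNorm hk
            refine mul_le_mul_of_nonneg_right ?_ (sq_nonneg _)
            rw [← Real.rpow_two, ← Real.rpow_add (by linarith)]
            exact Real.rpow_le_rpow_of_exponent_le h1 (by linarith)
        have i4 := mul_le_mul_of_nonneg_left i3 (sq_nonneg (ν - μ))
        have i5 := sq_nonneg (‖w t k‖ - |ν - μ| * freqNorm k ^ 2 * ‖U t k‖)
        have i6 : |ν - μ| ^ 2 = (ν - μ) ^ 2 := sq_abs _
        have i7 : (|ν - μ| * freqNorm k ^ 2 * ‖U t k‖) ^ 2 =
            (ν - μ) ^ 2 * (freqNorm k ^ 2 * freqNorm k ^ 2 * ‖U t k‖ ^ 2) := by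
          rw [mul_pow, mul_pow, i6]; ring
        nlinarith
      have e3 : 0 ≤ ν * freqNorm k ^ 2 * ‖w t k‖ ^ 2 := by positivity
      rw [e1]
      linarith
    have s3 := (c1.1.mul_left (-2)).add (c2.1.mul_left (-2))
    refine ((hXd t ht).2.tsum_le_tsum hterm (((hwsq t ht').add hE).add s3)).trans ?_
    rw [((hwsq t ht').add hE).tsum_add s3, (hwsq t ht').tsum_add hE,
      (c1.1.mul_left (-2)).tsum_add (c2.1.mul_left (-2)), tsum_mul_left, tsum_mul_left,
      tsum_mul_left, c1.2]
    have hE2 : ∑' k, freqNorm k ^ (2 * r) * ‖U t k‖ ^ 2 ≤ K := hK t ht'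
    have hL : ∑' k, freqNorm k * ‖U t k‖ ≤ L := by
      have := ((hU.adm t ht').l1 (q := 1) (by linarith)).2
      simp only [Real.rpow_one] at this
      exact this.trans (mul_le_mul_of_nonneg_left (Real.sqrt_le_sqrt (hK t ht'))
        (embConst_nonneg _))
    have hX0 : 0 ≤ X t := tsum_nonneg fun k => sq_nonneg _
    have h4 := (neg_le_abs _).trans (c2.2.trans (mul_le_mul_of_nonneg_right hL hX0))
    have h5 := mul_le_mul_of_nonneg_left hE2 (sq_nonneg (ν - μ))
    change X t + _ + _ ≤ _
    linarith
  set A := 1 + 2 * L with hA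
  have hA0 : 0 ≤ A := by linarith
  set F := (ν - μ) ^ 2 * K with hF
  have hF0 : 0 ≤ F := by positivity
  have hanti : AntitoneOn (fun t => Real.exp (-(A * t)) * X t - F * t) (Icc 0 T) := by
    have hd : ∀ t ∈ Ioo 0 T, HasDerivAt (fun t => Real.exp (-(A * t)) * X t - F * t)
        (Real.exp (-(A * t)) * -A * X t +
          Real.exp (-(A * t)) * (∑' k, 2 * (inner ℂ (w t k) (w' t k)).re) - F) t := by
      intro t ht
      have h1 : HasDerivAt (fun t => Real.exp (-(A * t))) (Real.exp (-(A * t)) * -A) t := by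
        have := (((hasDerivAt_id t).const_mul A).neg).exp
        simpa using this
      have h2 : HasDerivAt (fun t => F * t) F t := by
        simpa using (hasDerivAt_id t).const_mul F
      exact (h1.mul (hXd t ht).1).sub h2
    refine antitoneOn_of_deriv_nonpos (convex_Icc 0 T) ?_ ?_ ?_
    · exact ((by fun_prop : Continuous fun t => Real.exp (-(A * t))).continuousOn.mul hXc).sub
        (by fun_prop)
    · rw [interior_Icc]
      exact fun t ht => (hd t ht).differentiableAt.differentiableWithinAt
    · rw [interior_Icc]
      intro t ht
      rw [(hd t ht).deriv]
      have h1 := hineq t ht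
      have h2 : Real.exp (-(A * t)) ≤ 1 :=
        Real.exp_le_one_iff.2 (neg_nonpos.2 (mul_nonneg hA0 ht.1.le))
      have h3 := Real.exp_pos (-(A * t))
      have h4 := mul_le_mul_of_nonneg_left h1 h3.le
      have h5 := mul_le_mul_of_nonneg_right h2 hF0
      linarith
  have hX0 : X 0 = 0 := by
    simp only [X, w, h0, sub_self, norm_zero]
    simp
  have hfin := hanti (left_mem_Icc.2 hT) ht ht.1
  simp only [hX0, mul_zero, sub_zero] at hfin
  have hXt : X t ≤ F * T * Real.exp (A * T) := by
    have h1 : Real.exp (-(A * t)) * X t ≤ F * T :=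
      (sub_nonpos.1 hfin).trans (mul_le_mul_of_nonneg_left ht.2 hF0)
    have h2 : X t = Real.exp (A * t) * (Real.exp (-(A * t)) * X t) := by
      rw [← mul_assoc, ← Real.exp_add]; simp
    rw [h2, mul_comm]
    exact mul_le_mul h1 (Real.exp_le_exp.2 (mul_le_mul_of_nonneg_left ht.2 hA0))
      (Real.exp_pos _).le (mul_nonneg hF0 hT)
  calc ‖u t k - U t k‖ ^ 2 ≤ X t := (hwsq t ht).le_tsum k fun _ _ => sq_nonneg _
    _ ≤ F * T * Real.exp (A * T) := hXt
    _ = _ := by rw [hF]; ring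

/-! ### A bound in `H^r` that is uniform in the viscosity -/

lemma le_mul_exp_of_deriv_le {X X' : ℝ → ℝ} {T l : ℝ} (hT : 0 ≤ T)
    (hc : ContinuousOn X (Icc 0 T)) (hd : ∀ t ∈ Ioo 0 T, HasDerivAt X (X' t) t)
    (h : ∀ t ∈ Ioo 0 T, X' t ≤ l * X t) : X T ≤ X 0 * Real.exp (l * T) := by
  have hd' : ∀ t ∈ Ioo 0 T, HasDerivAt (fun t => Real.exp (-(l * t)) * X t)
      (Real.exp (-(l * t)) * -l * X t + Real.exp (-(l * t)) * X' t) t := by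
    intro t ht
    have h1 : HasDerivAt (fun t => Real.exp (-(l * t))) (Real.exp (-(l * t)) * -l) t := by
      have := (((hasDerivAt_id t).const_mul l).neg).exp
      simpa using this
    exact h1.mul (hd t ht)
  have hanti : AntitoneOn (fun t => Real.exp (-(l * t)) * X t) (Icc 0 T) := by
    refine antitoneOn_of_deriv_nonpos (convex_Icc 0 T) ?_ ?_ ?_
    · exact (by fun_prop : Continuous fun t => Real.exp (-(l * t))).continuousOn.mul hc
    · rw [interior_Icc]
      exact fun t ht => (hd' t ht).differentiableAt.differentiableWithinAt
    · rw [interior_Icc]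
      intro t ht
      rw [(hd' t ht).deriv]
      have := mul_le_mul_of_nonneg_left (h t ht) (Real.exp_pos (-(l * t))).le
      linarith
  have hfin := hanti (left_mem_Icc.2 hT) (right_mem_Icc.2 hT) hT
  simp only [mul_zero, neg_zero, Real.exp_zero, one_mul] at hfin
  have h2 : X T = (Real.exp (-(l * T)) * X T) * Real.exp (l * T) := by
    rw [mul_right_comm, ← Real.exp_add]; simp
  rw [h2]
  exact mul_le_mul_of_nonneg_right hfin (Real.exp_pos _).le

/-- A continuity argument: the differential inequality is only needed as long as `X ≤ G`. -/
lemma bootstrap {X X' : ℝ → ℝ} {T l G : ℝ} (hl : 0 ≤ l)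
    (hc : ContinuousOn X (Icc 0 T)) (hX0 : 0 ≤ X 0)
    (hd : ∀ t ∈ Ioo 0 T, HasDerivAt X (X' t) t)
    (h : ∀ t ∈ Ioo 0 T, X t ≤ G → X' t ≤ l * X t) (hG : X 0 * Real.exp (l * T) < G) :
    ∀ t ∈ Icc 0 T, X t ≤ G := by
  intro t0 ht0
  by_contra hcon
  push Not at hcon
  have hT : 0 ≤ T := ht0.1.trans ht0.2
  let S : Set ℝ := {t ∈ Icc 0 T | G ≤ X t}
  have hS : IsClosed S := isClosed_Icc.isClosed_le continuousOn_const hc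
  have hne : S.Nonempty := ⟨t0, ht0, hcon.le⟩
  have hbb : BddBelow S := ⟨0, fun t ht => ht.1.1⟩
  have hmem : sInf S ∈ S := hS.csInf_mem hne hbb
  set t1 := sInf S
  have hlt : ∀ t ∈ Icc 0 T, t < t1 → X t < G := by
    intro t ht htt
    by_contra hge
    exact absurd (csInf_le hbb ⟨ht, not_lt.1 hge⟩) (not_le.2 htt)
  have hsub : Icc 0 t1 ⊆ Icc 0 T := Icc_subset_Icc_right hmem.1.2
  have h1 : X t1 ≤ X 0 * Real.exp (l * t1) := by
    refine le_mul_exp_of_deriv_le hmem.1.1 (hc.mono hsub)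
      (fun t ht => hd t ⟨ht.1, ht.2.trans_le hmem.1.2⟩) fun t ht => ?_
    exact h t ⟨ht.1, ht.2.trans_le hmem.1.2⟩
      (hlt t (hsub (Ioo_subset_Icc_self ht)) ht.2).le
  have h2 : X 0 * Real.exp (l * t1) ≤ X 0 * Real.exp (l * T) :=
    mul_le_mul_of_nonneg_left (Real.exp_le_exp.2 (mul_le_mul_of_nonneg_left hmem.1.2 hl)) hX0
  linarith [hmem.2]

lemma gev_le_gev_add {p r q τ : ℝ} {a : Freq → C3} (ha : a 0 = 0) (hr : 0 ≤ r) (hq : 0 ≤ q)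
    (hR : Rapid p τ a) : gev p r τ a ≤ gev p (r + q) τ a := by
  refine (hR.summable_gev hr).tsum_le_tsum (fun k => ?_) (hR.summable_gev (by linarith))
  by_cases hk : k = 0
  · simp [hk, ha]
  · refine mul_le_mul_of_nonneg_right (mul_le_mul_of_nonneg_right ?_ (Real.exp_pos _).le)
      (sq_nonneg _)
    exact Real.rpow_le_rpow_of_exponent_le (one_le_freqNorm hk) (by linarith)

lemma wiener_one_zero (p : ℝ) (a : Freq → C3) :
    wiener p 1 0 a = ∑' k, freqNorm k * ‖a k‖ := by
  simp [wiener]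

/-- The `H^r` energy identity for solutions with rapidly decaying coefficients. -/
lemma FourierSolution.hasDerivAt_energy {ν p r T ρ B : ℝ} {u : ℝ → Freq → C3}
    (hu : FourierSolution ν r T u) (hr : 1 ≤ r) (hp0 : 0 < p) (hp1 : p ≤ 1) (hρ : 0 < ρ)
    (h : HasMajorant p T (fun _ => 0) u ρ B) {t : ℝ} (ht : t ∈ Ioo 0 T) :
    HasDerivAt (fun t => energy r (u t))
      (-2 * ν * gev p (r + 1) 0 (u t) - 2 * production p r 0 (u t)) t := by
  have := hu.hasDerivAt_gev (σ' := fun _ => 0) (S := 0) hr hp0 hp1 hρ h (fun _ _ => le_rfl)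
    (fun t _ => hasDerivAt_const t 0) (by simp) ht
  simp only [gev_zero p r] at this
  refine this.congr_deriv ?_
  ring

lemma FourierSolution.continuousOn_energy {ν p r T ρ B : ℝ} {u : ℝ → Freq → C3}
    (hu : FourierSolution ν r T u) (hp0 : 0 < p) (hρ : 0 < ρ)
    (h : HasMajorant p T (fun _ => 0) u ρ B) :
    ContinuousOn (fun t => energy r (u t)) (Icc 0 T) := by
  have := h.continuousOn_gev (r := r) hp0 hρ continuousOn_const hu.cont
  simpa only [gev_zero] using this

/-- Closeness of all coefficients, together with a bound in `H^r`, gives closeness in the Wiener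
norm of the gradient. -/
lemma exists_small_wiener {r : ℝ} (hr : 4 < r) (C : ℝ) :
    ∃ δ : ℝ, 0 < δ ∧ ∀ w : Freq → C3, (∀ k, ‖w k‖ ≤ δ) →
      (∀ k, ‖w k‖ ≤ C * freqNorm k ^ (-r)) →
      (Summable fun k => freqNorm k * ‖w k‖) ∧ ∑' k, freqNorm k * ‖w k‖ ≤ 1 := by
  by_cases hC : C < 0
  · refine ⟨1, one_pos, fun w _ hw => ?_⟩
    have h0 : ∀ k, freqNorm k * ‖w k‖ = 0 := fun k => by
      have h1 : ‖w k‖ ≤ 0 := (hw k).trans (mul_nonpos_of_nonpos_of_nonneg hC.le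
        (Real.rpow_nonneg (freqNorm_nonneg k) _))
      rw [le_antisymm h1 (norm_nonneg _), mul_zero]
    simp [h0, summable_zero]
  push Not at hC
  let bd : Freq → ℝ := fun k => C * freqNorm k ^ (1 + -r)
  have hbd : Summable bd := (summable_freqNorm_rpow (by linarith)).mul_left C
  have hbd0 : ∀ k, 0 ≤ bd k := fun k => mul_nonneg hC (Real.rpow_nonneg (freqNorm_nonneg k) _)
  have hlim : Tendsto (fun δ : ℝ => ∑' k, min (freqNorm k * |δ|) (bd k)) (𝓝 0)
      (𝓝 (∑' _ : Freq, (0 : ℝ))) := by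
    refine tendsto_tsum_of_dominated_convergence hbd (fun k => ?_) (Eventually.of_forall
      fun δ k => ?_)
    · have hcont : Continuous fun δ : ℝ => min (freqNorm k * |δ|) (bd k) := by fun_prop
      have := hcont.tendsto 0
      simpa [hbd0 k] using this
    · rw [Real.norm_of_nonneg (le_min (mul_nonneg (freqNorm_nonneg k) (abs_nonneg _)) (hbd0 k))]
      exact min_le_right _ _
  rw [tsum_zero] at hlim
  obtain ⟨ε, hε, hball⟩ := Metric.eventually_nhds_iff.1 (hlim.eventually_lt_const zero_lt_one)
  have hδ := hball (y := ε / 2) (by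
    rw [Real.dist_eq, sub_zero, abs_of_pos (by linarith)]; linarith)
  refine ⟨ε / 2, by linarith, fun w hw1 hw2 => ?_⟩
  have hle : ∀ k, freqNorm k * ‖w k‖ ≤ min (freqNorm k * |ε / 2|) (bd k) := by
    intro k
    refine le_min ?_ ?_
    · rw [abs_of_pos (by linarith)]
      exact mul_le_mul_of_nonneg_left (hw1 k) (freqNorm_nonneg k)
    · refine (mul_le_mul_of_nonneg_left (hw2 k) (freqNorm_nonneg k)).trans ?_
      by_cases hk : k = 0
      · rw [hk, freqNorm_zero, zero_mul]
        exact hbd0 0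
      · have hk0 : 0 < freqNorm k := by linarith [one_le_freqNorm hk]
        simp only [bd]
        rw [Real.rpow_add hk0, Real.rpow_one]
        exact le_of_eq (by ring)
  have hs2 : Summable fun k => min (freqNorm k * |ε / 2|) (bd k) :=
    hbd.of_nonneg_of_le
      (fun k => le_min (mul_nonneg (freqNorm_nonneg k) (abs_nonneg _)) (hbd0 k))
      fun k => min_le_right _ _
  have hs1 : Summable fun k => freqNorm k * ‖w k‖ :=
    hs2.of_nonneg_of_le (fun k => mul_nonneg (freqNorm_nonneg k) (norm_nonneg _)) hle
  exact ⟨hs1, (hs1.tsum_le_tsum hle hs2).trans hδ.le⟩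

/-- Near a viscosity for which an `H^r` solution exists on `[0,T]`, all rapidly decaying solutions
are bounded in `H^r`, uniformly: their difference with the given solution is so small in `L²` that
the Wiener norm of the gradient, hence the growth rate, exceeds that of `U` by at most one. -/
lemma exists_energy_le_near {p r T μ : ℝ} {U : ℝ → Freq → C3} (hr : 9 / 2 < r) (hp0 : 0 < p)
    (hp1 : p ≤ 1) (hT : 0 ≤ T) (hU : FourierSolution μ r T U) :
    ∃ ε K : ℝ, 0 < ε ∧ ∀ ν : ℝ, 0 ≤ ν → |ν - μ| < ε → ∀ (u : ℝ → Freq → C3) (ρ B : ℝ), 0 < ρ →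
      FourierSolution ν r T u → HasMajorant p T (fun _ => 0) u ρ B → (∀ k, u 0 k = U 0 k) →
      ∀ t ∈ Icc 0 T, energy r (u t) ≤ K := by
  obtain ⟨KU, hKU⟩ := hU.bound
  have h0T : (0 : ℝ) ∈ Icc 0 T := left_mem_Icc.2 hT
  have hKU0 : 0 ≤ KU := (energy_nonneg _ _).trans (hKU 0 h0T)
  set L := embConst (r - 1) * Real.sqrt KU
  have hL0 : 0 ≤ L := mul_nonneg (embConst_nonneg _) (Real.sqrt_nonneg _)
  have h2r : (0 : ℝ) < 2 ^ r := by positivity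
  have hr0 : 0 < r := by linarith
  set l := 2 * (2 * r * 2 ^ r * (L + 1)) with hl
  have hl0 : 0 ≤ l := by positivity
  set K := energy r (U 0) * Real.exp (l * T) + 1
  have hE0 := energy_nonneg r (U 0)
  have hK0 : 0 ≤ K := by positivity
  obtain ⟨δ, hδ, hsmall⟩ := exists_small_wiener (r := r) (by linarith)
    (Real.sqrt K + Real.sqrt KU)
  set Q := KU * T * Real.exp ((1 + 2 * (embConst (r - 1) * Real.sqrt KU)) * T)
  have hQ0 : 0 ≤ Q := by positivity
  refine ⟨δ / (1 + Q), K, by positivity, ?_⟩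
  intro ν hν hνμ u ρ B hρ hu hmaj hu0
  have hclose : ∀ t ∈ Icc 0 T, ∀ k, ‖u t k - U t k‖ ≤ δ := by
    intro t ht k
    have h1 := hu.sq_norm_sub_le hr hν hU hKU hu0 ht k
    have h2 : (ν - μ) ^ 2 ≤ (δ / (1 + Q)) ^ 2 := by
      rw [← sq_abs (ν - μ)]
      exact pow_le_pow_left₀ (abs_nonneg _) hνμ.le 2
    have h3 : (δ / (1 + Q)) ^ 2 * Q ≤ δ ^ 2 := by
      rw [div_pow, div_mul_eq_mul_div, div_le_iff₀ (by positivity)]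
      have : Q ≤ (1 + Q) ^ 2 := by nlinarith
      exact mul_le_mul_of_nonneg_left this (sq_nonneg δ)
    exact abs_le_of_sq_le_sq' (h1.trans ((mul_le_mul_of_nonneg_right h2 hQ0).trans h3)) hδ.le |>.2
  refine bootstrap hl0 (hu.continuousOn_energy hp0 hρ hmaj) (energy_nonneg _ _)
    (fun t ht => hu.hasDerivAt_energy (by linarith) hp0 hp1 hρ hmaj ht) (fun t ht hXK => ?_) ?_
  · have ht' := Ioo_subset_Icc_self ht
    have hw := hsmall (fun k => u t k - U t k) (hclose t ht') fun k => by
      rw [add_mul]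
      refine (norm_sub_le _ _).trans (add_le_add ?_ ?_)
      · exact ((hu.adm t ht').norm_le k).trans (mul_le_mul_of_nonneg_right
          (Real.sqrt_le_sqrt hXK) (Real.rpow_nonneg (freqNorm_nonneg k) _))
      · exact ((hU.adm t ht').norm_le k).trans (mul_le_mul_of_nonneg_right
          (Real.sqrt_le_sqrt (hKU t ht')) (Real.rpow_nonneg (freqNorm_nonneg k) _))
    have hU1 := (hU.adm t ht').l1 (q := 1) (by linarith)
    simp only [Real.rpow_one] at hU1
    have hUL : ∑' k, freqNorm k * ‖U t k‖ ≤ L := hU1.2.trans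
      (mul_le_mul_of_nonneg_left (Real.sqrt_le_sqrt (hKU t ht')) (embConst_nonneg _))
    have hW : wiener p 1 0 (u t) ≤ L + 1 := by
      rw [wiener_one_zero]
      calc ∑' k, freqNorm k * ‖u t k‖
          ≤ ∑' k, (freqNorm k * ‖U t k‖ + freqNorm k * ‖u t k - U t k‖) := by
            refine ((hu.adm t ht').summable_freqNorm_mul (by linarith)).tsum_le_tsum
              (fun k => ?_) (hU1.1.add hw.1)
            rw [← mul_add]
            refine mul_le_mul_of_nonneg_left ?_ (freqNorm_nonneg k)
            have := norm_add_le (U t k) (u t k - U t k)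
            rwa [add_sub_cancel] at this
        _ = _ := hU1.1.tsum_add hw.1
        _ ≤ L + 1 := add_le_add hUL hw.2
    have hprod := abs_production_zero_le (by linarith) hp0 hp1 (hu.adm t ht')
      (hmaj.rapid hp0 hρ ht')
    have hX := energy_nonneg r (u t)
    have h4 : 2 * r * 2 ^ r * wiener p 1 0 (u t) * energy r (u t) ≤
        2 * r * 2 ^ r * (L + 1) * energy r (u t) := by gcongr
    have h5 : 0 ≤ ν * gev p (r + 1) 0 (u t) := mul_nonneg hν (gev_nonneg _ _ _ _)
    have h6 := neg_le_abs (production p r 0 (u t))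
    rw [hl]
    linarith
  · have : u 0 = U 0 := funext hu0
    rw [this]
    linarith

/-- For large viscosity the dissipation absorbs the production as long as the energy is below
`K = energy r a + 1`, so that the energy never reaches `K`. -/
lemma exists_energy_le_of_large {p r T : ℝ} (hr : 9 / 2 < r) (hp0 : 0 < p) (hp1 : p ≤ 1)
    (a : Freq → C3) :
    ∃ N K : ℝ, 0 ≤ N ∧ ∀ ν : ℝ, N ≤ ν → ∀ (u : ℝ → Freq → C3) (ρ B : ℝ), 0 < ρ →
      FourierSolution ν r T u → HasMajorant p T (fun _ => 0) u ρ B → (∀ k, u 0 k = a k) →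
      ∀ t ∈ Icc 0 T, energy r (u t) ≤ K := by
  set K := energy r a + 1
  have h2r : (0 : ℝ) < 2 ^ r := by positivity
  have hr0 : 0 < r := by linarith
  have he := embConst_nonneg (r - 1)
  set c := embConst (r - 1) * Real.sqrt K
  have hc : 0 ≤ c := mul_nonneg he (Real.sqrt_nonneg _)
  refine ⟨2 * r * 2 ^ r * c, K, by positivity, ?_⟩
  intro ν hν u ρ B hρ hu hmaj hu0
  have hν0 : 0 ≤ ν := le_trans (by positivity) hν
  refine bootstrap le_rfl (hu.continuousOn_energy hp0 hρ hmaj) (energy_nonneg _ _)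
    (fun t ht => hu.hasDerivAt_energy (by linarith) hp0 hp1 hρ hmaj ht) (fun t ht hXK => ?_) ?_
  · have ht' := Ioo_subset_Icc_self ht
    have hR := hmaj.rapid hp0 hρ ht'
    have hprod := abs_production_zero_le (by linarith) hp0 hp1 (hu.adm t ht') hR
    have hW : wiener p 1 0 (u t) ≤ c := by
      have := wiener_le (r := r) (hu.adm t ht').zero hR (by linarith) (q := 1) (by linarith)
      rw [gev_zero] at this
      exact this.trans (mul_le_mul_of_nonneg_left (Real.sqrt_le_sqrt hXK) he)
    have hX := energy_nonneg r (u t)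
    have h4 : 2 * r * 2 ^ r * wiener p 1 0 (u t) * energy r (u t) ≤ ν * energy r (u t) := by
      refine mul_le_mul_of_nonneg_right (le_trans ?_ hν) hX
      gcongr
    have h5 : ν * energy r (u t) ≤ ν * gev p (r + 1) 0 (u t) := by
      rw [← gev_zero p]
      exact mul_le_mul_of_nonneg_left
        (gev_le_gev_add (hu.adm t ht').zero (by linarith) zero_le_one hR) hν0
    have h6 := neg_le_abs (production p r 0 (u t))
    linarith
  · have : u 0 = a := funext hu0
    rw [this, zero_mul, Real.exp_zero, mul_one]
    linarith

/-- The `H^r` bound uniform in the viscosity: local bounds, compactness of bounded ranges of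
viscosities, and the bound for large viscosities. -/
lemma exists_energy_le {p r T : ℝ} (hr : 9 / 2 < r) (hp0 : 0 < p) (hp1 : p ≤ 1) (hT : 0 ≤ T)
    (a : Freq → C3)
    (hex : ∀ ν : ℝ, 0 ≤ ν → ∃ U, FourierSolution ν r T U ∧ ∀ k, U 0 k = a k) :
    ∃ K : ℝ, ∀ ν : ℝ, 0 ≤ ν → ∀ (u : ℝ → Freq → C3) (ρ B : ℝ), 0 < ρ →
      FourierSolution ν r T u → HasMajorant p T (fun _ => 0) u ρ B → (∀ k, u 0 k = a k) →
      ∀ t ∈ Icc 0 T, energy r (u t) ≤ K := by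
  obtain ⟨N, K1, hN, hlarge⟩ := exists_energy_le_of_large (p := p) (r := r) (T := T) hr hp0 hp1 a
  have hcomp : ∃ K : ℝ, ∀ ν ∈ Icc 0 N, 0 ≤ ν → ∀ (u : ℝ → Freq → C3) (ρ B : ℝ), 0 < ρ →
      FourierSolution ν r T u → HasMajorant p T (fun _ => 0) u ρ B → (∀ k, u 0 k = a k) →
      ∀ t ∈ Icc 0 T, energy r (u t) ≤ K := by
    refine isCompact_Icc.induction_on (p := fun S : Set ℝ => ∃ K : ℝ, ∀ ν ∈ S, 0 ≤ ν →
      ∀ (u : ℝ → Freq → C3) (ρ B : ℝ), 0 < ρ → FourierSolution ν r T u →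
      HasMajorant p T (fun _ => 0) u ρ B → (∀ k, u 0 k = a k) →
      ∀ t ∈ Icc 0 T, energy r (u t) ≤ K) ⟨0, by simp⟩
      (fun S S' hS ⟨K, hK⟩ => ⟨K, fun ν hν => hK ν (hS hν)⟩) ?_ ?_
    · rintro S S' ⟨K, hK⟩ ⟨K', hK'⟩
      refine ⟨max K K', fun ν hν h0 u ρ B hρ hu hm hu0 t ht => ?_⟩
      rcases hν with hν | hν
      · exact (hK ν hν h0 u ρ B hρ hu hm hu0 t ht).trans (le_max_left _ _)
      · exact (hK' ν hν h0 u ρ B hρ hu hm hu0 t ht).trans (le_max_right _ _)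
    · intro μ hμ
      obtain ⟨U, hU, hU0⟩ := hex μ hμ.1
      obtain ⟨ε, K, hε, hK⟩ := exists_energy_le_near hr hp0 hp1 hT hU
      refine ⟨Metric.ball μ ε, mem_nhdsWithin_of_mem_nhds (Metric.ball_mem_nhds μ hε), K,
        fun ν hν h0 u ρ B hρ hu hm hu0 => ?_⟩
      exact hK ν h0 (by simpa [Real.dist_eq] using hν) u ρ B hρ hu hm
        fun k => (hu0 k).trans (hU0 k).symm
  obtain ⟨K2, hK2⟩ := hcomp
  refine ⟨max K1 K2, fun ν hν u ρ B hρ hu hm hu0 t ht => ?_⟩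
  rcases le_total N ν with h | h
  · exact (hlarge ν h u ρ B hρ hu hm hu0 t ht).trans (le_max_left _ _)
  · exact (hK2 ν ⟨hν, h⟩ hν u ρ B hρ hu hm hu0 t ht).trans (le_max_right _ _)

/-! ### The Gevrey radius -/

lemma radius_denom_pos {C₁ C₂ τ₀ t : ℝ} (h1 : 0 < C₁) (h2 : 0 < C₂) (h0 : 0 < τ₀) (ht : 0 ≤ t) :
    0 < Real.exp (C₁ * t) * (1 / τ₀) + C₂ / C₁ * (Real.exp (C₁ * t) - 1) := by
  have : 0 ≤ Real.exp (C₁ * t) - 1 := sub_nonneg.2 (Real.one_le_exp (by positivity))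
  positivity

lemma radius_pos {C₁ C₂ τ₀ t : ℝ} (h1 : 0 < C₁) (h2 : 0 < C₂) (h0 : 0 < τ₀) (ht : 0 ≤ t) :
    0 < radius C₁ C₂ τ₀ t :=
  one_div_pos.2 (radius_denom_pos h1 h2 h0 ht)

lemma radius_zero (C₁ C₂ τ₀ : ℝ) : radius C₁ C₂ τ₀ 0 = τ₀ := by
  simp [radius]

/-- The radius solves the Bernoulli equation `τ' = -(C₁ τ + C₂ τ²)`. -/
lemma hasDerivAt_radius {C₁ C₂ τ₀ t : ℝ} (h1 : 0 < C₁) (h2 : 0 < C₂) (h0 : 0 < τ₀) (ht : 0 ≤ t) :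
    HasDerivAt (radius C₁ C₂ τ₀)
      (-(C₁ * radius C₁ C₂ τ₀ t + C₂ * radius C₁ C₂ τ₀ t ^ 2)) t := by
  have hD := radius_denom_pos h1 h2 h0 ht
  have hE : HasDerivAt (fun t => Real.exp (C₁ * t)) (Real.exp (C₁ * t) * C₁) t := by
    simpa using ((hasDerivAt_id t).const_mul C₁).exp
  have hd := ((hE.mul_const (1 / τ₀)).add ((hE.sub_const 1).const_mul (C₂ / C₁))).inv hD.ne'
  have heq : radius C₁ C₂ τ₀ = (fun t => Real.exp (C₁ * t) * (1 / τ₀) +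
      C₂ / C₁ * (Real.exp (C₁ * t) - 1))⁻¹ := by
    funext x; simp [radius]
  rw [heq]
  refine hd.congr_deriv ?_
  simp only [Pi.inv_apply]
  simp only [Pi.add_apply]
  generalize Real.exp (C₁ * t) = e at *
  set D := e * (1 / τ₀) + C₂ / C₁ * (e - 1) with hDdef
  have hD' : e * C₁ * (1 / τ₀) + C₂ / C₁ * (e * C₁) = C₁ * D + C₂ := by
    rw [hDdef]; field_simp; ring
  rw [hD']
  field_simp

lemma strictAntiOn_radius {C₁ C₂ τ₀ : ℝ} (h1 : 0 < C₁) (h2 : 0 < C₂) (h0 : 0 < τ₀) (T : ℝ) :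
    StrictAntiOn (radius C₁ C₂ τ₀) (Icc 0 T) := by
  refine strictAntiOn_of_deriv_neg (convex_Icc 0 T) (fun t ht =>
    (hasDerivAt_radius h1 h2 h0 ht.1).continuousAt.continuousWithinAt) fun t ht => ?_
  rw [interior_Icc] at ht
  rw [(hasDerivAt_radius h1 h2 h0 ht.1.le).deriv]
  have := radius_pos h1 h2 h0 ht.1.le
  have : 0 < C₁ * radius C₁ C₂ τ₀ t + C₂ * radius C₁ C₂ τ₀ t ^ 2 := by positivity
  linarith

/-! ### Gevrey norms as limits of Gevrey norms of smaller radius -/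

lemma gevreyNorm_sq (s r τ : ℝ) (v : R3 → R3) : gevreyNorm s r τ v ^ 2 =
    ∑' k : Freq, ENNReal.ofReal (freqNorm k ^ (2 * r) *
      Real.exp (2 * τ * freqNorm k ^ (1 / s)) * ‖vecFourierCoeff v k‖ ^ 2) := by
  rw [gevreyNorm, ← ENNReal.rpow_natCast, ← ENNReal.rpow_mul]
  norm_num

lemma gevreyNorm_le_of_sq_le {s r τ B : ℝ} {v : R3 → R3}
    (h : gevreyNorm s r τ v ^ 2 ≤ ENNReal.ofReal B) :
    gevreyNorm s r τ v ≤ ENNReal.ofReal (Real.sqrt B) := by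
  have h1 : gevreyNorm s r τ v = (gevreyNorm s r τ v ^ 2) ^ (1 / 2 : ℝ) := by
    rw [← ENNReal.rpow_natCast, ← ENNReal.rpow_mul]
    norm_num
  rw [h1, Real.sqrt_eq_rpow]
  refine (ENNReal.rpow_le_rpow h (by norm_num)).trans ?_
  rcases le_or_gt 0 B with hB | hB
  · rw [ENNReal.ofReal_rpow_of_nonneg hB (by norm_num)]
  · rw [ENNReal.ofReal_of_nonpos hB.le, ENNReal.zero_rpow_of_pos (by norm_num)]
    exact bot_le

lemma gev_term_nonneg (p r τ : ℝ) (a : Freq → C3) (k : Freq) :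
    0 ≤ freqNorm k ^ (2 * r) * Real.exp (2 * τ * freqNorm k ^ p) * ‖a k‖ ^ 2 :=
  mul_nonneg (mul_nonneg (Real.rpow_nonneg (freqNorm_nonneg k) _) (Real.exp_pos _).le)
    (sq_nonneg _)

lemma gevreyNorm_sq_eq_ofReal {s r τ : ℝ} {v : R3 → R3} (hr : 0 ≤ r)
    (h : Rapid (1 / s) τ (vecFourierCoeff v)) :
    gevreyNorm s r τ v ^ 2 = ENNReal.ofReal (gev (1 / s) r τ (vecFourierCoeff v)) := by
  rw [gevreyNorm_sq, gev, ENNReal.ofReal_tsum_of_nonneg (gev_term_nonneg _ _ _ _)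
    (h.summable_gev hr)]

/-- Fatou's lemma for the radius: the norm of radius `τ` is controlled by those of radius
`θ τ`, `θ → 1`. -/
lemma gevreyNorm_sq_le_liminf (s r τ : ℝ) (v : R3 → R3) {θ : ℕ → ℝ}
    (hθ : Tendsto θ atTop (𝓝 1)) :
    gevreyNorm s r τ v ^ 2 ≤ liminf (fun n => gevreyNorm s r (θ n * τ) v ^ 2) atTop := by
  simp only [gevreyNorm_sq]
  rw [ENNReal.tsum_eq_iSup_sum]
  refine iSup_le fun F => ?_
  have hlim : Tendsto (fun n => ∑ k ∈ F, ENNReal.ofReal (freqNorm k ^ (2 * r) *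
      Real.exp (2 * (θ n * τ) * freqNorm k ^ (1 / s)) * ‖vecFourierCoeff v k‖ ^ 2)) atTop
      (𝓝 (∑ k ∈ F, ENNReal.ofReal (freqNorm k ^ (2 * r) *
      Real.exp (2 * τ * freqNorm k ^ (1 / s)) * ‖vecFourierCoeff v k‖ ^ 2))) := by
    refine tendsto_finsetSum _ fun k _ => ENNReal.tendsto_ofReal ?_
    have hc : Continuous fun x : ℝ => freqNorm k ^ (2 * r) *
      Real.exp (2 * (x * τ) * freqNorm k ^ (1 / s)) * ‖vecFourierCoeff v k‖ ^ 2 := by fun_prop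
    have h1 := (hc.tendsto 1).comp hθ
    rw [one_mul] at h1
    exact h1
  rw [← hlim.liminf_eq]
  exact liminf_le_liminf (Eventually.of_forall fun n => ENNReal.sum_le_tsum F)

lemma norm_coef_le_of_gevreyNorm_le {s q τ B : ℝ} {v : R3 → R3} (hq : 0 ≤ q)
    (h0 : vecFourierCoeff v 0 = 0) (h : gevreyNorm s q τ v ≤ ENNReal.ofReal B) (k : Freq) :
    Real.exp (τ * freqNorm k ^ (1 / s)) * ‖vecFourierCoeff v k‖ ≤ max B 0 := by
  by_cases hk : k = 0
  · rw [hk, h0, norm_zero, mul_zero]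
    exact le_max_right _ _
  have h1 : ENNReal.ofReal (freqNorm k ^ (2 * q) * Real.exp (2 * τ * freqNorm k ^ (1 / s)) *
      ‖vecFourierCoeff v k‖ ^ 2) ≤ ENNReal.ofReal (max B 0 ^ 2) := by
    calc _ ≤ gevreyNorm s q τ v ^ 2 := by
          rw [gevreyNorm_sq]
          exact ENNReal.le_tsum (f := fun k : Freq => ENNReal.ofReal (freqNorm k ^ (2 * q) *
            Real.exp (2 * τ * freqNorm k ^ (1 / s)) * ‖vecFourierCoeff v k‖ ^ 2)) k
      _ ≤ ENNReal.ofReal (max B 0) ^ 2 := by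
          gcongr
          exact h.trans (ENNReal.ofReal_le_ofReal (le_max_left _ _))
      _ = _ := (ENNReal.ofReal_pow (le_max_right _ _) 2).symm
  rw [ENNReal.ofReal_le_ofReal_iff (sq_nonneg _), ← weight_sq] at h1
  have h2 := abs_le_of_sq_le_sq' h1 (le_max_right _ _) |>.2
  refine le_trans ?_ h2
  rw [mul_assoc]
  exact le_mul_of_one_le_left (by positivity) (Real.one_le_rpow (one_le_freqNorm hk) hq)

/-- An essential Gevrey bound in time holds for the coefficients at every time, by their
continuity. -/
lemma MemLinftyGevrey.exists_norm_coef_le {s q T : ℝ} {τ : ℝ → ℝ} {u : ℝ → R3 → R3}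
    (h : MemLinftyGevrey s q T τ u) (hq : 0 ≤ q) (hT : 0 < T) (hτ : ContinuousOn τ (Icc 0 T))
    (hc : ∀ k, ContinuousOn (fun t => vecFourierCoeff (u t) k) (Icc 0 T)) :
    ∃ B : ℝ, ∀ t ∈ Icc 0 T, ∀ k : Freq,
      Real.exp (τ t * freqNorm k ^ (1 / s)) * ‖vecFourierCoeff (u t) k‖ ≤ B := by
  obtain ⟨B, hB⟩ := h
  refine ⟨max B 0, fun t ht k => ?_⟩
  have hf : ContinuousOn (fun t => Real.exp (τ t * freqNorm k ^ (1 / s)) *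
      ‖vecFourierCoeff (u t) k‖) (Icc 0 T) :=
    (Real.continuous_exp.comp_continuousOn (hτ.mul continuousOn_const)).mul (hc k).norm
  have hae : (fun t => max (Real.exp (τ t * freqNorm k ^ (1 / s)) *
      ‖vecFourierCoeff (u t) k‖) (max B 0)) =ᵐ[volume.restrict (Icc 0 T)]
      fun _ => max B 0 := by
    filter_upwards [hB] with t ht
    exact max_eq_right (norm_coef_le_of_gevreyNorm_le hq ht.1.1.mean_zero ht.2 k)
  have heq := Measure.eqOn_Icc_of_ae_eq volume hT.ne hae (hf.sup continuousOn_const)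
    continuousOn_const ht
  exact max_eq_right_iff.1 heq

/-- Shrinking the radius by a factor `θ < 1` turns a bound for the weighted coefficients into an
exponentially decaying majorant. -/
lemma hasMajorant_of_norm_le {p T B m θ : ℝ} {τ : ℝ → ℝ} {u : ℝ → Freq → C3}
    (hθ : θ ≤ 1) (hm : ∀ t ∈ Icc 0 T, m ≤ τ t)
    (h : ∀ t ∈ Icc 0 T, ∀ k, Real.exp (τ t * freqNorm k ^ p) * ‖u t k‖ ≤ B) :
    HasMajorant p T (fun t => θ * τ t) u ((1 - θ) * m) B := by
  intro t ht k
  have hx : 0 ≤ freqNorm k ^ p := Real.rpow_nonneg (freqNorm_nonneg k) _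
  have hB : 0 ≤ B := le_trans (by positivity) (h t ht k)
  calc Real.exp (θ * τ t * freqNorm k ^ p) * ‖u t k‖
      = Real.exp (-((1 - θ) * τ t * freqNorm k ^ p)) *
        (Real.exp (τ t * freqNorm k ^ p) * ‖u t k‖) := by
        rw [← mul_assoc, ← Real.exp_add]; congr 2; ring
    _ ≤ Real.exp (-((1 - θ) * m * freqNorm k ^ p)) * B := by
        refine mul_le_mul (Real.exp_le_exp.2 (neg_le_neg ?_)) (h t ht k) (by positivity)
          (Real.exp_pos _).le
        exact mul_le_mul_of_nonneg_right
          (mul_le_mul_of_nonneg_left (hm t ht) (sub_nonneg.2 hθ)) hx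
    _ = _ := mul_comm _ _

/-! ### The Gevrey energy estimate -/

/-- The a priori estimate for a radius `σ` that decreases fast enough to absorb the part of the
production which involves `p/2` derivatives too many. -/
lemma FourierSolution.gev_le_and_integral_le {ν p r T ρ B S C K C₁ C₂ X0 G : ℝ}
    {σ σ' : ℝ → ℝ} {u : ℝ → Freq → C3} (hr : 9 / 2 < r) (hp0 : 0 < p) (hp1 : p ≤ 1)
    (hν : 0 ≤ ν) (hu : FourierSolution ν r T u) (hρ : 0 < ρ) (h : HasMajorant p T σ u ρ B)
    (hσc : ContinuousOn σ (Icc 0 T)) (hσ : ∀ t ∈ Icc 0 T, 0 ≤ σ t)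
    (hσd : ∀ t ∈ Ioo 0 T, HasDerivAt σ (σ' t) t) (hS : ∀ t ∈ Ioo 0 T, |σ' t| ≤ S)
    (hσ' : ∀ t ∈ Ioo 0 T, σ' t ≤ -(C₁ * σ t + C₂ * σ t ^ 2)) (hC : 0 ≤ C)
    (hprod : ∀ (τ : ℝ) (a : Freq → C3), 0 ≤ τ → Admissible r a → Rapid p τ a →
      |production p r τ a| ≤ C * Real.sqrt (energy r a) * gev p r τ a +
        C * (τ * Real.sqrt (energy r a) + τ ^ 2 * Real.sqrt (gev p r τ a)) *
          gev p (r + p / 2) τ a)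
    (hK : ∀ t ∈ Icc 0 T, energy r (u t) ≤ K) (hC₁ : C * Real.sqrt K ≤ C₁)
    (hC₂ : C * Real.sqrt G ≤ C₂) (hX0 : gev p r (σ 0) (u 0) ≤ X0)
    (hG : X0 * Real.exp (2 * C * Real.sqrt K * T) < G) {t : ℝ} (ht : t ∈ Icc 0 T) :
    gev p r (σ t) (u t) ≤ G ∧
      2 * ν * ∫ t' in (0 : ℝ)..t, gev p (r + 1) (σ t') (u t') ≤
        X0 + 2 * C * Real.sqrt K * G * T := by
  set l := 2 * C * Real.sqrt K with hl
  have hl0 : 0 ≤ l := by positivity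
  have hsub : Ioo 0 T ⊆ Icc 0 T := Ioo_subset_Icc_self
  have hd := fun t (ht : t ∈ Ioo 0 T) =>
    hu.hasDerivAt_gev (by linarith) hp0 hp1 hρ h hσ hσd hS ht
  have hc : ContinuousOn (fun t => gev p r (σ t) (u t)) (Icc 0 T) :=
    h.continuousOn_gev hp0 hρ hσc hu.cont
  have hcZ : ContinuousOn (fun t => gev p (r + 1) (σ t) (u t)) (Icc 0 T) :=
    h.continuousOn_gev hp0 hρ hσc hu.cont
  have hineq : ∀ t ∈ Ioo 0 T, gev p r (σ t) (u t) ≤ G →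
      2 * σ' t * gev p (r + p / 2) (σ t) (u t) - 2 * ν * gev p (r + 1) (σ t) (u t) -
        2 * production p r (σ t) (u t) ≤
      l * gev p r (σ t) (u t) - 2 * ν * gev p (r + 1) (σ t) (u t) := by
    intro t ht hXG
    have hX := gev_nonneg p r (σ t) (u t)
    have hY := gev_nonneg p (r + p / 2) (σ t) (u t)
    have hσt := hσ t (hsub ht)
    have h1 := hprod (σ t) (u t) hσt (hu.adm t (hsub ht)) (h.rapid hp0 hρ (hsub ht))
    have h2 : C * Real.sqrt (energy r (u t)) ≤ C * Real.sqrt K :=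
      mul_le_mul_of_nonneg_left (Real.sqrt_le_sqrt (hK t (hsub ht))) hC
    have h3 : C * Real.sqrt (gev p r (σ t) (u t)) ≤ C * Real.sqrt G :=
      mul_le_mul_of_nonneg_left (Real.sqrt_le_sqrt hXG) hC
    have h4 := mul_le_mul_of_nonneg_right h2 hX
    have h5 : C * (σ t * Real.sqrt (energy r (u t)) +
        σ t ^ 2 * Real.sqrt (gev p r (σ t) (u t))) ≤ -σ' t := by
      have h6 := mul_le_mul_of_nonneg_left (h2.trans hC₁) hσt
      have h7 := mul_le_mul_of_nonneg_left (h3.trans hC₂) (sq_nonneg (σ t))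
      have h8 := hσ' t ht
      linarith
    have h6 := mul_le_mul_of_nonneg_right h5 hY
    have h7 := neg_le_abs (production p r (σ t) (u t))
    rw [hl]
    linarith
  have hbound : ∀ t ∈ Icc 0 T, gev p r (σ t) (u t) ≤ G := by
    refine bootstrap hl0 hc (gev_nonneg _ _ _ _) hd (fun t ht hXG => ?_)
      ((mul_le_mul_of_nonneg_right hX0 (Real.exp_pos _).le).trans_lt hG)
    refine (hineq t ht hXG).trans (sub_le_self _ ?_)
    exact mul_nonneg (by linarith) (gev_nonneg _ _ _ _)
  refine ⟨hbound t ht, ?_⟩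
  have hst : Icc 0 t ⊆ Icc 0 T := Icc_subset_Icc_right ht.2
  have hint : IntervalIntegrable (fun t' => gev p (r + 1) (σ t') (u t')) volume 0 t :=
    (hcZ.mono hst).intervalIntegrable_of_Icc ht.1
  have hmain := intervalIntegral.integral_le_sub_of_hasDeriv_right_of_le ht.1
    (g := fun t => -gev p r (σ t) (u t))
    (φ := fun t => 2 * ν * gev p (r + 1) (σ t) (u t) - l * G) (hc.mono hst).neg
    (fun x hx => (hd x (Ioo_subset_Ioo_right ht.2 hx)).neg.hasDerivWithinAt)
    (((hcZ.mono hst).const_smul (2 * ν)).sub continuousOn_const).integrableOn_Icc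
    (fun x hx => by
      have hx' := Ioo_subset_Ioo_right ht.2 hx
      have h1 := hineq x hx' (hbound x (hsub hx'))
      have h2 := mul_le_mul_of_nonneg_left (hbound x (hsub hx')) hl0
      linarith)
  rw [intervalIntegral.integral_sub (hint.const_mul _) intervalIntegrable_const,
    intervalIntegral.integral_const_mul, intervalIntegral.integral_const, smul_eq_mul] at hmain
  have hG0 : 0 ≤ G := (gev_nonneg _ _ _ _).trans (hbound t ht)
  have h1 : t * (l * G) ≤ T * (l * G) := mul_le_mul_of_nonneg_right ht.2 (by positivity)
  have h2 := gev_nonneg p r (σ t) (u t)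
  linarith

/-- The Gevrey bounds for a solution in the Gevrey class, for every viscosity `ν ≥ 0`. The energy
estimate is applied with the radius `θ τ`, `θ < 1`, for which the solution decays faster than any
Gevrey weight involved, and then `θ → 1`. -/
lemma IsSolution.gevrey_bounds {ν r s q T τ₀ C K C₁ C₂ X0 G : ℝ} {a : R3 → R3}
    {u : ℝ → R3 → R3} (hr : 9 / 2 < r) (hs : 1 ≤ s) (hτ₀ : 0 < τ₀) (hT : 0 < T) (hν : 0 ≤ ν)
    (hq : 0 ≤ q) (h1 : 0 < C₁) (h2 : 0 < C₂) (hu : IsSolution ν r T a u)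
    (hmem : MemLinftyGevrey s q T (radius C₁ C₂ τ₀) u) (hC : 0 ≤ C)
    (hprod : ∀ (τ : ℝ) (a : Freq → C3), 0 ≤ τ → Admissible r a → Rapid (1 / s) τ a →
      |production (1 / s) r τ a| ≤ C * Real.sqrt (energy r a) * gev (1 / s) r τ a +
        C * (τ * Real.sqrt (energy r a) + τ ^ 2 * Real.sqrt (gev (1 / s) r τ a)) *
          gev (1 / s) (r + 1 / s / 2) τ a)
    (hK : ∀ (ρ B : ℝ), 0 < ρ →
      HasMajorant (1 / s) T (fun _ => 0) (fun t => vecFourierCoeff (u t)) ρ B →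
      ∀ t ∈ Icc 0 T, energy r (vecFourierCoeff (u t)) ≤ K)
    (hC₁ : C * Real.sqrt K ≤ C₁) (hC₂ : C * Real.sqrt G ≤ C₂)
    (hX0 : ∀ τ, τ ≤ τ₀ → gev (1 / s) r τ (vecFourierCoeff (u 0)) ≤ X0)
    (hG : X0 * Real.exp (2 * C * Real.sqrt K * T) < G) {t : ℝ} (ht : t ∈ Icc 0 T) :
    gevreyNorm s r (radius C₁ C₂ τ₀ t) (u t) ^ 2 ≤ ENNReal.ofReal G ∧
      (0 < ν → ENNReal.ofReal ν *
        ∫⁻ t' in Ioc 0 t, gevreyNorm s (r + 1) (radius C₁ C₂ τ₀ t') (u t') ^ 2 ≤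
          ENNReal.ofReal ((X0 + 2 * C * Real.sqrt K * G * T) / 2)) := by
  have hr0 : 0 ≤ r := by linarith
  have hp0 : 0 < 1 / s := by positivity
  have hp1 : 1 / s ≤ 1 := (div_le_one (by linarith)).2 hs
  set τ := radius C₁ C₂ τ₀ with hτdef
  have hτd : ∀ t, 0 ≤ t → HasDerivAt τ (-(C₁ * τ t + C₂ * τ t ^ 2)) t := fun t ht =>
    hasDerivAt_radius h1 h2 hτ₀ ht
  have hτc : ContinuousOn τ (Icc 0 T) := fun t ht =>
    (hτd t ht.1).continuousAt.continuousWithinAt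
  have hτpos : ∀ t, 0 ≤ t → 0 < τ t := fun t ht => radius_pos h1 h2 hτ₀ ht
  have hanti := (strictAntiOn_radius h1 h2 hτ₀ T).antitoneOn
  have hTT : T ∈ Icc 0 T := right_mem_Icc.2 hT.le
  have hτmin : ∀ t ∈ Icc 0 T, τ T ≤ τ t := fun t ht => hanti ht hTT ht.2
  have hτmax : ∀ t ∈ Icc 0 T, τ t ≤ τ₀ := fun t ht => by
    have := hanti (left_mem_Icc.2 hT.le) ht ht.1
    rwa [radius_zero] at this
  have hF := hu.fourierSolution hr
  obtain ⟨B, hB⟩ := hmem.exists_norm_coef_le hq hT hτc hF.cont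
  have hmaj : ∀ θ : ℝ, θ < 1 → HasMajorant (1 / s) T (fun t => θ * τ t)
      (fun t => vecFourierCoeff (u t)) ((1 - θ) * τ T) B := fun θ hθ =>
    hasMajorant_of_norm_le hθ.le hτmin hB
  have hρ : ∀ θ : ℝ, θ < 1 → 0 < (1 - θ) * τ T := fun θ hθ =>
    mul_pos (sub_pos.2 hθ) (hτpos T hT.le)
  have hE := hK _ B (hρ 0 zero_lt_one) (by simpa using hmaj 0 zero_lt_one)
  have hest : ∀ θ : ℝ, 0 ≤ θ → θ < 1 → ∀ t ∈ Icc 0 T,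
      gev (1 / s) r (θ * τ t) (vecFourierCoeff (u t)) ≤ G ∧
      2 * ν * ∫ t' in (0 : ℝ)..t, gev (1 / s) (r + 1) (θ * τ t') (vecFourierCoeff (u t')) ≤
        X0 + 2 * C * Real.sqrt K * G * T := by
    intro θ hθ0 hθ1 t ht
    refine hF.gev_le_and_integral_le (S := C₁ * τ₀ + C₂ * τ₀ ^ 2)
      (σ' := fun t => θ * -(C₁ * τ t + C₂ * τ t ^ 2)) hr hp0 hp1 hν (hρ θ hθ1) (hmaj θ hθ1)
      (continuousOn_const.mul hτc) (fun t ht => mul_nonneg hθ0 (hτpos t ht.1).le)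
      (fun t ht => (hτd t ht.1.le).const_mul θ) ?_ ?_ hC hprod hE hC₁ hC₂ ?_ hG ht
    · intro t ht
      have hp := hτpos t ht.1.le
      have hm := hτmax t (Ioo_subset_Icc_self ht)
      have hn : 0 ≤ C₁ * τ t + C₂ * τ t ^ 2 := by positivity
      rw [abs_mul, abs_neg, abs_of_nonneg hθ0, abs_of_nonneg hn]
      calc θ * (C₁ * τ t + C₂ * τ t ^ 2) ≤ 1 * (C₁ * τ t + C₂ * τ t ^ 2) := by gcongr
        _ ≤ _ := by rw [one_mul]; gcongr
    · intro t ht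
      have hp := hτpos t ht.1.le
      have h3 : θ * (θ * (C₂ * τ t ^ 2)) ≤ 1 * (θ * (C₂ * τ t ^ 2)) := by gcongr
      linarith
    · refine hX0 _ ?_
      rw [hτdef, radius_zero]
      exact mul_le_of_le_one_left hτ₀.le hθ1.le
  let θ : ℕ → ℝ := fun n => 1 - 1 / ((n : ℝ) + 1)
  have hθlim : Tendsto θ atTop (𝓝 1) := by
    have h3 := (tendsto_one_div_add_atTop_nhds_zero_nat (𝕜 := ℝ)).const_sub (1 : ℝ)
    rwa [sub_zero] at h3
  have hθ0 : ∀ n, 0 ≤ θ n := fun n => by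
    have : 1 / ((n : ℝ) + 1) ≤ 1 :=
      (div_le_one (by positivity)).2 (by linarith [n.cast_nonneg (α := ℝ)])
    exact sub_nonneg.2 this
  have hθ1 : ∀ n, θ n < 1 := fun n => sub_lt_self _ (by positivity)
  have hgev : ∀ n, ∀ e : ℝ, 0 ≤ e → ∀ t ∈ Icc 0 T, gevreyNorm s e (θ n * τ t) (u t) ^ 2 =
      ENNReal.ofReal (gev (1 / s) e (θ n * τ t) (vecFourierCoeff (u t))) := fun n e he t ht =>
    gevreyNorm_sq_eq_ofReal he ((hmaj (θ n) (hθ1 n)).rapid hp0 (hρ _ (hθ1 n)) ht)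
  constructor
  · refine (gevreyNorm_sq_le_liminf s r (τ t) (u t) hθlim).trans ?_
    refine liminf_le_of_le (by isBoundedDefault) fun b hb => ?_
    obtain ⟨n, hn⟩ := hb.exists
    rw [hgev n r hr0 t ht] at hn
    exact hn.trans (ENNReal.ofReal_le_ofReal (hest _ (hθ0 n) (hθ1 n) t ht).1)
  · intro hνpos
    set M := (X0 + 2 * C * Real.sqrt K * G * T) / 2 with hM
    have hst : Icc 0 t ⊆ Icc 0 T := Icc_subset_Icc_right ht.2
    have hcont : ∀ n, ContinuousOn (fun t => gev (1 / s) (r + 1) (θ n * τ t)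
        (vecFourierCoeff (u t))) (Icc 0 t) := fun n =>
      ((hmaj _ (hθ1 n)).continuousOn_gev hp0 (hρ _ (hθ1 n)) (continuousOn_const.mul hτc)
        hF.cont).mono hst
    have hle : ∀ n, ∫⁻ t' in Ioc 0 t, ENNReal.ofReal (gev (1 / s) (r + 1) (θ n * τ t')
        (vecFourierCoeff (u t'))) ≤ ENNReal.ofReal (M / ν) := fun n => by
      rw [← ofReal_integral_eq_lintegral_ofReal
        ((hcont n).integrableOn_Icc.mono_set Ioc_subset_Icc_self)
        (Eventually.of_forall fun _ => gev_nonneg _ _ _ _),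
        ← intervalIntegral.integral_of_le ht.1]
      refine ENNReal.ofReal_le_ofReal ((le_div_iff₀ hνpos).2 ?_)
      have := (hest _ (hθ0 n) (hθ1 n) t ht).2
      rw [hM]
      linarith
    have hfatou : ∫⁻ t' in Ioc 0 t, gevreyNorm s (r + 1) (τ t') (u t') ^ 2 ≤
        ENNReal.ofReal (M / ν) := by
      calc _ ≤ ∫⁻ t' in Ioc 0 t, liminf (fun n => ENNReal.ofReal (gev (1 / s) (r + 1)
            (θ n * τ t') (vecFourierCoeff (u t')))) atTop := by
            refine setLIntegral_mono' measurableSet_Ioc fun t' ht' => ?_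
            refine (gevreyNorm_sq_le_liminf s (r + 1) (τ t') (u t') hθlim).trans (le_of_eq ?_)
            congr 1
            funext n
            exact hgev n (r + 1) (by linarith) t' (hst (Ioc_subset_Icc_self ht'))
        _ ≤ liminf (fun n => ∫⁻ t' in Ioc 0 t, ENNReal.ofReal (gev (1 / s) (r + 1)
            (θ n * τ t') (vecFourierCoeff (u t')))) atTop :=
            lintegral_liminf_le' fun n =>
              (((hcont n).mono Ioc_subset_Icc_self).aemeasurable measurableSet_Ioc).ennreal_ofReal
        _ ≤ _ := by
            refine liminf_le_of_le (by isBoundedDefault) fun b hb => ?_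
            obtain ⟨n, hn⟩ := hb.exists
            exact hn.trans (hle n)
    calc _ ≤ ENNReal.ofReal ν * ENNReal.ofReal (M / ν) := by gcongr
      _ = _ := by
        rw [← ENNReal.ofReal_mul hν, mul_div_cancel₀ _ hνpos.ne']

lemma MemGevrey.gev_le {s r τ₀ : ℝ} {a : R3 → R3} (ha : MemGevrey s r τ₀ a) {τ : ℝ}
    (hτ : τ ≤ τ₀) :
    gev (1 / s) r τ (vecFourierCoeff a) ≤ gev (1 / s) r τ₀ (vecFourierCoeff a) := by
  have hlt : ∑' k : Freq, ENNReal.ofReal (freqNorm k ^ (2 * r) *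
      Real.exp (2 * τ₀ * freqNorm k ^ (1 / s)) * ‖vecFourierCoeff a k‖ ^ 2) < ∞ := by
    rw [← gevreyNorm_sq]
    exact ENNReal.pow_lt_top ha.2
  have hsum := summable_of_tsum_ofReal_lt_top (gev_term_nonneg _ _ _ _) hlt
  have hle : ∀ k : Freq, freqNorm k ^ (2 * r) * Real.exp (2 * τ * freqNorm k ^ (1 / s)) *
      ‖vecFourierCoeff a k‖ ^ 2 ≤ freqNorm k ^ (2 * r) *
      Real.exp (2 * τ₀ * freqNorm k ^ (1 / s)) * ‖vecFourierCoeff a k‖ ^ 2 := fun k => by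
    have hx : 0 ≤ freqNorm k ^ (1 / s) := Real.rpow_nonneg (freqNorm_nonneg k) _
    have hy : 0 ≤ freqNorm k ^ (2 * r) := Real.rpow_nonneg (freqNorm_nonneg k) _
    gcongr
  exact (hsum.of_nonneg_of_le (gev_term_nonneg _ _ _ _) hle).tsum_le_tsum hle hsum

end GevreyNS

theorem proposition3p2 (r s τ₀ T : ℝ) (hr : 9 / 2 < r) (hs : 1 ≤ s) (hτ₀ : 0 < τ₀) (hT : 0 < T)
    (a : R3 → R3) (ha : MemGevrey s r τ₀ a)
    (hlife : ∀ ν : ℝ, 0 ≤ ν → ENNReal.ofReal T < lifespan ν r a) :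
    ∃ C₁ C₂ G M : ℝ, 0 < C₁ ∧ 0 < C₂ ∧ 0 < G ∧ 0 < M ∧
      (radius C₁ C₂ τ₀ 0 = τ₀ ∧
        (∀ t ∈ Icc 0 T, 0 < radius C₁ C₂ τ₀ t) ∧
        DifferentiableOn ℝ (radius C₁ C₂ τ₀) (Icc 0 T) ∧
        StrictAntiOn (radius C₁ C₂ τ₀) (Icc 0 T)) ∧
      (∀ (ν : ℝ) (u : ℝ → R3 → R3), 0 < ν → IsSolution ν r T a u →
        MemLinftyGevrey s r T (radius C₁ C₂ τ₀) u →
        MemL2Gevrey s (r + 1) T (radius C₁ C₂ τ₀) u →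
        ∀ t ∈ Ioc 0 T,
          gevreyNorm s r (radius C₁ C₂ τ₀ t) (u t) ≤ ENNReal.ofReal G ∧
          ENNReal.ofReal ν *
              ∫⁻ t' in Ioc 0 t, gevreyNorm s (r + 1) (radius C₁ C₂ τ₀ t') (u t') ^ 2 ≤
            ENNReal.ofReal M) ∧
      (∀ u : ℝ → R3 → R3, IsSolution 0 r T a u →
        MemLinftyGevrey s (r + 1) T (radius C₁ C₂ τ₀) u →
        ∀ t ∈ Ioc 0 T, gevreyNorm s r (radius C₁ C₂ τ₀ t) (u t) ≤ ENNReal.ofReal G) := by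
  have hp0 : 0 < 1 / s := by positivity
  have hp1 : 1 / s ≤ 1 := (div_le_one (by linarith)).2 hs
  obtain ⟨K, hK⟩ := exists_energy_le (p := 1 / s) hr hp0 hp1 hT.le (vecFourierCoeff a)
    fun ν hν => by
      obtain ⟨U, hU⟩ := exists_isSolution_of_lt_lifespan (hlife ν hν)
      exact ⟨_, hU.fourierSolution hr, hU.initial_coef ha.1⟩
  obtain ⟨C, hC, hprod⟩ := exists_production_le (1 / s) r hr hp0 hp1
  set X0 := gev (1 / s) r τ₀ (vecFourierCoeff a)
  have hX0 : 0 ≤ X0 := gev_nonneg _ _ _ _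
  set G := X0 * Real.exp (2 * C * Real.sqrt K * T) + 1
  have hG : 0 < G := by positivity
  set C₁ := C * Real.sqrt K + 1
  set C₂ := C * Real.sqrt G
  have h1 : 0 < C₁ := by positivity
  have h2 : 0 < C₂ := by positivity
  have hM : 0 < (X0 + 2 * C * Real.sqrt K * G * T) / 2 + 1 := by positivity
  have key := fun {ν q : ℝ} {u : ℝ → R3 → R3} (hν : 0 ≤ ν) (hq : 0 ≤ q)
      (hu : IsSolution ν r T a u) (hmem : MemLinftyGevrey s q T (radius C₁ C₂ τ₀) u)
      {t : ℝ} (ht : t ∈ Ioc 0 T) =>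
    hu.gevrey_bounds (K := K) (X0 := X0) (G := G) hr hs hτ₀ hT hν hq h1 h2 hmem hC.le hprod
      (fun ρ B hρ hB => hK ν hν _ ρ B hρ (hu.fourierSolution hr) hB (hu.initial_coef ha.1))
      (by linarith) le_rfl
      (fun τ hτ => by
        rw [funext (hu.initial_coef ha.1)]
        exact ha.gev_le hτ)
      (lt_add_one _) (Ioc_subset_Icc_self ht)
  refine ⟨C₁, C₂, Real.sqrt G, (X0 + 2 * C * Real.sqrt K * G * T) / 2 + 1, h1, h2,
    Real.sqrt_pos.2 hG, hM, ⟨radius_zero _ _ _, fun t ht => radius_pos h1 h2 hτ₀ ht.1,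
      fun t ht => (hasDerivAt_radius h1 h2 hτ₀ ht.1).differentiableAt.differentiableWithinAt,
      strictAntiOn_radius h1 h2 hτ₀ T⟩, ?_, ?_⟩
  · intro ν u hν hu hmem _ t ht
    have := key hν.le (by linarith) hu hmem ht
    exact ⟨gevreyNorm_le_of_sq_le this.1, (this.2 hν).trans
      (ENNReal.ofReal_le_ofReal (by linarith))⟩
  · intro u hu hmem t ht
    exact gevreyNorm_le_of_sq_le (key le_rfl (by linarith) hu hmem ht).1
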